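/- **Setting.** Let $n\ge 1$. All vectors carry the Euclidean norm and all matrices the induced norm. $\nabla$ denotes the derivative in the first argument (a row vector for scalar functions); $\mathcal K$ is the set of continuous strictly increasing $\alpha:[0,\infty)\to[0,\infty)$ with $\alpha(0)=0$. *Plant and safe set.* $\dot x=f(x)+g(x)u$ with $f:\mathbb R^n\to\mathbb R^n$, $g:\mathbb R^n\to\mathbb R^{n\times m}$ locally Lipschitz, $f(0)=0$; $\mathcal C=\{h\ge 0\}$, $\partial\mathcal C=\{h=0\}$, $\mathrm{Int}(\mathcal C)=\{h>0\}\ni 0$ with $h\in C^1$; $b:\mathrm{Int}(\mathcal C)\to\mathbb R_{\ge0}$ is $C^1$ with $1/\alpha_1(h)\le b\le 1/\alpha_2(h)$ for some $\alpha_1,\alpha_2\in\mathcal K$; $B(x)=(b(x)-b(0))^2$. Say that $F$ has *admissible growth* if $F(x)\le \ell(\|x\|)\|x\|$ on $\mathcal C$ for some positive non-decreasing $\ell$ such that $\ell(\|x\|)\|x\|$ stays bounded as $x$ tends to any point of $\partial\mathcal C$. *Assumption 1.* $\|f\|$ has admissible growth; $\|g(x)\|\ge\underline g>0$ on $\mathcal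 C$; on $\mathrm{Int}(\mathcal C)\cap\mathcal N$, for some neighbourhood $\mathcal N\not\ni0$ of $\partial\mathcal C$, $\nabla b\,g\ne0$. *Assumption 2.* With $r(x,u)=x^TQx+u^TRu$, $Q,R$ symmetric positive definite, there is a $C^1$ positive definite $V^*$ with $\nabla V^*$ locally Lipschitz and $0=\inf_u\{\nabla V^*f+\nabla V^*gu+r(x,u)\}$ for all $x\in\mathbb R^n$. *Approximation.* $\chi\ni0$ is compact, $l>0$, $B_l(x)$ is the closed $l$-ball about $x$; $W:\chi\to\mathbb R^L$ is $C^1$ (near $\chi$); $\phi(y,c(x))=(\phi_j(y,c_j(x)))_{j\le L}$ with $\phi_j$ smooth (near $\chi\times\chi$) positive (semi)definite kernels and $c_j(x)\in\chi\cap B_l(x)$; $x_i(x,t)\in\chi\cap B_l(x)$ for $x\in\chi$, $t\ge0$, $1\le i\le N$; $Y:\mathbb R^n\to\mathbb R^{n\times p}$ is continuous, $\theta\in\mathbb R^p$, $\varepsilon_\theta=f-Y\theta$. Moreover $\|g(x)^T\nabla\phi(x,c(x))^T\|$ has admissible growth. Write $G_R=gR^{-1}g^T$ and $G_\phi=\nabla\phi\,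 G_R\nabla\phi^T$. *Closed loop.* The gains $c_b,k_{c1},k_{c2},k_{a1},k_{a2},\gamma_c,\beta_c$ are positive. With $\hat k(y,x,w)=-\frac12R^{-1}g(y)^T\nabla\phi(y,c(x))^Tw$ let $u=\hat k(x,x,\hat W_a)-\frac{c_b}2R^{-1}g(x)^T\nabla B(x)^T$, $\omega=\nabla\phi(x,c(x))(Y(x)\hat\theta+g(x)u)$, $\rho=1+\gamma_c\omega^T\omega$, $\Lambda=\omega\omega^T/\rho^2$, $\delta_t=r(x,u)+\hat W_c^T\omega$; and let $\omega_i,\rho_i,\Lambda_i,\delta_i,G_{\phi,i}$ be the same expressions with $\nabla\phi,Y,g,r$ evaluated at $x_i=x_i(x,t)$ (centres $c(x)$) and $u$ replaced by $\hat k(x_i,x,\hat W_a)$. A solution on $[t_0,\tau)$, $t_0\ge 0$, $\tau\le\infty$, consists of continuous signals $x,\hat W_c,\Gamma,\hat W_a,\hat\theta$ which, except at locally finitely many times and as long as $x\in\mathrm{Int}(\mathcal C)$, satisfy $\dot x=f+gu$, $$\dot{\hat W}_c=-\Gamma\Big(k_{c1}\tfrac{\omega}{\rho^2}\delta_t+\tfrac{k_{c2}}N\sum_i\tfrac{\omega_i}{\rho_i^2}\delta_i\Big),\qquad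 \dot\Gamma=\beta_c\Gamma-\Gamma\Big(k_{c1}\Lambda+\tfrac{k_{c2}}N\sum_i\Lambda_i\Big)\Gamma,$$ $$\dot{\hat W}_a=\mathrm{proj}\Big\{-k_{a1}(\hat W_a-\hat W_c)-k_{a2}\hat W_a+\tfrac{k_{c1}}{4\rho^2}G_\phi^T\hat W_a\omega^T\hat W_c+\sum_i\tfrac{k_{c2}}{4N\rho_i^2}G_{\phi,i}^T\hat W_a\omega_i^T\hat W_c\Big\}$$ and an identifier law $\dot{\hat\theta}=\psi(\hat\theta,t)$; $\Gamma(t_0)$ is symmetric positive definite. Here $\mathrm{proj}$ is the standard smooth projection for $\Pi=\{\mathcal P\le0\}$ with boundary layer $\{0\le \mathcal P\le\epsilon\}$: $\mathrm{proj}\{\tau\}=\tau$ if $\mathcal P(\hat W_a)\le0$ or $\nabla\mathcal P(\hat W_a)\tau\le0$, and $\mathrm{proj}\{\tau\}=\tau-\min\{1,\mathcal P/\epsilon\}\frac{\nabla\mathcal P^T\nabla\mathcal P}{\|\nabla\mathcal P\|^2}\tau$ otherwise, where $\mathcal P$ is $C^1$ and convex, $\epsilon>0$, $\{\mathcal P\le\epsilon\}$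 is bounded and contains $\hat W_a(t_0)$, and $W(\chi)\subset\Pi$. *Identifier inequality.* There are $K_\theta,D_\theta>0$ and a continuous $V_\theta:\mathbb R^p\times\mathbb R_{\ge0}\to\mathbb R_{\ge 0}$ with $v_1(\|\tilde\theta\|)\le V_\theta(\tilde\theta,t)\le v_2(\|\tilde\theta\|)$ for some $v_1,v_2\in\mathcal K$, differentiable for $t>t_0$, whose derivative along $\dot{\tilde\theta}=-\psi(\theta-\tilde\theta,t)$ satisfies $\dot V_\theta\le-K_\theta\|\tilde\theta\|^2+D_\theta\|\tilde\theta\|$ for all $\tilde\theta$ and all $t>t_0$. *Assumption 3 (for a solution on $[t_0,\infty)$).* There are $T>0$ and $\underline c_1,\underline c_2,\underline c_3\ge0$, not all zero, such that for all $t\ge t_0$: $\underline c_1I\le\int_t^{t+T}\Lambda$, $\underline c_2I\le\int_t^{t+T}\frac1N\sum_i\Lambda_i$, $\underline c_3I\le\frac1N\sum_i\Lambda_i(t)$. *Composite state.* $\tilde W_c=W(x)-\hat W_c$, $\tilde W_a=W(x)-\hat W_a$, $\tilde\theta=\theta-\hat\theta$, $Z=[x^T,\tilde W_c^T,\tilde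 W_a^T,\tilde\theta^T]^T$, $V_L(Z,t)=V^*(x)+\frac12\tilde W_c^T\Gamma^{-1}(t)\tilde W_c+\frac12\tilde W_a^T\tilde W_a+V_\theta(\tilde\theta,t)$. *Constants.* Let $\|\nabla B\|_\infty$ be a finite bound on $\|\nabla B(x(t))\|$ along the solution. $\overline{\|\cdot\|}$ is the supremum over $x\in\chi$ and, for $G_\phi$, $\|G_\phi\|\|W\|$, $\Delta$ and $W^T\nabla\phi Y$, over $x\in\chi$, $y\in\chi\cap B_l(x)$, with $\phi=\phi(y,c(x))$, $W=W(x)$ and all else at $y$. Let $e=\nabla V^*-W^T\nabla\phi$, $\Delta=-ef-W^T\nabla\phi\,\varepsilon_\theta+\frac12W^T\nabla\phi G_Re^T+\frac14eG_Re^T$, let $\nabla\varepsilon$ be the gradient of $V^*-W^T\phi$ for fixed centres, $q=3\sqrt3/\sqrt{\gamma_c}$ and $k_c=k_{c1}+k_{c2}$. Given $0<\underline\Gamma,\overline\Gamma$, put $\underline c=\frac{\underline c_3}2+\frac{\beta_c}{2k_{c2}\overline\Gamma}$, $\kappa=\min\{\lambda_{\min}(Q),\frac{\underline ck_{c2}}4,\frac{k_{a1}+k_{a2}}4,\frac{K_\theta}4\}$,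 $$\iota_x=\overline{\|\nabla Wf\|}+\tfrac12\overline{\|\nabla WG_R\nabla\phi^TW\|}+\tfrac{c_b}2\overline{\|\nabla WG_R\|}\|\nabla B\|_\infty,$$ $$\iota_c=\tfrac{k_{c1}q}{64}c_b^2\overline{\|G_R\|}\|\nabla B\|_\infty^2+\tfrac{k_cq}{16}\overline{\|\Delta\|}+\tfrac{\iota_x}{\underline\Gamma},$$ $$\iota_a=\tfrac12\overline{\|\nabla V^*G_R\nabla\phi^T\|}+k_{a2}\overline{\|W\|}+\tfrac{k_cq}{64}\overline{\|G_\phi\|}\,\overline{\|W\|}^2+\iota_x,$$ $$\iota=\tfrac12\overline{\|\nabla V^*G_R\|}\big(\overline{\|\phi^T\nabla W+\nabla\varepsilon\|}+c_b\|\nabla B\|_\infty\big)+\tfrac{\iota_c^2}{2\underline ck_{c2}}+\tfrac{\iota_a^2}{2(k_{a1}+k_{a2})}+\tfrac{D_\theta^2}{2K_\theta},$$ $$\varphi_a=\tfrac{k_cq}{64}\overline{\|G_\phi\|\|W\|}+\tfrac12\overline{\|\nabla WG_R\nabla\phi^T\|},\qquad \varphi_{c\theta}=\tfrac{k_cq}{16}\overline{\|W^T\nabla\phi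 Y\|},$$ $$\varphi_{ac}=k_{a1}+\tfrac{k_cq}{64}\overline{\|G_\phi\|\|W\|}+\tfrac{c_bk_{c1}q}{32}\overline{\|G_R\nabla\phi^T\|}\|\nabla B\|_\infty+\tfrac1{2\underline\Gamma}\overline{\|\nabla WG_R\nabla\phi^T\|},$$ $$M=\begin{bmatrix}\frac{\underline ck_{c2}}4&-\frac{\varphi_{ac}}2&-\frac{\varphi_{c\theta}}2\\-\frac{\varphi_{ac}}2&\frac{k_{a1}+k_{a2}}4-\varphi_a&0\\-\frac{\varphi_{c\theta}}2&0&\frac{K_\theta}4\end{bmatrix}.$$ **Theorem 2.** Under Assumptions 1–2 and the above: 1. $\mathrm{Int}(\mathcal C)$ is forward invariant: every solution on $[t_0,\tau)$ with $x(t_0)\in\mathrm{Int}(\mathcal C)$ and finite $\|\nabla B\|_\infty$ satisfies $x(t)\in\mathrm{Int}(\mathcal C)$ for all $t\in[t_0,\tau)$. 2. For every solution on $[t_0,\infty)$ with $x(t_0)\in\mathrm{Int}(\mathcal C)$ and finite $\|\nabla B\|_\infty$ that satisfies the identifier inequality and Assumption 3, there are $\underline\Gamma,\overline\Gamma>0$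 with $\underline\Gamma I\le\Gamma(t)=\Gamma(t)^T\le\overline\Gamma I$ for all $t\ge t_0$, and $\eta_1,\eta_2\in\mathcal K$ with $\eta_1(\|Z\|)\le V_L(Z,t)\le\eta_2(\|Z\|)$ for all $t\ge t_0$, $Z\in\chi\times\mathbb R^{2L+p}$. 3. Fix $\underline c_3\ge 0$, $\underline\Gamma,\overline\Gamma>0$, $\|\nabla B\|_\infty\ge 0$, $\eta_1,\eta_2\in\mathcal K$ and $\zeta>0$ such that the closed ball of radius $\zeta$ about $Z=0$ is contained in $\chi\times\mathbb R^{2L+p}$, $$\lambda_{\min}(M)>0,\qquad\sqrt{2\iota/\kappa}<\eta_1^{-1}(\eta_2(\zeta)),$$ and $\eta_1^{-1}(\eta_2(\sqrt{2\iota/\kappa}))$ is defined. Consider all solutions as in 2 for which these are admissible constants and comparison functions, and for which either $x(t)\in\chi$ for all $t\ge t_0$, or $\eta_2(\|Z(t_0)\|)<\eta_1(\zeta)$ and $\eta_2(\sqrt{2\iota/\kappa})<\eta_1(\zeta)$. Along these, $Z$ is uniformly ultimately bounded with ultimate bound $\eta_1^{-1}\circ\eta_2(\sqrt{2\iota/\kappa})$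 (for every $a>0$ there is $T\ge0$, depending neither on $t_0$ nor on the solution, such that $\|Z(t_0)\|\le a$ implies $\|Z(t)\|\le\eta_1^{-1}\circ\eta_2(\sqrt{2\iota/\kappa})$ for all $t\ge t_0+T$); in particular $$\limsup_{t\to\infty}\|Z(t)\|\le\eta_1^{-1}\circ\eta_2\big(\sqrt{2\iota/\kappa}\big).$$ -/

import Mathlib

open Set Filter Topology
open scoped ContDiff RealInnerProductSpace

noncomputable section

namespace SafeMBRL

/-- `ℝᵏ` with its Euclidean norm. -/
abbrev E (k : ℕ) := EuclideanSpace ℝ (Fin k)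

/-- Class `𝒦`: continuous, strictly increasing on `[0, ∞)`, zero at zero. -/
def ClassK (α : ℝ → ℝ) : Prop :=
  ContinuousOn α (Ici 0) ∧ StrictMonoOn α (Ici 0) ∧ α 0 = 0

/-- The smallest eigenvalue (used for symmetric matrices and operators only). -/
def lambdaMin {A : Type*} [Ring A] [Algebra ℝ A] (a : A) : ℝ := sInf (spectrum ℝ a)

/-- Symmetric and positive definite. -/
def PosDefOp {k : ℕ} (A : E k →L[ℝ] E k) : Prop :=
  IsSelfAdjoint A ∧ ∀ v, v ≠ 0 → 0 < ⟪v, A v⟫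

/-- All the data of the plant, of the optimal control problem, of the approximation scheme and of
the learning laws. Matrices are linear maps between Euclidean spaces, so that `‖·‖` is the induced
Euclidean norm. Functions which are meaningful only on a part of the space (`b` on `Int 𝒞`;
`W, φ, c, xi` on `χ`) are total here, with arbitrary values elsewhere. -/
structure Scheme (n m L p N : ℕ) where
  /-- drift -/
  f : E n → E n
  /-- control directions -/
  g : E n → (E m →L[ℝ] E n)
  /-- the safe set is `{h ≥ 0}` -/
  h : E n → ℝ
  /-- candidate control barrier function -/
  b : E n → ℝ
  /-- state weight of the running cost -/
  Q : E n →L[ℝ] E n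
  /-- control weight of the running cost -/
  R : E m →L[ℝ] E m
  /-- optimal value function `V*` -/
  V : E n → ℝ
  /-- compact set over which the approximation takes place -/
  χ : Set (E n)
  /-- radius of the ball that follows the state -/
  l : ℝ
  /-- ideal weights -/
  W : E n → E L
  /-- kernels `φ_j(y, c)` -/
  φ : Fin L → E n → E n → ℝ
  /-- centres `c_j(x)` -/
  c : Fin L → E n → E n
  /-- extrapolation maps `x_i(x, t)` -/
  xi : Fin N → E n → ℝ → E n
  /-- basis for the drift -/
  Y : E n → (E p →L[ℝ] E n)
  /-- ideal drift parameters -/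
  θ : E p
  /-- Lyapunov function of the parameter identifier, `V_θ(θ̃, t)` -/
  Vθ : E p × ℝ → ℝ
  /-- constants of the identifier -/
  Kθ : ℝ
  Dθ : ℝ
  /-- convex function that defines the projection operator -/
  P : E L → ℝ
  /-- width of the boundary layer of the projection operator -/
  εP : ℝ
  /-- gains -/
  cb : ℝ
  kc1 : ℝ
  kc2 : ℝ
  ka1 : ℝ
  ka2 : ℝ
  γc : ℝ
  βc : ℝ

/-- The signals of a closed-loop run: state, critic weights, actor weights, least-squares gain,
parameter estimate, together with the update law `θ̂' = ψ(θ̂, t)` of the parameter identifier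
(its dependence on measured data is part of its dependence on time). -/
structure Run (n L p : ℕ) where
  x : ℝ → E n
  Wc : ℝ → E L
  Wa : ℝ → E L
  Γ : ℝ → (E L →L[ℝ] E L)
  θh : ℝ → E p
  ψ : E p → ℝ → E p

/-- `Γlow I ≤ Γ(t) ≤ Γup I` (with `Γ(t)` symmetric) for all `t ≥ t₀`. -/
def Run.GainBounds {n L p : ℕ} (r : Run n L p) (t₀ Γlow Γup : ℝ) : Prop :=
  ∀ t ≥ t₀, IsSelfAdjoint (r.Γ t) ∧
    ∀ v : E L, Γlow * ‖v‖ ^ 2 ≤ ⟪v, r.Γ t v⟫ ∧ ⟪v, r.Γ t v⟫ ≤ Γup * ‖v‖ ^ 2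

/-- The composite vector `[xᵀ, w_cᵀ, w_aᵀ, ϑᵀ]ᵀ`. -/
def stack {n L p : ℕ} (x : E n) (wc wa : E L) (th : E p) :
    EuclideanSpace ℝ (Fin n ⊕ Fin L ⊕ Fin L ⊕ Fin p) :=
  WithLp.toLp 2 (Sum.elim (fun i => x i)
    (Sum.elim (fun i => wc i) (Sum.elim (fun i => wa i) (fun i => th i))))

/-- Interval of existence `[t₀, τ)`, where `τ = ⊤` is allowed. -/
def timeInterval (t₀ : ℝ) (τ : EReal) : Set ℝ := {t | t₀ ≤ t ∧ (t : EReal) < τ}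

/-- Trajectories are given as pairs of an initial time and a curve. A family of them is uniformly
ultimately bounded with ultimate bound `r` if, for every bound `a` on the initial value, all of
them are within `r` from some time after the start on which depends on `a` only. -/
def UniformlyUltimatelyBounded {F : Type*} [NormedAddCommGroup F]
    (𝓕 : Set (ℝ × (ℝ → F))) (r : ℝ) : Prop :=
  ∀ a > 0, ∃ T ≥ 0, ∀ q ∈ 𝓕, ‖q.2 q.1‖ ≤ a → ∀ t ≥ q.1 + T, ‖q.2 t‖ ≤ r

namespace Scheme

variable {n m L p N : ℕ} (S : Scheme n m L p N)

/-! ### Objects built from the data -/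

/-- The set `𝒞`. -/
def safe : Set (E n) := {x | 0 ≤ S.h x}

/-- The recentred barrier function `B(x) = (b(x) - b(0))²`. -/
def B (x : E n) : ℝ := (S.b x - S.b 0) ^ 2

/-- `∇B(x)ᵀ`. -/
def gradB (x : E n) : E n := gradient S.B x

/-- `∇V*(x)` as a row vector. -/
def dV (x : E n) : E n →L[ℝ] ℝ := fderiv ℝ S.V x

/-- `∇W(x)`. -/
def dW (x : E n) : E n →L[ℝ] E L := fderiv ℝ S.W x

/-- `φ(y, c(x))`. -/
def phi (y x : E n) : E L := WithLp.toLp 2 fun j => S.φ j y (S.c j x)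

/-- `∇φ(y, c(x))`, the derivative in the first argument. -/
def dphi (y x : E n) : E n →L[ℝ] E L := fderiv ℝ (fun z => S.phi z x) y

/-- `∇φ(y, c(x))ᵀ`. -/
def dphiT (y x : E n) : E L →L[ℝ] E n := ContinuousLinearMap.adjoint (S.dphi y x)

/-- `g(x)ᵀ`. -/
def gT (x : E n) : E n →L[ℝ] E m := ContinuousLinearMap.adjoint (S.g x)

/-- `R⁻¹`. -/
def Rinv : E m →L[ℝ] E m := S.R.inverse

/-- `G_R = g R⁻¹ gᵀ`. -/
def GR (y : E n) : E n →L[ℝ] E n := S.g y ∘L S.Rinv ∘L S.gT y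

/-- `G_φ = ∇φ G_R ∇φᵀ` at the point `y`, with centres `c(x)`. -/
def Gphi (y x : E n) : E L →L[ℝ] E L := S.dphi y x ∘L S.GR y ∘L S.dphiT y x

/-- Running cost `r(y, u) = yᵀQy + uᵀRu`. -/
def cost (y : E n) (u : E m) : ℝ := ⟪y, S.Q y⟫ + ⟪u, S.R u⟫

/-- Approximate optimal policy `k̂(y, x, w) = -½ R⁻¹ g(y)ᵀ ∇φ(y, c(x))ᵀ w`. -/
def khat (y x : E n) (w : E L) : E m :=
  -((1 / 2 : ℝ) • S.Rinv (S.gT y (S.dphiT y x w)))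

/-- The policy applied to the plant,
`u = k̂(x, x, Ŵ_a) - (c_b/2) R⁻¹ g(x)ᵀ ∇B(x)ᵀ`. -/
def policy (x : E n) (wa : E L) : E m :=
  S.khat x x wa - (S.cb / 2) • S.Rinv (S.gT x (S.gradB x))

/-- The regressor `ω` along the trajectory. -/
def omega (x : E n) (wa : E L) (th : E p) : E L :=
  S.dphi x x (S.Y x th + S.g x (S.policy x wa))

/-- The regressor at an extrapolated point `y`, under the exploratory policy. -/
def omegaAt (y x : E n) (wa : E L) (th : E p) : E L :=
  S.dphi y x (S.Y y th + S.g y (S.khat y x wa))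

/-- Normalizing signal `ρ = 1 + γ_c ωᵀω`. -/
def rho (w : E L) : ℝ := 1 + S.γc * ⟪w, w⟫

/-- `Λ = ω ωᵀ / ρ²` for the regressor `ω = w`. -/
def Lam (w : E L) : E L →L[ℝ] E L := (1 / S.rho w ^ 2) • (innerSL ℝ w).smulRight w

/-- Bellman error `δ_t` along the trajectory. -/
def delta (x : E n) (wc wa : E L) (th : E p) : ℝ :=
  S.cost x (S.policy x wa) + ⟪wc, S.omega x wa th⟫

/-- Bellman error `δ_i` at an extrapolated point `y`. -/
def deltaAt (y x : E n) (wc wa : E L) (th : E p) : ℝ :=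
  S.cost y (S.khat y x wa) + ⟪wc, S.omegaAt y x wa th⟫

/-- `(1/N) ∑ᵢ Λᵢ` at time `t`. -/
def LamAvg (x : E n) (wa : E L) (th : E p) (t : ℝ) : E L →L[ℝ] E L :=
  (1 / (N : ℝ)) • ∑ i, S.Lam (S.omegaAt (S.xi i x t) x wa th)

/-- The smooth projection operator for the convex set `{P ≤ 0}` with boundary layer
`{0 ≤ P ≤ εP}`, at the current estimate `w`. -/
def proj (w τ : E L) : E L :=
  open Classical in
  if S.P w ≤ 0 ∨ ⟪gradient S.P w, τ⟫ ≤ 0 then τ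
  else τ - (min 1 (S.P w / S.εP) * (⟪gradient S.P w, τ⟫ / ‖gradient S.P w‖ ^ 2)) •
    gradient S.P w

/-- Right-hand side of the critic update law. -/
def critic (x : E n) (wc wa : E L) (Γ : E L →L[ℝ] E L) (th : E p) (t : ℝ) : E L :=
  -(Γ ((S.kc1 / S.rho (S.omega x wa th) ^ 2 * S.delta x wc wa th) • S.omega x wa th
    + (S.kc2 / N) • ∑ i,
      (S.deltaAt (S.xi i x t) x wc wa th / S.rho (S.omegaAt (S.xi i x t) x wa th) ^ 2) •
        S.omegaAt (S.xi i x t) x wa th))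

/-- Right-hand side of the update law of the least-squares gain. -/
def gain (x : E n) (wa : E L) (Γ : E L →L[ℝ] E L) (th : E p) (t : ℝ) : E L →L[ℝ] E L :=
  S.βc • Γ - Γ ∘L (S.kc1 • S.Lam (S.omega x wa th) + S.kc2 • S.LamAvg x wa th t) ∘L Γ

/-- Right-hand side of the actor update law. -/
def actor (x : E n) (wc wa : E L) (th : E p) (t : ℝ) : E L :=
  S.proj wa (-(S.ka1 • (wa - wc)) - S.ka2 • wa
    + (S.kc1 / (4 * S.rho (S.omega x wa th) ^ 2) * ⟪S.omega x wa th, wc⟫) •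
        ContinuousLinearMap.adjoint (S.Gphi x x) wa
    + ∑ i, (S.kc2 / (4 * N * S.rho (S.omegaAt (S.xi i x t) x wa th) ^ 2)
          * ⟪S.omegaAt (S.xi i x t) x wa th, wc⟫) •
        ContinuousLinearMap.adjoint (S.Gphi (S.xi i x t) x) wa)

/-! ### Assumptions on the data -/

/-- Regularity of the plant; the origin is an equilibrium of the drift. -/
structure PlantRegular : Prop where
  f_lip : LocallyLipschitz S.f
  g_lip : LocallyLipschitz S.g
  f_zero : S.f 0 = 0

/-- `𝒞 = {h ≥ 0}`, `∂𝒞 = {h = 0}`, `Int 𝒞 = {h > 0} ∋ 0`, with `h` of class `C¹`. -/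
structure SafeSet : Prop where
  h_smooth : ContDiff ℝ 1 S.h
  boundary : frontier S.safe = {x | S.h x = 0}
  inside : interior S.safe = {x | 0 < S.h x}
  zero_mem : (0 : E n) ∈ interior S.safe

/-- `b : Int 𝒞 → ℝ≥0` is a candidate control barrier function. -/
structure CandidateCBF : Prop where
  smooth : ContDiffOn ℝ 1 S.b (interior S.safe)
  nonneg : ∀ x ∈ interior S.safe, 0 ≤ S.b x
  bounds : ∃ α₁ α₂ : ℝ → ℝ, ClassK α₁ ∧ ClassK α₂ ∧ ∀ x ∈ interior S.safe,
    1 / α₁ (S.h x) ≤ S.b x ∧ S.b x ≤ 1 / α₂ (S.h x)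

/-- `F` is bounded on `𝒞` by `ℓ(‖x‖)‖x‖` for some positive non-decreasing `ℓ`, and
`ℓ(‖x‖)‖x‖` stays finite as `x` tends to `∂𝒞`. -/
def GrowthOnSafe (F : E n → ℝ) : Prop :=
  ∃ ℓ : ℝ → ℝ, (∀ s ≥ 0, 0 < ℓ s) ∧ MonotoneOn ℓ (Ici 0) ∧
    (∀ x ∈ S.safe, F x ≤ ℓ ‖x‖ * ‖x‖) ∧
    ∀ q ∈ frontier S.safe,
      IsBoundedUnder (· ≤ ·) (𝓝[interior S.safe] q) fun x => ℓ ‖x‖ * ‖x‖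

/-- Conditions on the dynamics, the safe set and the barrier function. In the last one `b`, which
lives on `Int 𝒞`, is looked at on the part of the neighbourhood that lies in `Int 𝒞`. -/
structure DynamicsCondition : Prop where
  drift : S.GrowthOnSafe fun x => ‖S.f x‖
  control : ∃ glow > 0, ∀ x ∈ S.safe, glow ≤ ‖S.g x‖
  relative_degree : ∃ U ∈ 𝓝ˢ (frontier S.safe), (0 : E n) ∉ U ∧
    ∀ x ∈ U ∩ interior S.safe, fderiv ℝ S.b x ∘L S.g x ≠ 0

/-- Weights of the cost, and a positive definite `C¹` solution of the HJB equation with locally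
Lipschitz gradient. -/
structure ValueCondition : Prop where
  Q_pos : PosDefOp S.Q
  R_pos : PosDefOp S.R
  smooth : ContDiff ℝ 1 S.V
  zero : S.V 0 = 0
  pos : ∀ x, x ≠ 0 → 0 < S.V x
  hjb : ∀ x, IsGLB (range fun u : E m =>
    S.dV x (S.f x) + S.dV x (S.g x u) + S.cost x u) 0
  grad_lip : LocallyLipschitz S.dV

/-- State-following approximation over the compact set `χ ∋ 0`. The reconstruction errors
`ε(x, y) = V*(y) - W(x)ᵀφ(y, c(x))` and `ε_θ = f - Yθ` are defined by their equations. -/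
structure Approximation : Prop where
  compact : IsCompact S.χ
  zero_mem : (0 : E n) ∈ S.χ
  l_pos : 0 < S.l
  W_smooth : ∃ O, IsOpen O ∧ S.χ ⊆ O ∧ ContDiffOn ℝ 1 S.W O
  φ_smooth : ∀ j, ∃ O, IsOpen O ∧ S.χ ⊆ O ∧
    ContDiffOn ℝ ∞ (fun q : E n × E n => S.φ j q.1 q.2) (O ×ˢ O)
  φ_posdef : ∀ (j : Fin L) (k : ℕ) (q : Fin k → E n), (∀ i, q i ∈ S.χ) →
    (Matrix.of fun i i' => S.φ j (q i) (q i')).PosSemidef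
  centre : ∀ j, ∀ x ∈ S.χ, S.c j x ∈ S.χ ∩ Metric.closedBall x S.l
  extrapolation : ∀ i, ∀ x ∈ S.χ, ∀ t ≥ 0, S.xi i x t ∈ S.χ ∩ Metric.closedBall x S.l
  Y_cont : Continuous S.Y

/-- `V_θ` is continuous, positive definite and decrescent; the constants are positive. -/
structure IdentifierFunction : Prop where
  K_pos : 0 < S.Kθ
  D_pos : 0 < S.Dθ
  cont : ContinuousOn S.Vθ (univ ×ˢ Ici 0)
  bounds : ∃ v₁ v₂ : ℝ → ℝ, ClassK v₁ ∧ ClassK v₂ ∧ ∀ th, ∀ t ≥ 0,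
    v₁ ‖th‖ ≤ S.Vθ (th, t) ∧ S.Vθ (th, t) ≤ v₂ ‖th‖

/-- The projection operator is built on a convex set that contains the ideal weights and whose
boundary layer is bounded. -/
structure ProjectionSet : Prop where
  smooth : ContDiff ℝ 1 S.P
  convex : ConvexOn ℝ univ S.P
  ε_pos : 0 < S.εP
  bounded : Bornology.IsBounded {w | S.P w ≤ S.εP}
  ideal : ∀ x ∈ S.χ, S.P (S.W x) ≤ 0

structure GainsPos : Prop where
  cb_pos : 0 < S.cb
  kc1_pos : 0 < S.kc1
  kc2_pos : 0 < S.kc2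
  ka1_pos : 0 < S.ka1
  ka2_pos : 0 < S.ka2
  γc_pos : 0 < S.γc
  βc_pos : 0 < S.βc

/-- All assumptions on the data. -/
structure Assumptions : Prop where
  plant : S.PlantRegular
  safeSet : S.SafeSet
  cbf : S.CandidateCBF
  dynamics : S.DynamicsCondition
  value : S.ValueCondition
  approx : S.Approximation
  policy_growth : S.GrowthOnSafe fun x => ‖S.gT x ∘L S.dphiT x x‖
  identifier : S.IdentifierFunction
  projection : S.ProjectionSet
  gains : S.GainsPos

/-! ### Closed-loop runs -/

/-- `r` is a solution of the closed loop on `[t₀, τ)`: plant under the policy, critic, gain and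
actor update laws, and identifier. The signals are continuous and satisfy the differential
equations at all times but the elements of a locally finite set (switching instants), as long as
the state is in `Int 𝒞`, where the policy is defined. -/
structure IsSolution (r : Run n L p) (t₀ : ℝ) (τ : EReal) : Prop where
  x_cont : ContinuousOn r.x (timeInterval t₀ τ)
  Wc_cont : ContinuousOn r.Wc (timeInterval t₀ τ)
  Wa_cont : ContinuousOn r.Wa (timeInterval t₀ τ)
  Γ_cont : ContinuousOn r.Γ (timeInterval t₀ τ)
  θh_cont : ContinuousOn r.θh (timeInterval t₀ τ)
  Γ_init : PosDefOp (r.Γ t₀)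
  Wa_init : S.P (r.Wa t₀) ≤ S.εP
  ode : ∃ D : Set ℝ, (∀ s, (D ∩ Icc t₀ s).Finite) ∧
    ∀ t ∈ timeInterval t₀ τ, t₀ < t → t ∉ D → r.x t ∈ interior S.safe →
      HasDerivAt r.x (S.f (r.x t) + S.g (r.x t) (S.policy (r.x t) (r.Wa t))) t ∧
      HasDerivAt r.Wc (S.critic (r.x t) (r.Wc t) (r.Wa t) (r.Γ t) (r.θh t) t) t ∧
      HasDerivAt r.Γ (S.gain (r.x t) (r.Wa t) (r.Γ t) (r.θh t) t) t ∧
      HasDerivAt r.Wa (S.actor (r.x t) (r.Wc t) (r.Wa t) (r.θh t) t) t ∧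
      HasDerivAt r.θh (r.ψ (r.θh t) t) t

/-- `‖∇B(x(·))‖_∞ ≤ Bsup` on `[t₀, τ)` (where `∇B` is defined). -/
def GradBBound (r : Run n L p) (t₀ : ℝ) (τ : EReal) (Bsup : ℝ) : Prop :=
  ∀ t ∈ timeInterval t₀ τ, r.x t ∈ interior S.safe → ‖S.gradB (r.x t)‖ ≤ Bsup

/-- The Lyapunov inequality `V̇_θ ≤ -K_θ‖θ̃‖² + D_θ‖θ̃‖` of the identifier, for all `θ̃`;
here `θ̃ = θ - θ̂`, so that `θ̃' = -ψ(θ - θ̃, t)`. -/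
def IdentifierInequality (r : Run n L p) (t₀ : ℝ) : Prop :=
  ∀ (th : E p), ∀ t > t₀, DifferentiableAt ℝ S.Vθ (th, t) ∧
    fderiv ℝ S.Vθ (th, t) (-r.ψ (S.θ - th) t, 1) ≤ -S.Kθ * ‖th‖ ^ 2 + S.Dθ * ‖th‖

/-- `Λ(t)` along a run. -/
def LamRun (r : Run n L p) (t : ℝ) : E L →L[ℝ] E L :=
  S.Lam (S.omega (r.x t) (r.Wa t) (r.θh t))

/-- `(1/N) ∑ᵢ Λᵢ(t)` along a run. -/
def LamAvgRun (r : Run n L p) (t : ℝ) : E L →L[ℝ] E L :=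
  S.LamAvg (r.x t) (r.Wa t) (r.θh t) t

/-- The excitation condition with window `T` and levels `c₁, c₂, c₃`. -/
def Excitation (r : Run n L p) (t₀ T c₁ c₂ c₃ : ℝ) : Prop :=
  0 < T ∧ 0 ≤ c₁ ∧ 0 ≤ c₂ ∧ 0 ≤ c₃ ∧ (0 < c₁ ∨ 0 < c₂ ∨ 0 < c₃) ∧
  ∀ t ≥ t₀, ∀ v : E L,
    c₁ * ‖v‖ ^ 2 ≤ ∫ s in t..(t + T), ⟪v, S.LamRun r s v⟫ ∧
    c₂ * ‖v‖ ^ 2 ≤ ∫ s in t..(t + T), ⟪v, S.LamAvgRun r s v⟫ ∧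
    c₃ * ‖v‖ ^ 2 ≤ ⟪v, S.LamAvgRun r t v⟫

/-- A run on `[t₀, ∞)` that starts in `Int 𝒞` and meets the identifier inequality and the
excitation condition with third level `c₃`, with `‖∇B(x(·))‖_∞ ≤ Bsup`. -/
structure ExcitedRun (r : Run n L p) (t₀ c₃ Bsup : ℝ) : Prop where
  t₀_nonneg : 0 ≤ t₀
  sol : S.IsSolution r t₀ ⊤
  init : r.x t₀ ∈ interior S.safe
  identifier : S.IdentifierInequality r t₀
  excitation : ∃ T c₁ c₂, S.Excitation r t₀ T c₁ c₂ c₃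
  gradB_bound : S.GradBBound r t₀ ⊤ Bsup

/-- `Int 𝒞` is forward invariant along all solutions of the closed loop, on any interval of
existence, along which `‖∇B(x(·))‖_∞` is finite. -/
def ForwardInvariant : Prop :=
  ∀ (r : Run n L p) (t₀ : ℝ) (τ : EReal), 0 ≤ t₀ → S.IsSolution r t₀ τ →
    r.x t₀ ∈ interior S.safe → (∃ Bsup, S.GradBBound r t₀ τ Bsup) →
    ∀ t ∈ timeInterval t₀ τ, r.x t ∈ interior S.safe

/-- The composite state `Z(t)`. -/
def Z (r : Run n L p) (t : ℝ) : EuclideanSpace ℝ (Fin n ⊕ Fin L ⊕ Fin L ⊕ Fin p) :=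
  stack (r.x t) (S.W (r.x t) - r.Wc t) (S.W (r.x t) - r.Wa t) (S.θ - r.θh t)

/-- The Lyapunov function candidate `V_L(Z, t)`, `Z = [xᵀ, w_cᵀ, w_aᵀ, ϑᵀ]ᵀ`. -/
def VL (r : Run n L p) (x : E n) (wc wa : E L) (th : E p) (t : ℝ) : ℝ :=
  S.V x + 1 / 2 * ⟪wc, (r.Γ t).inverse wc⟫ + 1 / 2 * ⟪wa, wa⟫ + S.Vθ (th, t)

/-- `η₁(‖Z‖) ≤ V_L(Z, t) ≤ η₂(‖Z‖)` for all `t ≥ t₀` and `Z ∈ χ × ℝ^{2L+p}`. -/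
def Sandwich (r : Run n L p) (t₀ : ℝ) (η₁ η₂ : ℝ → ℝ) : Prop :=
  ∀ t ≥ t₀, ∀ x ∈ S.χ, ∀ (wc wa : E L) (th : E p),
    η₁ ‖stack x wc wa th‖ ≤ S.VL r x wc wa th t ∧
    S.VL r x wc wa th t ≤ η₂ ‖stack x wc wa th‖

/-! ### Constants -/

/-- Supremum over `x ∈ χ`. -/
def sup₁ (F : E n → ℝ) : ℝ := sSup (F '' S.χ)

/-- Supremum over `x ∈ χ` and `y ∈ χ ∩ B_l(x)`, for quantities which are evaluated at the
extrapolated points `y = x_i(x, t)` as well as at `y = x`. -/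
def sup₂ (F : E n → E n → ℝ) : ℝ :=
  sSup {a | ∃ x ∈ S.χ, ∃ y ∈ S.χ ∩ Metric.closedBall x S.l, a = F x y}

/-- The residual `Δ` of the Bellman error at `y` for the state `x`, that is
`-e f - Wᵀ∇φ ε_θ + ½ Wᵀ∇φ G_R eᵀ + ¼ e G_R eᵀ` with `e = ∇V* - Wᵀ∇φ`. -/
def Delta (x y : E n) : ℝ :=
  let q : E n := S.dphiT y x (S.W x)
  let e : E n := gradient S.V y - q
  1 / 2 * ⟪q, S.GR y e⟫ + 1 / 4 * ⟪e, S.GR y e⟫ - ⟪e, S.f y⟫ - ⟪q, S.f y - S.Y y S.θ⟫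

/-- `∇ε` in `∇V* = Wᵀ∇φ + φᵀ∇W + ∇ε`: the gradient of `V* - Wᵀφ` for fixed centres. -/
def dEps (x : E n) : E n →L[ℝ] ℝ := fderiv ℝ (fun z => S.V z - ⟪S.W z, S.phi z x⟫) x

/-- `c̲`. -/
def clow (c₃ Γup : ℝ) : ℝ := c₃ / 2 + S.βc / (2 * S.kc2 * Γup)

def kappa (c₃ Γup : ℝ) : ℝ :=
  min (lambdaMin S.Q) (min (S.clow c₃ Γup * S.kc2 / 4) (min ((S.ka1 + S.ka2) / 4) (S.Kθ / 4)))

def iotaX (Bsup : ℝ) : ℝ :=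
  S.sup₁ (fun x => ‖S.dW x (S.f x)‖)
    + 1 / 2 * S.sup₁ (fun x => ‖S.dW x (S.GR x (S.dphiT x x (S.W x)))‖)
    + S.cb / 2 * S.sup₁ (fun x => ‖S.dW x ∘L S.GR x‖) * Bsup

def iotaC (Γlow Bsup : ℝ) : ℝ :=
  S.kc1 * (3 * √3) / (64 * √S.γc) * S.cb ^ 2 * S.sup₁ (fun x => ‖S.GR x‖) * Bsup ^ 2
    + (S.kc1 + S.kc2) * (3 * √3) / (16 * √S.γc) * S.sup₂ (fun x y => |S.Delta x y|)
    + S.iotaX Bsup / Γlow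

def iotaA (Bsup : ℝ) : ℝ :=
  1 / 2 * S.sup₁ (fun x => ‖S.dV x ∘L S.GR x ∘L S.dphiT x x‖)
    + S.ka2 * S.sup₁ (fun x => ‖S.W x‖)
    + (S.kc1 + S.kc2) * (3 * √3) / (64 * √S.γc) * S.sup₂ (fun x y => ‖S.Gphi y x‖)
        * S.sup₁ (fun x => ‖S.W x‖) ^ 2
    + S.iotaX Bsup

def iota (c₃ Γlow Γup Bsup : ℝ) : ℝ :=
  1 / 2 * S.sup₁ (fun x => ‖S.dV x ∘L S.GR x‖)
      * (S.sup₁ (fun x => ‖innerSL ℝ (S.phi x x) ∘L S.dW x + S.dEps x‖) + S.cb * Bsup)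
    + S.iotaC Γlow Bsup ^ 2 / (2 * S.clow c₃ Γup * S.kc2)
    + S.iotaA Bsup ^ 2 / (2 * (S.ka1 + S.ka2))
    + S.Dθ ^ 2 / (2 * S.Kθ)

def phiA : ℝ :=
  (S.kc1 + S.kc2) * (3 * √3) / (64 * √S.γc) * S.sup₂ (fun x y => ‖S.Gphi y x‖ * ‖S.W x‖)
    + 1 / 2 * S.sup₁ (fun x => ‖S.dW x ∘L S.GR x ∘L S.dphiT x x‖)

def phiAC (Γlow Bsup : ℝ) : ℝ :=
  S.ka1
    + (S.kc1 + S.kc2) * (3 * √3) / (64 * √S.γc) * S.sup₂ (fun x y => ‖S.Gphi y x‖ * ‖S.W x‖)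
    + S.cb * S.kc1 * (3 * √3) / (32 * √S.γc) * S.sup₁ (fun x => ‖S.GR x ∘L S.dphiT x x‖) * Bsup
    + 1 / (2 * Γlow) * S.sup₁ (fun x => ‖S.dW x ∘L S.GR x ∘L S.dphiT x x‖)

def phiCθ : ℝ :=
  (S.kc1 + S.kc2) * (3 * √3) / (16 * √S.γc)
    * S.sup₂ (fun x y => ‖innerSL ℝ (S.W x) ∘L S.dphi y x ∘L S.Y y‖)

/-- The matrix `M`. -/
def M (c₃ Γlow Γup Bsup : ℝ) : Matrix (Fin 3) (Fin 3) ℝ :=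
  !![S.clow c₃ Γup * S.kc2 / 4, -S.phiAC Γlow Bsup / 2, -S.phiCθ / 2;
     -S.phiAC Γlow Bsup / 2, (S.ka1 + S.ka2) / 4 - S.phiA, 0;
     -S.phiCθ / 2, 0, S.Kθ / 4]

/-- `√(2ι/κ)`. -/
def mu (c₃ Γlow Γup Bsup : ℝ) : ℝ :=
  √(2 * S.iota c₃ Γlow Γup Bsup / S.kappa c₃ Γup)

/-- The composite states, with their initial times, of all excited runs with the given constants
and comparison functions for which the state stays in `χ`, where the approximation is defined, or
for which the smallness conditions hold that keep `Z` in the ball of radius `ζ`. -/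
def compositeTrajectories (c₃ Γlow Γup Bsup ζ : ℝ) (η₁ η₂ : ℝ → ℝ) :
    Set (ℝ × (ℝ → EuclideanSpace ℝ (Fin n ⊕ Fin L ⊕ Fin L ⊕ Fin p))) :=
  {q | ∃ r : Run n L p, q.2 = S.Z r ∧
    S.ExcitedRun r q.1 c₃ Bsup ∧ r.GainBounds q.1 Γlow Γup ∧ S.Sandwich r q.1 η₁ η₂ ∧
    ((∀ t ≥ q.1, r.x t ∈ S.χ) ∨
      (η₂ ‖S.Z r q.1‖ < η₁ ζ ∧ η₂ (S.mu c₃ Γlow Γup Bsup) < η₁ ζ))}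

end Scheme

end SafeMBRL

end

open SafeMBRL

/-!
The barrier function `B = (b - b(0))²` is infinite on the boundary of the safe set, while along a
run its rate of change is bounded, because `∇B` is; so the state cannot reach the boundary.

With the information matrix `A`, the inverse of the gain solves the linear equation
`(Γ⁻¹)' = A - β Γ⁻¹`. Hence `exp (β t) ⟪v, Γ⁻¹ v⟫` is monotone, and its growth over one excitation
window bounds `Γ⁻¹` from below; boundedness of `A` bounds it from above.

By the Hamilton-Jacobi-Bellman equation, each Bellman error is a polynomial in the weight and
parameter errors plus a residual, and `‖ω‖/ρ²` is at most `3√3/(16√γ_c)`. In the derivative of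
`V_L` half of each negative square, together with the cross terms, forms the quadratic form of `M`;
the linear terms are absorbed by the other halves at the price `ι`. So `V_L` decreases at rate at
least `ι` wherever `‖Z‖ ≥ √(2ι/κ)`, in particular wherever `V_L > η₂(√(2ι/κ))`.
-/

namespace SafeMBRL

/-! ### Comparison principles with finitely many exceptional times -/

section Comparison

open MeasureTheory

variable {F F' ψ : ℝ → ℝ} {D : Set ℝ} {a b : ℝ}

theorem sub_le_integral_of_hasDerivAt_off_finite (hab : a ≤ b) (hD : (D ∩ Ioo a b).Finite)
    (hF : ContinuousOn F (Icc a b)) (hd : ∀ t ∈ Ioo a b, t ∉ D → HasDerivAt F (F' t) t)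
    (hψ : IntegrableOn ψ (Icc a b)) (hle : ∀ t ∈ Ioo a b, t ∉ D → F' t ≤ ψ t) :
    F b - F a ≤ ∫ t in a..b, ψ t := by
  induction hk : (D ∩ Ioo a b).ncard using Nat.strong_induction_on generalizing a b with
  | _ k ih =>
    by_cases hne : (D ∩ Ioo a b).Nonempty
    · obtain ⟨d, hdD, had, hdb⟩ := hne
      have on_part : ∀ a' b', a ≤ a' → a' ≤ b' → b' ≤ b → d ∉ Ioo a' b' →
          F b' - F a' ≤ ∫ t in a'..b', ψ t := fun a' b' ha hab' hb hd' => by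
        have hIoo : Ioo a' b' ⊆ Ioo a b := Ioo_subset_Ioo ha hb
        have hIcc : Icc a' b' ⊆ Icc a b := Icc_subset_Icc ha hb
        have fewer : (D ∩ Ioo a' b').ncard < k :=
          hk ▸ ncard_lt_ncard
            ⟨inter_subset_inter_right _ hIoo, fun h => hd' (h ⟨hdD, had, hdb⟩).2⟩ hD
        exact ih _ fewer hab' (hD.subset (inter_subset_inter_right _ hIoo)) (hF.mono hIcc)
          (fun t ht => hd t (hIoo ht)) (hψ.mono_set hIcc) (fun t ht => hle t (hIoo ht)) rfl
      have intervalIntegrable : ∀ a' b', a ≤ a' → a' ≤ b' → b' ≤ b →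
          IntervalIntegrable ψ volume a' b' := fun a' b' ha hab' hb =>
        (intervalIntegrable_iff_integrableOn_Icc_of_le hab').2 (hψ.mono_set (Icc_subset_Icc ha hb))
      have left := on_part a d le_rfl had.le hdb.le (by simp)
      have right := on_part d b had.le hdb.le le_rfl (by simp)
      rw [← intervalIntegral.integral_add_adjacent_intervals
        (intervalIntegrable a d le_rfl had.le hdb.le) (intervalIntegrable d b had.le hdb.le le_rfl)]
      linarith
    · have hnotMem : ∀ t ∈ Ioo a b, t ∉ D := fun t ht h => hne ⟨t, h, ht⟩
      exact intervalIntegral.sub_le_integral_of_hasDeriv_right_of_le hab hF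
        (fun t ht => (hd t ht (hnotMem t ht)).hasDerivWithinAt) hψ
        (fun t ht => hle t ht (hnotMem t ht))

theorem integral_le_sub_of_hasDerivAt_off_finite (hab : a ≤ b) (hD : (D ∩ Ioo a b).Finite)
    (hF : ContinuousOn F (Icc a b)) (hd : ∀ t ∈ Ioo a b, t ∉ D → HasDerivAt F (F' t) t)
    (hψ : IntegrableOn ψ (Icc a b)) (hle : ∀ t ∈ Ioo a b, t ∉ D → ψ t ≤ F' t) :
    ∫ t in a..b, ψ t ≤ F b - F a := by
  have h := sub_le_integral_of_hasDerivAt_off_finite (F := fun t => -F t) (F' := fun t => -F' t)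
    (ψ := fun t => -ψ t) hab hD hF.neg (fun t ht h => (hd t ht h).neg) hψ.neg
    (fun t ht h => neg_le_neg (hle t ht h))
  rw [intervalIntegral.integral_neg] at h
  linarith

theorem sub_le_mul_of_deriv_le_off_finite {C : ℝ} (hab : a ≤ b) (hD : (D ∩ Ioo a b).Finite)
    (hF : ContinuousOn F (Icc a b)) (hd : ∀ t ∈ Ioo a b, t ∉ D → HasDerivAt F (F' t) t)
    (hle : ∀ t ∈ Ioo a b, t ∉ D → F' t ≤ C) : F b - F a ≤ C * (b - a) := by
  have h := sub_le_integral_of_hasDerivAt_off_finite (ψ := fun _ => C) hab hD hF hd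
    (by simp) hle
  simpa [mul_comm] using h

theorem le_max_of_decreasing_above {m ι : ℝ} (hab : a ≤ b) (hD : (D ∩ Ioo a b).Finite)
    (hι : 0 ≤ ι) (hF : ContinuousOn F (Icc a b))
    (hd : ∀ t ∈ Ioo a b, t ∉ D → HasDerivAt F (F' t) t)
    (hle : ∀ t ∈ Ioo a b, t ∉ D → m < F t → F' t ≤ -ι) :
    F b ≤ max m (F a - ι * (b - a)) := by
  by_contra! hcon
  obtain ⟨hm, hlt⟩ := max_lt_iff.1 hcon
  have decrease : ∀ s ∈ Icc a b, (∀ t ∈ Ioo s b, m < F t) → F b ≤ F s - ι * (b - s) := by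
    intro s hs habove
    have := sub_le_mul_of_deriv_le_off_finite (C := -ι) hs.2
      (hD.subset (inter_subset_inter_right _ (Ioo_subset_Ioo_left hs.1)))
      (hF.mono (Icc_subset_Icc_left hs.1)) (fun t ht => hd t ⟨hs.1.trans_lt ht.1, ht.2⟩)
      (fun t ht h => hle t ⟨hs.1.trans_lt ht.1, ht.2⟩ h (habove t ht))
    linarith
  have hclosed : IsClosed (Icc a b ∩ F ⁻¹' Iic m) :=
    hF.preimage_isClosed_of_isClosed isClosed_Icc isClosed_Iic
  rcases (Icc a b ∩ F ⁻¹' Iic m).eq_empty_or_nonempty with hempty | hne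
  · have := decrease a ⟨le_rfl, hab⟩ fun t ht => not_le.1 fun h =>
      (hempty.subset ⟨Ioo_subset_Icc_self ht, h⟩ : t ∈ (∅ : Set ℝ))
    linarith
  · obtain ⟨s, ⟨hs, hsm : F s ≤ m⟩, hlast⟩ :=
      (isCompact_Icc.of_isClosed_subset hclosed inter_subset_left).exists_isGreatest hne
    have := decrease s hs fun t ht => not_le.1 fun h =>
      ht.1.not_ge (hlast ⟨⟨hs.1.trans ht.1.le, ht.2.le⟩, h⟩)
    linarith [mul_nonneg hι (sub_nonneg.2 hs.2)]

theorem exists_first_exit_time {X : Type*} [TopologicalSpace X] {γ : ℝ → X} {U : Set X}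
    (hγ : ContinuousOn γ (Icc a b)) (hU : IsOpen U) (hab : a ≤ b) (ha : γ a ∈ U) (hb : γ b ∉ U) :
    ∃ s ∈ Ioc a b, γ s ∉ U ∧ ∀ t ∈ Ico a s, γ t ∈ U := by
  have hclosed : IsClosed (Icc a b ∩ γ ⁻¹' Uᶜ) :=
    hγ.preimage_isClosed_of_isClosed isClosed_Icc hU.isClosed_compl
  obtain ⟨s, ⟨hs, hsU⟩, hfirst⟩ := (isCompact_Icc.of_isClosed_subset hclosed
    inter_subset_left).exists_isLeast ⟨b, ⟨hab, le_rfl⟩, hb⟩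
  refine ⟨s, ⟨hs.1.lt_of_ne ?_, hs.2⟩, hsU, fun t ht => ?_⟩
  · rintro rfl
    exact hsU ha
  · by_contra hnot
    exact ht.2.not_ge (hfirst ⟨⟨ht.1, ht.2.le.trans hs.2⟩, hnot⟩)

end Comparison

/-! ### Symmetric operators and their inverses -/

section LinearAlgebra

theorem dotProduct_mulVec_nonneg_of_lambdaMin_pos {k : ℕ} {A : Matrix (Fin k) (Fin k) ℝ}
    (hA : A.IsHermitian) (h : 0 < lambdaMin A) (z : Fin k → ℝ) : 0 ≤ z ⬝ᵥ (A.mulVec z) := by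
  have hbdd : BddBelow (spectrum ℝ A) := Matrix.finite_real_spectrum.bddBelow
  have hpd : A.PosDef := hA.posDef_iff_eigenvalues_pos.2 fun i =>
    h.trans_le (csInf_le hbdd (hA.eigenvalues_mem_spectrum_real i))
  simpa using hpd.posSemidef.dotProduct_mulVec_nonneg z

variable {V : Type*} [NormedAddCommGroup V] [InnerProductSpace ℝ V] {A : V →L[ℝ] V} {low up : ℝ}

theorem norm_apply_le_of_coercive (h : ∀ v, low * ‖v‖ ^ 2 ≤ ⟪v, A v⟫) (v : V) :
    low * ‖v‖ ≤ ‖A v‖ := by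
  rcases (norm_nonneg v).eq_or_lt with h0 | h0
  · simp [← h0]
  · refine le_of_mul_le_mul_left ?_ h0
    calc ‖v‖ * (low * ‖v‖) = low * ‖v‖ ^ 2 := by ring
      _ ≤ ‖v‖ * ‖A v‖ := (h v).trans (real_inner_le_norm v (A v))

theorem abs_inner_apply_le {V₁ : Type*} [NormedAddCommGroup V₁] [NormedSpace ℝ V₁]
    (A : V₁ →L[ℝ] V) (v : V) (w : V₁) : |⟪v, A w⟫| ≤ ‖A‖ * (‖v‖ * ‖w‖) :=
  calc |⟪v, A w⟫| ≤ ‖v‖ * ‖A w‖ := abs_real_inner_le_norm v (A w)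
    _ ≤ ‖v‖ * (‖A‖ * ‖w‖) := by gcongr; exact A.le_opNorm w
    _ = ‖A‖ * (‖v‖ * ‖w‖) := by ring

theorem isSelfAdjoint_inverse [CompleteSpace V] (hA : IsSelfAdjoint A) :
    IsSelfAdjoint A.inverse := by
  rw [← ContinuousLinearMap.ringInverse_eq_inverse]
  exact hA.ringInverse

theorem isSelfAdjoint_of_isSelfAdjoint_inverse [CompleteSpace V] (hu : A.IsInvertible)
    (hA : IsSelfAdjoint A.inverse) : IsSelfAdjoint A :=
  hu.inverse_inverse ▸ isSelfAdjoint_inverse hA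

variable [FiniteDimensional ℝ V]

theorem isInvertible_of_injective (h : Function.Injective A) : A.IsInvertible :=
  ⟨(LinearEquiv.ofInjectiveEndo (A : V →ₗ[ℝ] V) h).toContinuousLinearEquiv, rfl⟩

theorem isInvertible_of_coercive (hlow : 0 < low) (h : ∀ v, low * ‖v‖ ^ 2 ≤ ⟪v, A v⟫) :
    A.IsInvertible :=
  isInvertible_of_injective <| (injective_iff_map_eq_zero A).2 fun v hv => by
    have := norm_apply_le_of_coercive h v
    rw [hv, norm_zero] at this
    exact norm_le_zero_iff.1 (nonpos_of_mul_nonpos_right this hlow)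

theorem norm_inverse_apply_le (hlow : 0 < low) (h : ∀ v, low * ‖v‖ ^ 2 ≤ ⟪v, A v⟫) (v : V) :
    ‖A.inverse v‖ ≤ ‖v‖ / low := by
  have := norm_apply_le_of_coercive h (A.inverse v)
  rw [(isInvertible_of_coercive hlow h).self_apply_inverse] at this
  rwa [le_div_iff₀' hlow]

theorem norm_sq_div_le_inner_inverse (hA : IsSelfAdjoint A) (hlow : 0 < low) (hup : 0 < up)
    (h : ∀ v, low * ‖v‖ ^ 2 ≤ ⟪v, A v⟫ ∧ ⟪v, A v⟫ ≤ up * ‖v‖ ^ 2) (v : V) :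
    ‖v‖ ^ 2 / up ≤ ⟪v, A.inverse v⟫ := by
  set w := A.inverse v
  have hAw : A w = v := (isInvertible_of_coercive hlow fun v => (h v).1).self_apply_inverse v
  have hwAv : ⟪w, A v⟫ = ‖v‖ ^ 2 :=
    calc ⟪w, A v⟫ = ⟪A w, v⟫ := (hA.isSymmetric w v).symm
      _ = ‖v‖ ^ 2 := by rw [hAw, real_inner_self_eq_norm_sq]
  -- the quadratic form of `A` is nonnegative at `A⁻¹ v - v / up`
  have hnonneg : 0 ≤ ⟪w - up⁻¹ • v, A (w - up⁻¹ • v)⟫ := le_trans (by positivity) (h _).1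
  have hexpand : ⟪w - up⁻¹ • v, A (w - up⁻¹ • v)⟫
      = ⟪v, w⟫ - 2 * (‖v‖ ^ 2 / up) + up⁻¹ ^ 2 * ⟪v, A v⟫ := by
    simp only [map_sub, map_smul, hAw, inner_sub_left, inner_sub_right, real_inner_smul_left,
      real_inner_smul_right, hwAv, real_inner_self_eq_norm_sq, real_inner_comm v w]
    ring
  have hquad : up⁻¹ ^ 2 * ⟪v, A v⟫ ≤ ‖v‖ ^ 2 / up :=
    calc up⁻¹ ^ 2 * ⟪v, A v⟫ ≤ up⁻¹ ^ 2 * (up * ‖v‖ ^ 2) := by gcongr; exact (h v).2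
      _ = ‖v‖ ^ 2 / up := by field_simp
  linarith

theorem mem_spectrum_iff_exists_apply_eq_smul {μ : ℝ} :
    μ ∈ spectrum ℝ A ↔ ∃ v, v ≠ 0 ∧ A v = μ • v := by
  have : spectrum ℝ A = spectrum ℝ (A : V →ₗ[ℝ] V) :=
    AlgEquiv.spectrum_eq (Module.End.toContinuousLinearMap V) (A : V →ₗ[ℝ] V)
  rw [this, ← Module.End.hasEigenvalue_iff_mem_spectrum]
  exact ⟨fun h => h.exists_hasEigenvector.imp fun v hv => ⟨hv.2, hv.apply_eq_smul⟩,
    fun ⟨v, hv, hAv⟩ => Module.End.hasEigenvalue_of_hasEigenvector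
      ⟨Module.End.mem_eigenspace_iff.2 hAv, hv⟩⟩

theorem exists_mem_spectrum_le_inner [Nontrivial V] (hA : IsSelfAdjoint A) :
    ∃ μ ∈ spectrum ℝ A, ∀ v, μ * ‖v‖ ^ 2 ≤ ⟪v, A v⟫ := by
  obtain ⟨w, hw⟩ := hA.isSymmetric.hasEigenvalue_iInf_of_finiteDimensional.exists_hasEigenvector
  refine ⟨_, mem_spectrum_iff_exists_apply_eq_smul.2 ⟨w, hw.2, hw.apply_eq_smul⟩, fun v => ?_⟩
  rcases eq_or_ne v 0 with rfl | hv
  · simp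
  have hbdd : BddBelow (range fun x : { x : V // x ≠ 0 } =>
      RCLike.re (inner ℝ ((A : V →ₗ[ℝ] V) x) (x : V)) / ‖(x : V)‖ ^ 2) := by
    refine ⟨-‖A‖, ?_⟩
    rintro _ ⟨x, rfl⟩
    exact neg_le_of_abs_le (A.rayleighQuotient_le_norm x)
  rw [real_inner_comm]
  exact (le_div_iff₀ (by positivity)).1 (ciInf_le hbdd ⟨v, hv⟩)

theorem lambdaMin_mul_norm_sq_le (hA : IsSelfAdjoint A) (v : V) :
    lambdaMin A * ‖v‖ ^ 2 ≤ ⟪v, A v⟫ := by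
  rcases eq_or_ne v 0 with rfl | hv
  · simp
  have : Nontrivial V := ⟨v, 0, hv⟩
  obtain ⟨μ, hμ, hle⟩ := exists_mem_spectrum_le_inner hA
  have hmin : lambdaMin A ≤ μ := csInf_le (spectrum.isCompact A).bddBelow hμ
  exact (mul_le_mul_of_nonneg_right hmin (sq_nonneg _)).trans (hle v)

end LinearAlgebra

namespace PosDefOp

variable {k : ℕ} {A : E k →L[ℝ] E k}

theorem inner_nonneg (hA : PosDefOp A) (v : E k) : 0 ≤ ⟪v, A v⟫ := by
  rcases eq_or_ne v 0 with rfl | hv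
  · simp
  · exact (hA.2 v hv).le

theorem isPositive (hA : PosDefOp A) : A.IsPositive :=
  ⟨hA.1.isSymmetric, fun v => (real_inner_comm _ _).trans_ge (hA.inner_nonneg v)⟩

theorem lambdaMin_pos (hk : 0 < k) (hA : PosDefOp A) : 0 < lambdaMin A := by
  have : Nonempty (Fin k) := ⟨⟨0, hk⟩⟩
  obtain ⟨μ, hμ, -⟩ := exists_mem_spectrum_le_inner hA.1
  have hmem : lambdaMin A ∈ spectrum ℝ A := (spectrum.isCompact A).sInf_mem ⟨μ, hμ⟩
  obtain ⟨v, hv, hAv⟩ := mem_spectrum_iff_exists_apply_eq_smul.1 hmem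
  have h := hA.2 v hv
  rw [hAv, real_inner_smul_right, real_inner_self_eq_norm_sq] at h
  exact pos_of_mul_pos_left h (sq_nonneg _)

theorem exists_coercive (hA : PosDefOp A) : ∃ c > 0, ∀ v, c * ‖v‖ ^ 2 ≤ ⟪v, A v⟫ := by
  rcases Nat.eq_zero_or_pos k with rfl | hk
  · exact ⟨1, one_pos, fun v => by simp [Subsingleton.elim v 0]⟩
  · exact ⟨_, hA.lambdaMin_pos hk, lambdaMin_mul_norm_sq_le hA.1⟩

theorem isInvertible (hA : PosDefOp A) : A.IsInvertible := by
  obtain ⟨c, hc, hcoer⟩ := hA.exists_coercive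
  exact isInvertible_of_coercive hc hcoer

theorem inverse (hA : PosDefOp A) : PosDefOp A.inverse := by
  refine ⟨isSelfAdjoint_inverse hA.1, fun v hv => ?_⟩
  have hne : A.inverse v ≠ 0 := fun h => hv <| by
    rw [← hA.isInvertible.self_apply_inverse v, h, map_zero]
  have := hA.2 _ hne
  rwa [hA.isInvertible.self_apply_inverse, real_inner_comm] at this

end PosDefOp

/-! ### The Riccati flow of the least-squares gain -/

/-- `Γ` solves `Γ' = β Γ - Γ A Γ` on `[t₀, ∞)` off a locally finite set `D`, where `A` takes
positive semidefinite values bounded by `K`. No regularity in time is asked of `A`, which in the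
closed loop depends on arbitrary extrapolation maps. -/
structure GainFlow {k : ℕ} (Γ A : ℝ → (E k →L[ℝ] E k)) (β t₀ K : ℝ) (D : Set ℝ) : Prop where
  cont : ContinuousOn Γ (Ici t₀)
  init : PosDefOp (Γ t₀)
  finite : ∀ s, (D ∩ Icc t₀ s).Finite
  isPositive : ∀ t, (A t).IsPositive
  norm_le : ∀ t, ‖A t‖ ≤ K
  rate_pos : 0 < β
  ode : ∀ t > t₀, t ∉ D → HasDerivAt Γ (β • Γ t - Γ t ∘L A t ∘L Γ t) t

namespace GainFlow

open MeasureTheory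

variable {k : ℕ} {Γ A : ℝ → (E k →L[ℝ] E k)} {β t₀ K t : ℝ} {D : Set ℝ}

theorem finite_inter_Ioo (h : GainFlow Γ A β t₀ K D) {a : ℝ} (ha : t₀ ≤ a) :
    (D ∩ Ioo a t).Finite :=
  (h.finite t).subset
    (inter_subset_inter_right _ (Ioo_subset_Icc_self.trans (Icc_subset_Icc_left ha)))

theorem bound_nonneg (h : GainFlow Γ A β t₀ K D) : 0 ≤ K :=
  (norm_nonneg _).trans (h.norm_le t₀)

theorem hasDerivAt_inverse (h : GainFlow Γ A β t₀ K D) (ht : t₀ < t) (htD : t ∉ D)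
    (hu : (Γ t).IsInvertible) :
    HasDerivAt (fun s => (Γ s).inverse) (A t - β • (Γ t).inverse) t := by
  obtain ⟨u, hu'⟩ := hu
  have hinverse := hasFDerivAt_ringInverse (𝕜 := ℝ) (ContinuousLinearEquiv.toUnit u)
  simp only [ContinuousLinearMap.ringInverse_eq_inverse] at hinverse
  have hd := HasFDerivAt.comp_hasDerivAt_of_eq t hinverse (h.ode t ht htD) hu'
  refine hd.congr_deriv ?_
  ext1 v
  have hinv : (Γ t).inverse = (u.symm : E k →L[ℝ] E k) := by
    rw [← hu', ContinuousLinearMap.inverse_equiv]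
  rw [hinv, ← hu']
  change -(u.symm (β • u (u.symm v) - u (A t (u (u.symm v))))) = A t v - β • u.symm v
  simp

theorem hasDerivAt_exp_inner (h : GainFlow Γ A β t₀ K D) (ht : t₀ < t) (htD : t ∉ D)
    (hu : (Γ t).IsInvertible) (v w : E k) :
    HasDerivAt (fun s => Real.exp (β * s) * ⟪v, (Γ s).inverse w⟫)
      (Real.exp (β * t) * ⟪v, A t w⟫) t := by
  have hexp : HasDerivAt (fun s => Real.exp (β * s)) (Real.exp (β * t) * β) t := by
    simpa using ((hasDerivAt_id t).const_mul β).exp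
  have hinner := (hasDerivAt_const t v).inner ℝ
    ((h.hasDerivAt_inverse ht htD hu).clm_apply (hasDerivAt_const t w))
  refine (hexp.mul hinner).congr_deriv ?_
  simp only [map_zero, inner_zero_left, add_zero, sub_apply, smul_apply,
    inner_sub_right, inner_smul_right]
  ring

theorem continuousOn_inverse (h : GainFlow Γ A β t₀ K D) {s : Set ℝ} (hs : s ⊆ Ici t₀)
    (hu : ∀ t ∈ s, (Γ t).IsInvertible) : ContinuousOn (fun t => (Γ t).inverse) s := fun t ht => by
  obtain ⟨u, hu'⟩ := hu t ht
  have hcont := NormedRing.inverse_continuousAt (ContinuousLinearEquiv.toUnit u)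
  rw [ContinuousLinearMap.ringInverse_eq_inverse] at hcont
  exact ContinuousAt.comp_continuousWithinAt_of_eq hcont (h.cont.mono hs t ht) hu'.symm

theorem continuousOn_exp_inner (h : GainFlow Γ A β t₀ K D) {s : Set ℝ} (hs : s ⊆ Ici t₀)
    (hu : ∀ t ∈ s, (Γ t).IsInvertible) (v w : E k) :
    ContinuousOn (fun s => Real.exp (β * s) * ⟪v, (Γ s).inverse w⟫) s := by
  have hexp : Continuous fun t => Real.exp (β * t) := by fun_prop
  exact hexp.continuousOn.mul
    (continuousOn_const.inner ((h.continuousOn_inverse hs hu).clm_apply continuousOn_const))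

theorem inner_inverse_le (h : GainFlow Γ A β t₀ K D) (ht : t₀ ≤ t)
    (hu : ∀ s ∈ Icc t₀ t, (Γ s).IsInvertible) (v w : E k) :
    ⟪v, (Γ t).inverse w⟫ ≤ (‖(Γ t₀).inverse‖ + K / β) * (‖v‖ * ‖w‖) := by
  have hβ := h.rate_pos
  have hK := h.bound_nonneg
  set C := (‖(Γ t₀).inverse‖ + K / β) * (‖v‖ * ‖w‖) with hC
  have hKC : K * (‖v‖ * ‖w‖) ≤ β * C :=
    calc K * (‖v‖ * ‖w‖) = β * (K / β * (‖v‖ * ‖w‖)) := by field_simp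
      _ ≤ β * C := by rw [hC]; gcongr; exact le_add_of_nonneg_left (norm_nonneg _)
  have hinit : ⟪v, (Γ t₀).inverse w⟫ ≤ C :=
    calc ⟪v, (Γ t₀).inverse w⟫ ≤ ‖(Γ t₀).inverse‖ * (‖v‖ * ‖w‖) :=
          (le_abs_self _).trans (abs_inner_apply_le _ v w)
      _ ≤ C := by rw [hC]; gcongr; exact le_add_of_nonneg_right (by positivity)
  have hderiv : ∀ s, HasDerivAt (fun s => Real.exp (β * s) * C) (Real.exp (β * s) * (β * C)) s :=
    fun s => by simpa [mul_assoc] using (((hasDerivAt_id s).const_mul β).exp).mul_const C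
  -- `e^{βs} (⟪v, Γ(s)⁻¹ w⟫ - C)` is non-increasing
  have hdecr := sub_le_mul_of_deriv_le_off_finite (C := 0) ht (h.finite_inter_Ioo le_rfl)
    ((h.continuousOn_exp_inner Icc_subset_Ici_self hu v w).sub
      (continuous_iff_continuousAt.2 fun s => (hderiv s).continuousAt).continuousOn)
    (fun s hs hsD => (h.hasDerivAt_exp_inner hs.1 hsD (hu s (Ioo_subset_Icc_self hs)) v w).sub
      (hderiv s))
    (fun s _ _ => by
      have hA : ⟪v, A s w⟫ ≤ β * C := calc
        ⟪v, A s w⟫ ≤ ‖A s‖ * (‖v‖ * ‖w‖) := (le_abs_self _).trans (abs_inner_apply_le _ v w)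
        _ ≤ K * (‖v‖ * ‖w‖) := by gcongr; exact h.norm_le s
        _ ≤ β * C := hKC
      exact sub_nonpos.2 (mul_le_mul_of_nonneg_left hA (Real.exp_pos _).le))
  have hscaled : Real.exp (β * t) * ⟪v, (Γ t).inverse w⟫ ≤ Real.exp (β * t) * C := by
    have := mul_le_mul_of_nonneg_left hinit (Real.exp_pos (β * t₀)).le
    simp only [Pi.sub_apply, zero_mul] at hdecr
    linarith
  exact le_of_mul_le_mul_left hscaled (Real.exp_pos _)

theorem norm_inverse_le (h : GainFlow Γ A β t₀ K D) (ht : t₀ ≤ t)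
    (hu : ∀ s ∈ Icc t₀ t, (Γ s).IsInvertible) : ‖(Γ t).inverse‖ ≤ ‖(Γ t₀).inverse‖ + K / β := by
  have hβ := h.rate_pos
  have hK := h.bound_nonneg
  refine ContinuousLinearMap.opNorm_le_bound _ (by positivity) fun w => ?_
  have hinner := h.inner_inverse_le ht hu ((Γ t).inverse w) w
  rw [real_inner_self_eq_norm_sq] at hinner
  rcases (norm_nonneg ((Γ t).inverse w)).eq_or_lt with h0 | h0
  · rw [← h0]; positivity
  · exact le_of_mul_le_mul_left (by linarith) h0

theorem norm_le_mul_norm_apply (h : GainFlow Γ A β t₀ K D) (ht : t₀ ≤ t)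
    (hu : ∀ s ∈ Icc t₀ t, (Γ s).IsInvertible) (v : E k) :
    ‖v‖ ≤ (‖(Γ t₀).inverse‖ + K / β) * ‖Γ t v‖ :=
  calc ‖v‖ = ‖(Γ t).inverse (Γ t v)‖ := by
        rw [(hu t ⟨ht, le_rfl⟩).inverse_apply_self]
    _ ≤ ‖(Γ t).inverse‖ * ‖Γ t v‖ := (Γ t).inverse.le_opNorm _
    _ ≤ _ := by gcongr; exact h.norm_inverse_le ht hu

/-- The bound on `Γ⁻¹` does not depend on the length of the interval on which `Γ` is invertible, so
it passes to the limit at the first time at which `Γ` could be singular. -/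
theorem isInvertible (h : GainFlow Γ A β t₀ K D) (ht : t₀ ≤ t) : (Γ t).IsInvertible := by
  by_contra hcon
  have hcont : ContinuousOn Γ (Icc t₀ t) := h.cont.mono Icc_subset_Ici_self
  obtain ⟨s, ⟨hs, hst⟩, hsing, hinv⟩ := exists_first_exit_time hcont
    (U := range ContinuousLinearEquiv.toContinuousLinearMap) ContinuousLinearEquiv.isOpen ht
    h.init.isInvertible hcon
  set C := ‖(Γ t₀).inverse‖ + K / β
  have hbelow : ∀ v, ‖v‖ ≤ C * ‖Γ s v‖ := fun v => by
    have hle : 𝓝[<] s ≤ 𝓝[Icc t₀ t] s := by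
      rw [← nhdsWithin_Ioo_eq_nhdsLT hs]
      exact nhdsWithin_mono _ (Ioo_subset_Icc_self.trans (Icc_subset_Icc_right hst))
    have htend : Tendsto (fun u => C * ‖Γ u v‖) (𝓝[<] s) (𝓝 (C * ‖Γ s v‖)) :=
      ((((hcont s ⟨hs.le, hst⟩).clm_apply continuousWithinAt_const).mono_left hle).norm).const_mul C
    refine ge_of_tendsto htend ?_
    filter_upwards [Ioo_mem_nhdsLT hs] with u hu
    exact h.norm_le_mul_norm_apply hu.1.le (fun w hw => hinv w ⟨hw.1, hw.2.trans_lt hu.2⟩) v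
  refine hsing (isInvertible_of_injective ((injective_iff_map_eq_zero _).2 fun v hv => ?_))
  simpa [hv] using hbelow v

theorem inner_inverse_comm_le (h : GainFlow Γ A β t₀ K D) (ht : t₀ ≤ t) (v w : E k) :
    ⟪v, (Γ t).inverse w⟫ ≤ ⟪w, (Γ t).inverse v⟫ := by
  have hu : ∀ s ∈ Icc t₀ t, (Γ s).IsInvertible := fun s hs => h.isInvertible hs.1
  have hdiff := sub_le_mul_of_deriv_le_off_finite (C := 0) ht (h.finite_inter_Ioo le_rfl)
    ((h.continuousOn_exp_inner Icc_subset_Ici_self hu v w).sub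
      (h.continuousOn_exp_inner Icc_subset_Ici_self hu w v))
    (fun s hs hsD => (h.hasDerivAt_exp_inner hs.1 hsD (h.isInvertible hs.1.le) v w).sub
      (h.hasDerivAt_exp_inner hs.1 hsD (h.isInvertible hs.1.le) w v))
    (fun s _ _ => by
      have hA : ⟪v, A s w⟫ = ⟪w, A s v⟫ := by
        rw [real_inner_comm]; exact (h.isPositive s).isSymmetric w v
      simp [hA])
  have hinit : ⟪v, (Γ t₀).inverse w⟫ = ⟪w, (Γ t₀).inverse v⟫ := by
    rw [real_inner_comm]; exact h.init.inverse.1.isSymmetric w v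
  simp only [Pi.sub_apply, hinit, sub_self, sub_zero, zero_mul, sub_nonpos] at hdiff
  exact le_of_mul_le_mul_left hdiff (Real.exp_pos _)

theorem isSelfAdjoint (h : GainFlow Γ A β t₀ K D) (ht : t₀ ≤ t) : IsSelfAdjoint (Γ t) := by
  refine isSelfAdjoint_of_isSelfAdjoint_inverse (h.isInvertible ht) ?_
  rw [ContinuousLinearMap.isSelfAdjoint_iff_isSymmetric]
  intro v w
  rw [real_inner_comm]
  exact le_antisymm (h.inner_inverse_comm_le ht w v) (h.inner_inverse_comm_le ht v w)

theorem exp_mul_add_integral_le_inner_inverse (h : GainFlow Γ A β t₀ K D) {a : ℝ} (ha : t₀ ≤ a)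
    (hat : a ≤ t) (v : E k) {ψ : ℝ → ℝ} (hψ : IntegrableOn ψ (Icc a t))
    (hle : ∀ s ∈ Icc a t, ψ s ≤ ⟪v, A s v⟫) :
    Real.exp (-(β * (t - a))) * (⟪v, (Γ a).inverse v⟫ + ∫ s in a..t, ψ s)
      ≤ ⟪v, (Γ t).inverse v⟫ := by
  have hgrowth := integral_le_sub_of_hasDerivAt_off_finite (ψ := fun s => Real.exp (β * a) * ψ s)
    hat (h.finite_inter_Ioo ha)
    (h.continuousOn_exp_inner (fun s hs => ha.trans hs.1)
      (fun s hs => h.isInvertible (ha.trans hs.1)) v v)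
    (fun s hs hsD => h.hasDerivAt_exp_inner (ha.trans_lt hs.1) hsD
      (h.isInvertible (ha.trans hs.1.le)) v v)
    (hψ.const_mul _) (fun s hs _ => calc
      Real.exp (β * a) * ψ s ≤ Real.exp (β * a) * ⟪v, A s v⟫ := by
        gcongr; exact hle s (Ioo_subset_Icc_self hs)
      _ ≤ Real.exp (β * s) * ⟪v, A s v⟫ := by
        have := h.rate_pos.le
        gcongr
        exacts [(h.isPositive s).inner_nonneg_right v, hs.1.le])
  rw [intervalIntegral.integral_const_mul] at hgrowth
  have hexp : Real.exp (β * t) * Real.exp (-(β * (t - a))) = Real.exp (β * a) := by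
    rw [← Real.exp_add]; ring_nf
  refine le_of_mul_le_mul_left ?_ (Real.exp_pos (β * t))
  rw [← mul_assoc, hexp]
  linarith

theorem inner_inverse_nonneg (h : GainFlow Γ A β t₀ K D) (ht : t₀ ≤ t) (v : E k) :
    0 ≤ ⟪v, (Γ t).inverse v⟫ := by
  have := h.exp_mul_add_integral_le_inner_inverse le_rfl ht v (ψ := fun _ => 0) integrableOn_zero
    fun s _ => (h.isPositive s).inner_nonneg_right v
  rw [intervalIntegral.integral_zero, add_zero] at this
  exact (mul_nonneg (Real.exp_pos _).le (h.init.inverse.inner_nonneg v)).trans this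

/-- `A` is persistently exciting, over windows of length `T` and at level `c`. As `A` need not be
measurable, the excitation is carried by an integrable minorant. -/
def Exciting (A : ℝ → (E k →L[ℝ] E k)) (t₀ T c : ℝ) : Prop :=
  ∀ a ≥ t₀, ∀ v ≠ 0, ∃ ψ : ℝ → ℝ, IntegrableOn ψ (Icc a (a + T)) ∧
    (∀ s ∈ Icc a (a + T), ψ s ≤ ⟪v, A s v⟫) ∧ c * ‖v‖ ^ 2 ≤ ∫ s in a..(a + T), ψ s

theorem Exciting.of_integral_le {A A' : ℝ → (E k →L[ℝ] E k)} {T κ c : ℝ} (hT : 0 ≤ T) (hκ : 0 < κ)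
    (hc : 0 < c) (hint : ∀ t ≥ t₀, ∀ v, c * ‖v‖ ^ 2 ≤ ∫ s in t..(t + T), ⟪v, A s v⟫)
    (hle : ∀ t v, κ * ⟪v, A t v⟫ ≤ ⟪v, A' t v⟫) : Exciting A' t₀ T (κ * c) := by
  intro a ha v hv
  have hpos : 0 < c * ‖v‖ ^ 2 := mul_pos hc (pow_pos (norm_pos_iff.2 hv) 2)
  -- a non-integrable quadratic form would have the integral `0`
  have hintegrable : IntervalIntegrable (fun s => ⟪v, A s v⟫) volume a (a + T) :=
    not_imp_comm.1 intervalIntegral.integral_undef (hpos.trans_le (hint a ha v)).ne'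
  refine ⟨fun s => κ * ⟪v, A s v⟫, ((intervalIntegrable_iff_integrableOn_Icc_of_le
    (le_add_of_nonneg_right hT)).1 hintegrable).const_mul κ, fun s _ => hle s v, ?_⟩
  rw [intervalIntegral.integral_const_mul, mul_assoc]
  exact mul_le_mul_of_nonneg_left (hint a ha v) hκ.le

theorem Exciting.of_forall_le {A : ℝ → (E k →L[ℝ] E k)} {T c : ℝ}
    (hle : ∀ t ≥ t₀, ∀ v, c * ‖v‖ ^ 2 ≤ ⟪v, A t v⟫) : Exciting A t₀ T (c * T) := fun a ha v _ =>
  ⟨fun _ => c * ‖v‖ ^ 2, continuous_const.integrableOn_Icc, fun s hs => hle s (ha.trans hs.1) v, by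
    rw [intervalIntegral.integral_const, add_sub_cancel_left, smul_eq_mul]
    exact le_of_eq (by ring)⟩

theorem exists_inverse_coercive (h : GainFlow Γ A β t₀ K D) {T c : ℝ} (hT : 0 < T) (hc : 0 < c)
    (hexc : Exciting A t₀ T c) :
    ∃ q > 0, ∀ t ≥ t₀, ∀ v, q * ‖v‖ ^ 2 ≤ ⟪v, (Γ t).inverse v⟫ := by
  obtain ⟨c₀, hc₀, hcoer⟩ := h.init.inverse.exists_coercive
  refine ⟨Real.exp (-(β * T)) * min c₀ c, by positivity, fun t ht v => ?_⟩
  rcases eq_or_ne v 0 with rfl | hv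
  · simp
  rw [mul_assoc]
  rcases le_total t (t₀ + T) with htT | htT
  · have hevolve := h.exp_mul_add_integral_le_inner_inverse le_rfl ht v (ψ := fun _ => 0)
      integrableOn_zero fun s _ => (h.isPositive s).inner_nonneg_right v
    rw [intervalIntegral.integral_zero, add_zero] at hevolve
    refine le_trans ?_ hevolve
    have := h.rate_pos.le
    gcongr
    · linarith
    · exact (mul_le_mul_of_nonneg_right (min_le_left _ _) (sq_nonneg _)).trans (hcoer v)
  · have ha : t₀ ≤ t - T := by linarith
    obtain ⟨ψ, hψ, hle, hint⟩ := hexc (t - T) ha v hv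
    rw [sub_add_cancel] at hψ hle hint
    have hevolve := h.exp_mul_add_integral_le_inner_inverse ha (by linarith) v hψ hle
    rw [sub_sub_cancel] at hevolve
    refine le_trans ?_ hevolve
    gcongr
    calc min c₀ c * ‖v‖ ^ 2 ≤ c * ‖v‖ ^ 2 := by gcongr; exact min_le_right _ _
      _ ≤ _ := hint.trans (le_add_of_nonneg_left (h.inner_inverse_nonneg ha v))

theorem exists_bounds (h : GainFlow Γ A β t₀ K D) {q : ℝ} (hq : 0 < q)
    (hcoer : ∀ t ≥ t₀, ∀ v, q * ‖v‖ ^ 2 ≤ ⟪v, (Γ t).inverse v⟫) :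
    ∃ low > 0, ∃ up > 0, ∀ t ≥ t₀, ∀ v,
      low * ‖v‖ ^ 2 ≤ ⟪v, Γ t v⟫ ∧ ⟪v, Γ t v⟫ ≤ up * ‖v‖ ^ 2 := by
  have hβ := h.rate_pos
  have hK := h.bound_nonneg
  have : 0 < ‖(Γ t₀).inverse‖ + K / β + 1 := by positivity
  refine ⟨q / (‖(Γ t₀).inverse‖ + K / β + 1) ^ 2, by positivity, 1 / q, by positivity,
    fun t ht v => ⟨?_, ?_⟩⟩
  · have hv : ‖v‖ ≤ (‖(Γ t₀).inverse‖ + K / β + 1) * ‖Γ t v‖ :=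
      (h.norm_le_mul_norm_apply ht (fun s hs => h.isInvertible hs.1) v).trans
        (mul_le_mul_of_nonneg_right (le_add_of_nonneg_right zero_le_one) (norm_nonneg _))
    have hcoerΓ := hcoer t ht (Γ t v)
    rw [(h.isInvertible ht).inverse_apply_self, real_inner_comm] at hcoerΓ
    refine le_trans ?_ hcoerΓ
    rw [div_mul_eq_mul_div, div_le_iff₀ (by positivity), mul_assoc, ← mul_pow, mul_comm ‖Γ t v‖]
    gcongr
  · have hnorm : ‖Γ t v‖ ≤ ‖v‖ / q := by
      have := norm_inverse_apply_le hq (hcoer t ht) v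
      rwa [(h.isInvertible ht).inverse_inverse] at this
    calc ⟪v, Γ t v⟫ ≤ ‖v‖ * (‖v‖ / q) := (real_inner_le_norm v _).trans (by gcongr)
      _ = 1 / q * ‖v‖ ^ 2 := by ring

end GainFlow

/-! ### Bounded maps -/

/-- `F` is bounded in norm on `s`. -/
def BddOn {α V : Type*} [Norm V] (s : Set α) (F : α → V) : Prop := ∃ C, ∀ a ∈ s, ‖F a‖ ≤ C

namespace BddOn

variable {α : Type*} {s : Set α}

theorem const {V : Type*} [Norm V] (v : V) : BddOn s fun _ => v := ⟨‖v‖, fun _ _ => le_rfl⟩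

theorem comp {X V : Type*} [Norm V] {K : Set X} {F : X → V} (hF : BddOn K F) {u : α → X}
    (hu : MapsTo u s K) : BddOn s fun a => F (u a) :=
  hF.imp fun _ hC _ ha => hC _ (hu ha)

theorem of_norm_le {V W : Type*} [Norm V] [Norm W] {F : α → V} {G : α → W} (hG : BddOn s G)
    (h : ∀ a ∈ s, ‖F a‖ ≤ ‖G a‖) : BddOn s F :=
  hG.imp fun _ hC a ha => (h a ha).trans (hC a ha)

theorem le_sSup_image {F : α → ℝ} (hF : BddOn s F) {a : α} (ha : a ∈ s) :
    F a ≤ sSup (F '' s) :=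
  le_csSup (hF.imp fun _ hC => forall_mem_image.2 fun b hb => (le_abs_self _).trans (hC b hb))
    (mem_image_of_mem F ha)

theorem mul {F G : α → ℝ} (hF : BddOn s F) (hG : BddOn s G) : BddOn s fun a => F a * G a := by
  obtain ⟨C, hC⟩ := hF
  obtain ⟨C', hC'⟩ := hG
  exact ⟨C * C', fun a ha => norm_mul_le_of_le (hC a ha) (hC' a ha)⟩

section Add

variable {V : Type*} [SeminormedAddCommGroup V] {F G : α → V}

theorem of_continuousOn {X : Type*} [TopologicalSpace X] {K : Set X} (hK : IsCompact K)
    {F : X → V} (hF : ContinuousOn F K) {u : α → X} (hu : MapsTo u s K) :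
    BddOn s fun a => F (u a) :=
  BddOn.comp (hK.exists_bound_of_continuousOn hF) hu

theorem norm (hF : BddOn s F) : BddOn s fun a => ‖F a‖ :=
  hF.of_norm_le fun _ _ => (norm_norm _).le

theorem neg (hF : BddOn s F) : BddOn s fun a => -F a :=
  hF.of_norm_le fun _ _ => (norm_neg _).le

theorem add (hF : BddOn s F) (hG : BddOn s G) : BddOn s fun a => F a + G a := by
  obtain ⟨C, hC⟩ := hF
  obtain ⟨C', hC'⟩ := hG
  exact ⟨C + C', fun a ha => norm_add_le_of_le (hC a ha) (hC' a ha)⟩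

theorem sub (hF : BddOn s F) (hG : BddOn s G) : BddOn s fun a => F a - G a := by
  simpa only [sub_eq_add_neg] using hF.add hG.neg

theorem sum {ι : Type*} {t : Finset ι} {F : ι → α → V} (hF : ∀ i ∈ t, BddOn s (F i)) :
    BddOn s fun a => ∑ i ∈ t, F i a := by
  choose! C hC using hF
  exact ⟨∑ i ∈ t, C i, fun a ha => norm_sum_le_of_le t fun i hi => hC i hi a ha⟩

end Add

section Linear

variable {V₁ V₂ V₃ : Type*} [SeminormedAddCommGroup V₁] [NormedSpace ℝ V₁]
  [SeminormedAddCommGroup V₂] [NormedSpace ℝ V₂] [SeminormedAddCommGroup V₃] [NormedSpace ℝ V₃]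

theorem clm_comp {F : α → V₂ →L[ℝ] V₃} {G : α → V₁ →L[ℝ] V₂} (hF : BddOn s F)
    (hG : BddOn s G) : BddOn s fun a => F a ∘L G a :=
  (hF.norm.mul hG.norm).of_norm_le fun a _ =>
    ((F a).opNorm_comp_le (G a)).trans (Real.le_norm_self _)

theorem clm_apply {F : α → V₁ →L[ℝ] V₂} {G : α → V₁} (hF : BddOn s F)
    (hG : BddOn s G) : BddOn s fun a => F a (G a) :=
  (hF.norm.mul hG.norm).of_norm_le fun a _ => ((F a).le_opNorm (G a)).trans (Real.le_norm_self _)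

theorem const_smul (c : ℝ) {F : α → V₁} (hF : BddOn s F) : BddOn s fun a => c • F a :=
  ((BddOn.const c).norm.mul hF.norm).of_norm_le fun a _ =>
    (norm_smul c (F a)).le.trans (Real.le_norm_self _)

theorem inner {V : Type*} [SeminormedAddCommGroup V] [InnerProductSpace ℝ V] {F G : α → V}
    (hF : BddOn s F) (hG : BddOn s G) : BddOn s fun a => ⟪F a, G a⟫ :=
  (hF.norm.mul hG.norm).of_norm_le fun a _ =>
    (abs_real_inner_le_norm (F a) (G a)).trans (Real.le_norm_self _)

end Linear

end BddOn

namespace Scheme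

variable {n m L p N : ℕ} {S : Scheme n m L p N}

/-! ### The Hamilton-Jacobi-Bellman equation -/

variable (S) in
/-- The control `u = -½ R⁻¹ g(y)ᵀ v`, which minimises `vᵀ g(y) u + uᵀ R u`. -/
noncomputable def feedback (y v : E n) : E m := -((1 / 2 : ℝ) • S.Rinv (S.gT y v))

theorem khat_eq_feedback (y x : E n) (w : E L) : S.khat y x w = S.feedback y (S.dphiT y x w) := rfl

theorem policy_eq_feedback (x : E n) (wa : E L) :
    S.policy x wa = S.feedback x (S.dphiT x x wa + S.cb • S.gradB x) := by
  simp only [policy, khat, feedback, map_add, map_smul]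
  module

theorem g_feedback (y v : E n) : S.g y (S.feedback y v) = -((1 / 2 : ℝ) • S.GR y v) := by
  simp [feedback, GR]

theorem dV_apply (x v : E n) : S.dV x v = ⟪gradient S.V x, v⟫ := inner_gradient_left.symm

theorem inner_gT (x v : E n) (u : E m) : ⟪S.gT x v, u⟫ = ⟪v, S.g x u⟫ :=
  ContinuousLinearMap.adjoint_inner_left _ _ _

theorem inner_dphiT (y x v : E n) (w : E L) : ⟪S.dphiT y x w, v⟫ = ⟪w, S.dphi y x v⟫ :=
  ContinuousLinearMap.adjoint_inner_left _ _ _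

theorem isPositive_GR (hR : PosDefOp S.R) (y : E n) : (S.GR y).IsPositive :=
  hR.inverse.isPositive.conj_adjoint (S.g y)

theorem isPositive_Gphi (hR : PosDefOp S.R) (y x : E n) : (S.Gphi y x).IsPositive :=
  (isPositive_GR hR y).conj_adjoint (S.dphi y x)

theorem inner_add_inner_R_eq (hR : PosDefOp S.R) (y v : E n) (u : E m) :
    ⟪v, S.g y u⟫ + ⟪u, S.R u⟫
      = ⟪u - S.feedback y v, S.R (u - S.feedback y v)⟫ - 1 / 4 * ⟪v, S.GR y v⟫ := by
  have hRfeedback : S.R (S.feedback y v) = -((1 / 2 : ℝ) • S.gT y v) := by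
    rw [feedback, map_neg, map_smul, Rinv, hR.isInvertible.self_apply_inverse]
  have cross : ⟪S.feedback y v, S.R u⟫ = -(1 / 2 * ⟪v, S.g y u⟫) :=
    calc ⟪S.feedback y v, S.R u⟫ = ⟪S.R (S.feedback y v), u⟫ := (hR.1.isSymmetric _ u).symm
      _ = -(1 / 2 * ⟪v, S.g y u⟫) := by
        rw [hRfeedback, inner_neg_left, real_inner_smul_left, inner_gT]
  have cross' : ⟪u, S.R (S.feedback y v)⟫ = -(1 / 2 * ⟪v, S.g y u⟫) := by
    rw [hRfeedback, inner_neg_right, real_inner_smul_right, real_inner_comm, inner_gT]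
  have square : ⟪S.feedback y v, S.R (S.feedback y v)⟫ = 1 / 4 * ⟪v, S.GR y v⟫ := by
    rw [hRfeedback, inner_neg_right, real_inner_smul_right, real_inner_comm, inner_gT, g_feedback,
      inner_neg_right, real_inner_smul_right]
    ring
  rw [map_sub, inner_sub_left, inner_sub_right, inner_sub_right, cross, cross', square]
  ring

theorem inner_feedback_R (hR : PosDefOp S.R) (y v : E n) :
    ⟪S.feedback y v, S.R (S.feedback y v)⟫ = 1 / 4 * ⟪v, S.GR y v⟫ := by
  have h := inner_add_inner_R_eq hR y v (S.feedback y v)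
  rw [sub_self, inner_zero_left, g_feedback, inner_neg_right, real_inner_smul_right] at h
  linarith

theorem inner_Q_eq_of_hjb (hR : PosDefOp S.R) {x : E n}
    (hjb : IsGLB (range fun u : E m => S.dV x (S.f x) + S.dV x (S.g x u) + S.cost x u) 0) :
    ⟪x, S.Q x⟫ = 1 / 4 * ⟪gradient S.V x, S.GR x (gradient S.V x)⟫ - ⟪gradient S.V x, S.f x⟫ := by
  set v := gradient S.V x
  have complete_square : ∀ u : E m, S.dV x (S.f x) + S.dV x (S.g x u) + S.cost x u
      = ⟪v, S.f x⟫ + ⟪x, S.Q x⟫ - 1 / 4 * ⟪v, S.GR x v⟫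
        + ⟪u - S.feedback x v, S.R (u - S.feedback x v)⟫ := fun u => by
    rw [dV_apply, dV_apply, cost]
    linarith [inner_add_inner_R_eq hR x v u]
  have upper : ⟪v, S.f x⟫ + ⟪x, S.Q x⟫ - 1 / 4 * ⟪v, S.GR x v⟫ ≤ 0 :=
    hjb.2 <| forall_mem_range.2 fun u => by
      rw [complete_square]
      linarith [hR.inner_nonneg (u - S.feedback x v)]
  have lower := hjb.1 ⟨S.feedback x v, rfl⟩
  simp only [complete_square, sub_self, inner_zero_left, add_zero] at lower
  linarith

/-! ### Assumptions on the data -/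

variable (S) in
/-- The properties of the data on which the stability analysis rests, a weakening of `Assumptions`:
`f` and `g` are merely continuous, the barrier function is bounded only from below, the kernels are
only `C¹`, and the gain of the policy is only locally bounded on the safe set. -/
structure WeakAssumptions : Prop where
  f_cont : Continuous S.f
  g_cont : Continuous S.g
  h_cont : Continuous S.h
  interior_safe : interior S.safe = {x | 0 < S.h x}
  b_diff : DifferentiableOn ℝ S.b (interior S.safe)
  b_lower : ∃ α, ClassK α ∧ ∀ x ∈ interior S.safe, 1 / α (S.h x) ≤ S.b x
  policy_bdd : ∀ K, IsCompact K → BddOn (K ∩ interior S.safe) fun x => S.gT x ∘L S.dphiT x x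
  Q_pos : PosDefOp S.Q
  R_pos : PosDefOp S.R
  V_smooth : ContDiff ℝ 1 S.V
  V_zero : S.V 0 = 0
  V_pos : ∀ x, x ≠ 0 → 0 < S.V x
  hjb : ∀ x, IsGLB (range fun u : E m => S.dV x (S.f x) + S.dV x (S.g x u) + S.cost x u) 0
  χ_compact : IsCompact S.χ
  zero_mem_χ : (0 : E n) ∈ S.χ
  l_nonneg : 0 ≤ S.l
  W_smooth : ∃ O, IsOpen O ∧ S.χ ⊆ O ∧ ContDiffOn ℝ 1 S.W O
  φ_smooth : ∀ j, ∃ O, IsOpen O ∧ S.χ ⊆ O ∧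
    ContDiffOn ℝ 1 (fun q : E n × E n => S.φ j q.1 q.2) (O ×ˢ O)
  centre_mem : ∀ j, ∀ x ∈ S.χ, S.c j x ∈ S.χ
  extrapolation : ∀ i, ∀ x ∈ S.χ, ∀ t ≥ 0, S.xi i x t ∈ S.χ ∩ Metric.closedBall x S.l
  Y_cont : Continuous S.Y
  identifier : S.IdentifierFunction
  P_diff : Differentiable ℝ S.P
  P_convex : ConvexOn ℝ univ S.P
  εP_pos : 0 < S.εP
  ideal : ∀ x ∈ S.χ, S.P (S.W x) ≤ 0
  gains : S.GainsPos

theorem GrowthOnSafe.exists_le_of_isCompact {F : E n → ℝ} (hF : S.GrowthOnSafe F) {K : Set (E n)}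
    (hK : IsCompact K) : ∃ C, ∀ x ∈ K ∩ interior S.safe, F x ≤ C := by
  obtain ⟨ℓ, hpos, hmono, hle, -⟩ := hF
  obtain ⟨r, hr⟩ := hK.isBounded.exists_norm_le
  refine ⟨ℓ r * r, fun x hx => (hle x (interior_subset hx.2)).trans ?_⟩
  have hxr := hr x hx.1
  have hr0 : 0 ≤ r := (norm_nonneg x).trans hxr
  have hℓ : ℓ ‖x‖ ≤ ℓ r := hmono (norm_nonneg x) hr0 hxr
  exact mul_le_mul hℓ hxr (norm_nonneg x) (hpos r hr0).le

theorem Assumptions.weaken (hS : S.Assumptions) : S.WeakAssumptions where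
  f_cont := hS.plant.f_lip.continuous
  g_cont := hS.plant.g_lip.continuous
  h_cont := hS.safeSet.h_smooth.continuous
  interior_safe := hS.safeSet.inside
  b_diff := hS.cbf.smooth.differentiableOn one_ne_zero
  b_lower := by
    obtain ⟨α₁, _, hα₁, -, hb⟩ := hS.cbf.bounds
    exact ⟨α₁, hα₁, fun x hx => (hb x hx).1⟩
  policy_bdd _ hK := hS.policy_growth.exists_le_of_isCompact hK
  Q_pos := hS.value.Q_pos
  R_pos := hS.value.R_pos
  V_smooth := hS.value.smooth
  V_zero := hS.value.zero
  V_pos := hS.value.pos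
  hjb := hS.value.hjb
  χ_compact := hS.approx.compact
  zero_mem_χ := hS.approx.zero_mem
  l_nonneg := hS.approx.l_pos.le
  W_smooth := hS.approx.W_smooth
  φ_smooth j := (hS.approx.φ_smooth j).imp fun _ h => ⟨h.1, h.2.1, h.2.2.of_le (by simp)⟩
  centre_mem j x hx := (hS.approx.centre j x hx).1
  extrapolation := hS.approx.extrapolation
  Y_cont := hS.approx.Y_cont
  identifier := hS.identifier
  P_diff := hS.projection.smooth.differentiable one_ne_zero
  P_convex := hS.projection.convex
  εP_pos := hS.projection.ε_pos
  ideal := hS.projection.ideal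
  gains := hS.gains

/-! ### Finiteness of the suprema in the constants -/

theorem WeakAssumptions.contDiffAt_W (hS : S.WeakAssumptions) {x : E n} (hx : x ∈ S.χ) :
    ContDiffAt ℝ 1 S.W x := by
  obtain ⟨O, hO, hχ, hW⟩ := hS.W_smooth
  exact hW.contDiffAt (hO.mem_nhds (hχ hx))

theorem WeakAssumptions.hasFDerivAt_W (hS : S.WeakAssumptions) {x : E n} (hx : x ∈ S.χ) :
    HasFDerivAt S.W (S.dW x) x :=
  ((hS.contDiffAt_W hx).differentiableAt one_ne_zero).hasFDerivAt

theorem WeakAssumptions.hasFDerivAt_V (hS : S.WeakAssumptions) (x : E n) :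
    HasFDerivAt S.V (S.dV x) x :=
  (hS.V_smooth.differentiable one_ne_zero x).hasFDerivAt

theorem WeakAssumptions.hasFDerivAt_phi (hS : S.WeakAssumptions) {y x : E n} (hy : y ∈ S.χ)
    (hx : x ∈ S.χ) :
    HasFDerivAt (fun z => S.phi z x)
      (∑ j, (fderiv ℝ (fun q : E n × E n => S.φ j q.1 q.2) (y, S.c j x) ∘L
        ContinuousLinearMap.inl ℝ (E n) (E n)).smulRight (EuclideanSpace.single j (1 : ℝ))) y := by
  refine hasFDerivWithinAt_univ.1 <| hasFDerivWithinAt_euclidean.2 fun j =>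
    hasFDerivWithinAt_univ.2 ?_
  obtain ⟨O, hO, hχ, hφ⟩ := hS.φ_smooth j
  have hd : DifferentiableAt ℝ (fun q : E n × E n => S.φ j q.1 q.2) (y, S.c j x) :=
    (hφ.differentiableOn one_ne_zero).differentiableAt
      ((hO.prod hO).mem_nhds ⟨hχ hy, hχ (hS.centre_mem j x hx)⟩)
  have hinl : HasFDerivAt (fun z => (z, S.c j x)) (ContinuousLinearMap.inl ℝ (E n) (E n)) y :=
    hasFDerivAt_prodMk_left y (S.c j x)
  have h := HasFDerivAt.comp (f := fun z => (z, S.c j x)) y hd.hasFDerivAt hinl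
  have hproj : PiLp.proj 2 (fun _ : Fin L => ℝ) j ∘L
      (∑ k, (fderiv ℝ (fun q : E n × E n => S.φ k q.1 q.2) (y, S.c k x) ∘L
        ContinuousLinearMap.inl ℝ (E n) (E n)).smulRight (EuclideanSpace.single k (1 : ℝ)))
      = fderiv ℝ (fun q : E n × E n => S.φ j q.1 q.2) (y, S.c j x) ∘L
        ContinuousLinearMap.inl ℝ (E n) (E n) := by
    ext v
    simp
  rw [hproj]
  exact h

theorem WeakAssumptions.hasFDerivAt_phi_dphi (hS : S.WeakAssumptions) {y x : E n} (hy : y ∈ S.χ)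
    (hx : x ∈ S.χ) : HasFDerivAt (fun z => S.phi z x) (S.dphi y x) y :=
  (hS.hasFDerivAt_phi hy hx).differentiableAt.hasFDerivAt

section Bounded

variable {α : Type*} {s : Set α} {u w : α → E n}

theorem bddOn_f (hS : S.WeakAssumptions) (hu : MapsTo u s S.χ) : BddOn s fun a => S.f (u a) :=
  BddOn.of_continuousOn hS.χ_compact hS.f_cont.continuousOn hu

theorem bddOn_g (hS : S.WeakAssumptions) (hu : MapsTo u s S.χ) : BddOn s fun a => S.g (u a) :=
  BddOn.of_continuousOn hS.χ_compact hS.g_cont.continuousOn hu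

theorem bddOn_Y (hS : S.WeakAssumptions) (hu : MapsTo u s S.χ) : BddOn s fun a => S.Y (u a) :=
  BddOn.of_continuousOn hS.χ_compact hS.Y_cont.continuousOn hu

theorem bddOn_dV (hS : S.WeakAssumptions) (hu : MapsTo u s S.χ) : BddOn s fun a => S.dV (u a) :=
  BddOn.of_continuousOn hS.χ_compact
    (hS.V_smooth.continuous_fderiv one_ne_zero).continuousOn hu

theorem bddOn_gradV (hS : S.WeakAssumptions) (hu : MapsTo u s S.χ) :
    BddOn s fun a => gradient S.V (u a) :=
  (bddOn_dV hS hu).of_norm_le fun a _ => by simp [gradient, dV]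

theorem bddOn_W (hS : S.WeakAssumptions) (hu : MapsTo u s S.χ) : BddOn s fun a => S.W (u a) :=
  BddOn.of_continuousOn hS.χ_compact
    (fun _ hx => (hS.contDiffAt_W hx).continuousAt.continuousWithinAt) hu

theorem bddOn_dW (hS : S.WeakAssumptions) (hu : MapsTo u s S.χ) : BddOn s fun a => S.dW (u a) := by
  obtain ⟨O, hO, hχ, hW⟩ := hS.W_smooth
  exact BddOn.of_continuousOn hS.χ_compact
    ((hW.continuousOn_fderiv_of_isOpen hO le_rfl).mono hχ) hu

theorem bddOn_dphi (hS : S.WeakAssumptions) (hu : MapsTo u s S.χ) (hw : MapsTo w s S.χ) :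
    BddOn s fun a => S.dphi (u a) (w a) := by
  have hsum : BddOn s fun a => ∑ j, (fderiv ℝ (fun q : E n × E n => S.φ j q.1 q.2)
      (u a, S.c j (w a)) ∘L ContinuousLinearMap.inl ℝ (E n) (E n)).smulRight
        (EuclideanSpace.single j (1 : ℝ)) := by
    refine BddOn.sum fun j _ => ?_
    obtain ⟨O, hO, hχ, hφ⟩ := hS.φ_smooth j
    have hpair : MapsTo (fun a => (u a, S.c j (w a))) s (S.χ ×ˢ S.χ) := fun a ha =>
      ⟨hu ha, hS.centre_mem j _ (hw ha)⟩
    have hfderiv := BddOn.of_continuousOn (hS.χ_compact.prod hS.χ_compact)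
      ((hφ.continuousOn_fderiv_of_isOpen (hO.prod hO) le_rfl).mono (prod_mono hχ hχ)) hpair
    exact (hfderiv.clm_comp
      (BddOn.const (ContinuousLinearMap.inl ℝ (E n) (E n)))).of_norm_le fun a _ => by simp
  exact hsum.of_norm_le fun a ha => by
    rw [dphi, (hS.hasFDerivAt_phi (hu ha) (hw ha)).fderiv]

theorem bddOn_dphiT (hS : S.WeakAssumptions) (hu : MapsTo u s S.χ) (hw : MapsTo w s S.χ) :
    BddOn s fun a => S.dphiT (u a) (w a) :=
  (bddOn_dphi hS hu hw).of_norm_le fun a _ => by simp [dphiT]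

theorem bddOn_GR (hS : S.WeakAssumptions) (hu : MapsTo u s S.χ) : BddOn s fun a => S.GR (u a) :=
  (bddOn_g hS hu).clm_comp ((BddOn.const S.Rinv).clm_comp
    ((bddOn_g hS hu).of_norm_le fun a _ => by simp [gT]))

theorem bddOn_Gphi (hS : S.WeakAssumptions) (hu : MapsTo u s S.χ) (hw : MapsTo w s S.χ) :
    BddOn s fun a => S.Gphi (u a) (w a) :=
  (bddOn_dphi hS hu hw).clm_comp ((bddOn_GR hS hu).clm_comp (bddOn_dphiT hS hu hw))

theorem bddOn_Delta (hS : S.WeakAssumptions) (hu : MapsTo u s S.χ) (hw : MapsTo w s S.χ) :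
    BddOn s fun a => S.Delta (w a) (u a) := by
  have hq := (bddOn_dphiT hS hu hw).clm_apply (bddOn_W hS hw)
  have he := (bddOn_gradV hS hu).sub hq
  have hG := bddOn_GR hS hu
  have hf := bddOn_f hS hu
  exact ((((BddOn.const (1 / 2 : ℝ)).mul (hq.inner (hG.clm_apply he))).add
    ((BddOn.const (1 / 4 : ℝ)).mul (he.inner (hG.clm_apply he)))).sub (he.inner hf)).sub
    (hq.inner (hf.sub ((bddOn_Y hS hu).clm_apply (BddOn.const S.θ))))

end Bounded

theorem le_sup₁ {F : E n → ℝ} (hF : BddOn S.χ F) {x : E n} (hx : x ∈ S.χ) : F x ≤ S.sup₁ F :=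
  hF.le_sSup_image hx

theorem le_sup₂ {F : E n → E n → ℝ} (hF : BddOn (S.χ ×ˢ S.χ) fun q => F q.1 q.2) {x y : E n}
    (hx : x ∈ S.χ) (hy : y ∈ S.χ ∩ Metric.closedBall x S.l) : F x y ≤ S.sup₂ F := by
  obtain ⟨C, hC⟩ := hF
  refine le_csSup ⟨C, ?_⟩ ⟨x, hx, y, hy, rfl⟩
  rintro _ ⟨x, hx, y, hy, rfl⟩
  exact (le_abs_self _).trans (hC (x, y) ⟨hx, hy.1⟩)

theorem inner_phi_dW_add_dEps (hS : S.WeakAssumptions) {x : E n} (hx : x ∈ S.χ) :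
    innerSL ℝ (S.phi x x) ∘L S.dW x + S.dEps x = S.dV x - innerSL ℝ (S.W x) ∘L S.dphi x x := by
  have hEps : S.dEps x = _ := ((hS.hasFDerivAt_V x).sub
    ((hS.hasFDerivAt_W hx).inner ℝ (hS.hasFDerivAt_phi_dphi hx hx))).fderiv
  rw [hEps]
  ext v
  simp only [add_apply, sub_apply, ContinuousLinearMap.comp_apply, innerSL_apply_apply,
    fderivInnerCLM_apply, ContinuousLinearMap.prod_apply]
  rw [real_inner_comm (S.phi x x)]
  ring

theorem bddOn_phi_dW_add_dEps (hS : S.WeakAssumptions) :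
    BddOn S.χ fun x => innerSL ℝ (S.phi x x) ∘L S.dW x + S.dEps x := by
  have hW : BddOn S.χ fun x => innerSL ℝ (S.W x) :=
    (bddOn_W hS (mapsTo_id _)).of_norm_le fun _ _ => by simp
  exact ((bddOn_dV hS (mapsTo_id _)).sub (hW.clm_comp (bddOn_dphi hS (mapsTo_id _)
    (mapsTo_id _)))).of_norm_le fun x hx => by rw [inner_phi_dW_add_dEps hS hx]; rfl

end Scheme

/-! ### Forward invariance of the safe set -/

namespace ClassK

variable {α : ℝ → ℝ} {s : ℝ}

theorem pos (hα : ClassK α) (hs : 0 < s) : 0 < α s := by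
  simpa only [hα.2.2] using hα.2.1 self_mem_Ici hs.le hs

theorem nonneg (hα : ClassK α) (hs : 0 ≤ s) : 0 ≤ α s := by
  simpa only [hα.2.2] using hα.2.1.monotoneOn self_mem_Ici hs hs

theorem tendsto_nhdsGT_zero (hα : ClassK α) : Tendsto α (𝓝[>] 0) (𝓝[>] 0) := by
  refine tendsto_nhdsWithin_iff.2 ⟨?_, ?_⟩
  · simpa only [hα.2.2] using
      (hα.1 0 self_mem_Ici).mono_left (nhdsWithin_mono 0 Ioi_subset_Ici_self)
  · filter_upwards [self_mem_nhdsWithin] with s hs using hα.pos hs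

end ClassK

theorem Icc_subset_timeInterval {t₀ t : ℝ} {τ : EReal} (ht : t ∈ timeInterval t₀ τ) :
    Icc t₀ t ⊆ timeInterval t₀ τ := fun _ hs =>
  ⟨hs.1, (EReal.coe_le_coe_iff.2 hs.2).trans_lt ht.2⟩

theorem timeInterval_top (t₀ : ℝ) : timeInterval t₀ ⊤ = Ici t₀ := by
  ext t
  simp [timeInterval]

namespace Scheme

variable {n m L p N : ℕ} {S : Scheme n m L p N}

theorem hasGradientAt_B (hb : DifferentiableOn ℝ S.b (interior S.safe)) {x : E n}
    (hx : x ∈ interior S.safe) : HasGradientAt S.B (S.gradB x) x :=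
  (((hb.differentiableAt (isOpen_interior.mem_nhds hx)).sub_const _).pow 2).hasGradientAt

theorem tendsto_B_atTop {α : ℝ → ℝ} (hα : ClassK α) {ι : Type*} {l : Filter ι} {x : ι → E n}
    (hb : ∀ᶠ i in l, 1 / α (S.h (x i)) ≤ S.b (x i))
    (hx : Tendsto (fun i => S.h (x i)) l (𝓝[>] 0)) :
    Tendsto (fun i => S.B (x i)) l atTop := by
  have hbtop : Tendsto (fun i => S.b (x i)) l atTop := by
    refine tendsto_atTop_mono' l ?_ ((hα.tendsto_nhdsGT_zero.comp hx).inv_tendsto_nhdsGT_zero)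
    filter_upwards [hb] with i hi
    exact (one_div _).symm.trans_le hi
  exact (tendsto_pow_atTop two_ne_zero).comp (tendsto_atTop_add_const_right _ (-S.b 0) hbtop)

theorem bddOn_closedLoop (hS : S.WeakAssumptions) {α : Type*} {s : Set α} {K : Set (E n)}
    (hK : IsCompact K) {x : α → E n} {wa : α → E L} (hx : MapsTo x s (K ∩ interior S.safe))
    (hwa : BddOn s wa) (hB : BddOn s fun a => S.gradB (x a)) :
    BddOn s fun a => S.f (x a) + S.g (x a) (S.policy (x a) (wa a)) := by
  have hxK : MapsTo x s K := fun a ha => (hx ha).1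
  have hg := BddOn.of_continuousOn hK hS.g_cont.continuousOn hxK
  have hgT : BddOn s fun a => S.gT (x a) := hg.of_norm_le fun a _ => by simp [gT]
  have hR := BddOn.const (s := s) S.Rinv
  have hpolicy : BddOn s fun a => S.policy (x a) (wa a) :=
    ((hR.clm_apply (((hS.policy_bdd K hK).comp hx).clm_apply hwa)).const_smul _).neg.sub
      ((hR.clm_apply (hgT.clm_apply hB)).const_smul _)
  exact (BddOn.of_continuousOn hK hS.f_cont.continuousOn hxK).add (hg.clm_apply hpolicy)

section Exit

variable {r : Run n L p} {t₀ Bsup t : ℝ} {τ : EReal}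

theorem IsSolution.exists_B_le (hS : S.WeakAssumptions) (hr : S.IsSolution r t₀ τ)
    (hB : S.GradBBound r t₀ τ Bsup) (ht : t ∈ timeInterval t₀ τ)
    (hin : ∀ s ∈ Ico t₀ t, r.x s ∈ interior S.safe) : ∃ C, ∀ s ∈ Ico t₀ t, S.B (r.x s) ≤ C := by
  have hI := Icc_subset_timeInterval ht
  have hxc := hr.x_cont.mono hI
  have hgradB : BddOn (Ico t₀ t) fun s => S.gradB (r.x s) :=
    ⟨Bsup, fun s hs => hB s (hI (Ico_subset_Icc_self hs)) (hin s hs)⟩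
  have hspeed := bddOn_closedLoop hS (isCompact_Icc.image_of_continuousOn hxc)
    (fun s hs => ⟨mem_image_of_mem r.x (Ico_subset_Icc_self hs), hin s hs⟩)
    (BddOn.of_continuousOn isCompact_Icc (hr.Wa_cont.mono hI)
      fun s hs => Ico_subset_Icc_self hs) hgradB
  obtain ⟨C, hC⟩ := hgradB.inner hspeed
  obtain ⟨D, hD, hode⟩ := hr.ode
  refine ⟨S.B (r.x t₀) + C * (t - t₀), fun s hs => ?_⟩
  have hC0 : 0 ≤ C := (norm_nonneg _).trans (hC s hs)
  have hinIoo : ∀ u ∈ Ioo t₀ s, u ∈ Ico t₀ t := fun u hu => ⟨hu.1.le, hu.2.trans hs.2⟩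
  have hBcont : ContinuousOn (fun u => S.B (r.x u)) (Icc t₀ s) := fun u hu =>
    have hu' := hin u ⟨hu.1, hu.2.trans_lt hs.2⟩
    (hasGradientAt_B hS.b_diff hu').continuousAt.comp_continuousWithinAt
      (hxc.mono (Icc_subset_Icc_right hs.2.le) u hu)
  have hgrowth := sub_le_mul_of_deriv_le_off_finite hs.1
    ((hD s).subset (inter_subset_inter_right _ Ioo_subset_Icc_self)) hBcont
    (fun u hu huD => (hasGradientAt_B hS.b_diff (hin u (hinIoo u hu))).hasFDerivAt.comp_hasDerivAt u
      (hode u (hI (Ico_subset_Icc_self (hinIoo u hu))) hu.1 huD (hin u (hinIoo u hu))).1)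
    (fun u hu _ => (le_abs_self _).trans (hC u (hinIoo u hu)))
  have := mul_le_mul_of_nonneg_left (sub_le_sub_right hs.2.le t₀) hC0
  linarith

/-- `B` grows at a bounded rate but blows up at the boundary, which therefore is never reached. -/
theorem forwardInvariant (hS : S.WeakAssumptions) : S.ForwardInvariant := by
  intro r t₀ τ _ hr hinit ⟨Bsup, hB⟩ t₁ ht₁
  by_contra hout
  obtain ⟨t, ht, htout, hin⟩ := exists_first_exit_time
    (hr.x_cont.mono (Icc_subset_timeInterval ht₁)) isOpen_interior ht₁.1 hinit hout
  have htI : t ∈ timeInterval t₀ τ := Icc_subset_timeInterval ht₁ ⟨ht.1.le, ht.2⟩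
  have hleft : ∀ᶠ s in 𝓝[<] t, s ∈ Ico t₀ t := Ico_mem_nhdsLT ht.1
  have hhin : ∀ᶠ s in 𝓝[<] t, 0 < S.h (r.x s) :=
    hleft.mono fun s hs => hS.interior_safe.subset (hin s hs)
  have hhcont : Tendsto (fun s => S.h (r.x s)) (𝓝[<] t) (𝓝 (S.h (r.x t))) :=
    ((hS.h_cont.comp_continuousOn (hr.x_cont.mono (Icc_subset_timeInterval htI))) t
      ⟨ht.1.le, le_rfl⟩).mono_left
        (nhdsWithin_le_of_mem (mem_of_superset hleft Ico_subset_Icc_self))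
  have hzero : S.h (r.x t) = 0 :=
    le_antisymm (not_lt.1 fun h => htout (hS.interior_safe.superset h))
      (ge_of_tendsto hhcont (hhin.mono fun s hs => hs.le))
  obtain ⟨α, hα, hb⟩ := hS.b_lower
  have hBtop : Tendsto (fun s => S.B (r.x s)) (𝓝[<] t) atTop :=
    tendsto_B_atTop hα (hleft.mono fun s hs => hb _ (hin s hs))
      (tendsto_nhdsWithin_iff.2 ⟨hzero ▸ hhcont, hhin⟩)
  obtain ⟨C, hC⟩ := hr.exists_B_le hS hB htI hin
  obtain ⟨s, hs, hCs⟩ := (hleft.and (hBtop.eventually_gt_atTop C)).exists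
  exact (hC s hs).not_gt hCs

end Exit

theorem ExcitedRun.mem_interior (hS : S.WeakAssumptions) {r : Run n L p} {t₀ c₃ Bsup t : ℝ}
    (hr : S.ExcitedRun r t₀ c₃ Bsup) (ht : t₀ ≤ t) : r.x t ∈ interior S.safe :=
  forwardInvariant hS r t₀ ⊤ hr.t₀_nonneg hr.sol hr.init ⟨Bsup, hr.gradB_bound⟩ t
    ((timeInterval_top t₀).superset ht)

/-! ### Bounds on the gain along a run -/

theorem rho_pos (hγ : 0 ≤ S.γc) (w : E L) : 0 < S.rho w := by
  have := real_inner_self_nonneg (x := w)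
  rw [rho]
  positivity

theorem inner_Lam (w v : E L) : ⟪v, S.Lam w v⟫ = ⟪w, v⟫ ^ 2 / S.rho w ^ 2 := by
  rw [Lam, smul_apply, ContinuousLinearMap.smulRight_apply, innerSL_apply_apply,
    real_inner_smul_right, real_inner_smul_right, real_inner_comm]
  ring

theorem isPositive_Lam (w : E L) : (S.Lam w).IsPositive :=
  (InnerProductSpace.isPositive_rankOne_self w).smul_of_nonneg (by positivity)

theorem isPositive_LamAvg (x : E n) (wa : E L) (th : E p) (t : ℝ) :
    (S.LamAvg x wa th t).IsPositive := by
  refine ContinuousLinearMap.IsPositive.smul_of_nonneg ?_ (by positivity)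
  exact Finset.sum_induction _ ContinuousLinearMap.IsPositive (fun _ _ => .add)
    ContinuousLinearMap.isPositive_zero fun i _ => isPositive_Lam _

theorem norm_Lam_le (hγ : 0 < S.γc) (w : E L) : ‖S.Lam w‖ ≤ 1 / (4 * S.γc) := by
  have hρ := rho_pos hγ.le w
  calc ‖S.Lam w‖ = ‖w‖ ^ 2 / S.rho w ^ 2 := by
        rw [Lam, ← InnerProductSpace.rankOne_def, norm_smul, InnerProductSpace.norm_rankOne,
          Real.norm_of_nonneg (by positivity)]
        ring
    _ ≤ 1 / (4 * S.γc) := by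
        rw [div_le_div_iff₀ (by positivity) (by positivity), rho, real_inner_self_eq_norm_sq]
        nlinarith [sq_nonneg (1 - S.γc * ‖w‖ ^ 2)]

theorem norm_LamAvg_le (hγ : 0 < S.γc) (x : E n) (wa : E L) (th : E p) (t : ℝ) :
    ‖S.LamAvg x wa th t‖ ≤ 1 / (4 * S.γc) :=
  calc ‖S.LamAvg x wa th t‖ ≤ 1 / N * ∑ _i : Fin N, 1 / (4 * S.γc) := by
        rw [LamAvg, norm_smul, Real.norm_of_nonneg (by positivity)]
        gcongr
        exact norm_sum_le_of_le _ fun i _ => norm_Lam_le hγ _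
    _ = N / N * (1 / (4 * S.γc)) := by
        rw [Finset.sum_const, Finset.card_univ, Fintype.card_fin, nsmul_eq_mul]
        ring
    _ ≤ 1 / (4 * S.γc) := mul_le_of_le_one_left (by positivity) (div_self_le_one _)

variable (S) in
/-- The information matrix `k_{c1} Λ + (k_{c2}/N) ∑ᵢ Λᵢ` along a run. -/
noncomputable def info (r : Run n L p) (t : ℝ) : E L →L[ℝ] E L :=
  S.kc1 • S.LamRun r t + S.kc2 • S.LamAvgRun r t

theorem inner_info (r : Run n L p) (t : ℝ) (v : E L) :
    ⟪v, S.info r t v⟫ = S.kc1 * ⟪v, S.LamRun r t v⟫ + S.kc2 * ⟪v, S.LamAvgRun r t v⟫ := by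
  simp [info, inner_add_right, inner_smul_right]

theorem isPositive_info (hS : S.GainsPos) (r : Run n L p) (t : ℝ) : (S.info r t).IsPositive :=
  ((isPositive_Lam _).smul_of_nonneg hS.kc1_pos.le).add
    ((isPositive_LamAvg _ _ _ _).smul_of_nonneg hS.kc2_pos.le)

theorem norm_info_le (hS : S.GainsPos) (r : Run n L p) (t : ℝ) :
    ‖S.info r t‖ ≤ S.kc1 * (1 / (4 * S.γc)) + S.kc2 * (1 / (4 * S.γc)) := by
  refine norm_add_le_of_le ?_ ?_
  · rw [norm_smul, Real.norm_of_nonneg hS.kc1_pos.le]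
    exact mul_le_mul_of_nonneg_left (norm_Lam_le hS.γc_pos _) hS.kc1_pos.le
  · rw [norm_smul, Real.norm_of_nonneg hS.kc2_pos.le]
    exact mul_le_mul_of_nonneg_left (norm_LamAvg_le hS.γc_pos _ _ _ _) hS.kc2_pos.le

section Excitation

variable {r : Run n L p} {t₀ c₃ Bsup : ℝ}

theorem ExcitedRun.exists_gainFlow (hS : S.WeakAssumptions) (hr : S.ExcitedRun r t₀ c₃ Bsup) :
    ∃ K D, GainFlow r.Γ (S.info r) S.βc t₀ K D ∧ ∀ t > t₀, t ∉ D →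
      HasDerivAt r.x (S.f (r.x t) + S.g (r.x t) (S.policy (r.x t) (r.Wa t))) t ∧
      HasDerivAt r.Wc (S.critic (r.x t) (r.Wc t) (r.Wa t) (r.Γ t) (r.θh t) t) t ∧
      HasDerivAt r.Wa (S.actor (r.x t) (r.Wc t) (r.Wa t) (r.θh t) t) t ∧
      HasDerivAt r.θh (r.ψ (r.θh t) t) t := by
  obtain ⟨D, hD, hode⟩ := hr.sol.ode
  have hode' := fun t (ht : t > t₀) htD =>
    hode t ((timeInterval_top t₀).superset ht.le) ht htD (hr.mem_interior hS ht.le)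
  refine ⟨_, D, ⟨timeInterval_top t₀ ▸ hr.sol.Γ_cont, hr.sol.Γ_init, hD, isPositive_info hS.gains r,
    norm_info_le hS.gains r, hS.gains.βc_pos, fun t ht htD => (hode' t ht htD).2.2.1⟩,
    fun t ht htD => ?_⟩
  obtain ⟨hx, hc, -, ha, hθ⟩ := hode' t ht htD
  exact ⟨hx, hc, ha, hθ⟩

theorem Excitation.exists_exciting_info (hS : S.GainsPos) {T c₁ c₂ : ℝ}
    (h : S.Excitation r t₀ T c₁ c₂ c₃) : ∃ c > 0, GainFlow.Exciting (S.info r) t₀ T c := by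
  obtain ⟨hT, -, -, -, hpos, hexc⟩ := h
  have hΛ : ∀ t v, 0 ≤ S.kc1 * ⟪v, S.LamRun r t v⟫ := fun t v =>
    mul_nonneg hS.kc1_pos.le ((isPositive_Lam _).inner_nonneg_right v)
  have hΛavg : ∀ t v, 0 ≤ S.kc2 * ⟪v, S.LamAvgRun r t v⟫ := fun t v =>
    mul_nonneg hS.kc2_pos.le ((isPositive_LamAvg _ _ _ _).inner_nonneg_right v)
  rcases hpos with hc | hc | hc
  · exact ⟨_, mul_pos hS.kc1_pos hc, .of_integral_le hT.le hS.kc1_pos hc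
      (fun t ht v => (hexc t ht v).1) fun t v => by rw [inner_info]; linarith [hΛavg t v]⟩
  · exact ⟨_, mul_pos hS.kc2_pos hc, .of_integral_le hT.le hS.kc2_pos hc
      (fun t ht v => (hexc t ht v).2.1) fun t v => by rw [inner_info]; linarith [hΛ t v]⟩
  · refine ⟨_, mul_pos (mul_pos hS.kc2_pos hc) hT, .of_forall_le fun t ht v => ?_⟩
    rw [inner_info, mul_assoc]
    linarith [hΛ t v, mul_le_mul_of_nonneg_left (hexc t ht v).2.2 hS.kc2_pos.le]

theorem ExcitedRun.exists_gainBounds (hS : S.WeakAssumptions) (hr : S.ExcitedRun r t₀ c₃ Bsup) :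
    ∃ Γlow > 0, ∃ Γup > 0, r.GainBounds t₀ Γlow Γup := by
  obtain ⟨K, D, hflow, -⟩ := hr.exists_gainFlow hS
  obtain ⟨T, c₁, c₂, hexc⟩ := hr.excitation
  obtain ⟨c, hc, hinfo⟩ := hexc.exists_exciting_info hS.gains
  obtain ⟨q, hq, hcoer⟩ := hflow.exists_inverse_coercive hexc.1 hc hinfo
  obtain ⟨low, hlow, up, hup, hbounds⟩ := hflow.exists_bounds hq hcoer
  exact ⟨low, hlow, up, hup, fun t ht => ⟨hflow.isSelfAdjoint ht, hbounds t ht⟩⟩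

end Excitation

end Scheme

/-! ### Comparison functions for the Lyapunov function -/

namespace ClassK

variable {α β : ℝ → ℝ}

theorem le_iff (hα : ClassK α) {a b : ℝ} (ha : 0 ≤ a) (hb : 0 ≤ b) : α a ≤ α b ↔ a ≤ b :=
  hα.2.1.le_iff_le ha hb

theorem lt_iff (hα : ClassK α) {a b : ℝ} (ha : 0 ≤ a) (hb : 0 ≤ b) : α a < α b ↔ a < b :=
  hα.2.1.lt_iff_lt ha hb

theorem add (hα : ClassK α) (hβ : ClassK β) : ClassK fun s => α s + β s :=
  ⟨hα.1.add hβ.1, hα.2.1.add hβ.2.1, by simp only [hα.2.2, hβ.2.2, add_zero]⟩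

theorem min (hα : ClassK α) (hβ : ClassK β) : ClassK fun s => min (α s) (β s) :=
  ⟨ContinuousOn.inf hα.1 hβ.1, fun _ ha _ hb h => min_lt_min (hα.2.1 ha hb h) (hβ.2.1 ha hb h), by
    simp only [hα.2.2, hβ.2.2, min_self]⟩

theorem comp_half (hα : ClassK α) : ClassK fun s => α (s / 2) := by
  have hmaps : MapsTo (fun s : ℝ => s / 2) (Ici 0) (Ici 0) :=
    fun s (hs : 0 ≤ s) => div_nonneg hs two_pos.le
  exact ⟨hα.1.comp (by fun_prop) hmaps,
    fun _ ha _ hb h => hα.2.1 (hmaps ha) (hmaps hb) (by linarith), by simp only [zero_div, hα.2.2]⟩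

theorem const_mul_sq {c : ℝ} (hc : 0 < c) : ClassK fun s => c * s ^ 2 :=
  ⟨by fun_prop, fun _ ha _ _ h =>
    mul_lt_mul_of_pos_left (pow_lt_pow_left₀ h ha two_ne_zero) hc, by simp⟩

theorem const_mul_id {c : ℝ} (hc : 0 < c) : ClassK fun s => c * s :=
  ⟨by fun_prop, fun _ _ _ _ h => mul_lt_mul_of_pos_left h hc, mul_zero c⟩

theorem mul_div_one_add {a : ℝ → ℝ} (hcont : Continuous a) (hmono : Monotone a)
    (hpos : ∀ r > 0, 0 < a r) : ClassK fun r => a r * (r / (1 + r)) := by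
  refine ⟨?_, fun r (hr : 0 ≤ r) s _ hrs => ?_, by simp⟩
  · refine hcont.continuousOn.mul (continuousOn_id.div (by fun_prop) fun r (hr : 0 ≤ r) => ?_)
    positivity
  · have hs : 0 < s := hr.trans_lt hrs
    have hfrac : r / (1 + r) < s / (1 + s) := by
      rw [div_lt_div_iff₀ (by positivity) (by positivity)]
      linarith
    exact mul_lt_mul' (hmono hrs.le) hfrac (by positivity) (hpos s hs)

end ClassK

section RadialBounds

variable {X : Type*} [NormedAddCommGroup X] {K : Set X} {V : X → ℝ}

-- `a r` is the minimum over `K` of `V x + max 0 (r - ‖x‖)`, which is `1`-Lipschitz in `r`.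
theorem exists_monotone_radial_minorant (hK : IsCompact K) (h0 : (0 : X) ∈ K)
    (hV : ContinuousOn V K) (hzero : V 0 = 0) (hpos : ∀ x ∈ K, x ≠ 0 → 0 < V x) :
    ∃ a : ℝ → ℝ, Continuous a ∧ Monotone a ∧ (∀ r > 0, 0 < a r) ∧ ∀ x ∈ K, a ‖x‖ ≤ V x := by
  have hmin : ∀ r : ℝ, ∃ x ∈ K, ∀ y ∈ K, V x + max 0 (r - ‖x‖) ≤ V y + max 0 (r - ‖y‖) :=
    fun r => hK.exists_isMinOn ⟨0, h0⟩ (hV.add (by fun_prop))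
  choose m hmK hmle using hmin
  set a : ℝ → ℝ := fun r => V (m r) + max 0 (r - ‖m r‖) with ha
  have hmono : Monotone a := fun r s hrs => by
    refine (hmle r _ (hmK s)).trans ?_
    simp only [ha]
    gcongr
  have hlip : ∀ s r, a s ≤ a r + |s - r| := fun s r => by
    refine (hmle s _ (hmK r)).trans ?_
    simp only [ha]
    rw [add_assoc]
    gcongr
    refine max_le (by positivity) ?_
    linarith [le_max_right 0 (r - ‖m r‖), le_abs_self (s - r)]
  refine ⟨a, ?_, hmono, fun r hr => ?_, fun x hx => ?_⟩
  · refine (LipschitzWith.of_le_add_mul 1 fun s r => ?_).continuous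
    simpa [Real.dist_eq] using hlip s r
  · rcases eq_or_ne (m r) 0 with h | h
    · simpa [ha, h, hzero] using hr
    · exact add_pos_of_pos_of_nonneg (hpos _ (hmK r) h) (le_max_left _ _)
  · simpa using hmle ‖x‖ x hx

theorem exists_classK_le (hK : IsCompact K) (h0 : (0 : X) ∈ K) (hV : ContinuousOn V K)
    (hzero : V 0 = 0) (hpos : ∀ x ∈ K, x ≠ 0 → 0 < V x) :
    ∃ α, ClassK α ∧ ∀ x ∈ K, α ‖x‖ ≤ V x := by
  obtain ⟨a, hcont, hmono, hapos, hle⟩ := exists_monotone_radial_minorant hK h0 hV hzero hpos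
  refine ⟨_, .mul_div_one_add hcont hmono hapos, fun x hx => ?_⟩
  rcases eq_or_ne x 0 with rfl | hx0
  · simp [hzero]
  · have hfrac : ‖x‖ / (1 + ‖x‖) ≤ 1 := (div_le_one (by positivity)).2 (by linarith)
    exact (mul_le_of_le_one_right (hapos _ (norm_pos_iff.2 hx0)).le hfrac).trans (hle x hx)

theorem exists_le_mul_norm (hK : IsCompact K) (h0 : (0 : X) ∈ K) (hV : LocallyLipschitz V)
    (hzero : V 0 = 0) : ∃ C > 0, ∀ x ∈ K, V x ≤ C * ‖x‖ := by
  obtain ⟨C, hC⟩ := hV.locallyLipschitzOn.exists_lipschitzOnWith_of_compact hK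
  refine ⟨C + 1, by positivity, fun x hx => ?_⟩
  have hle := hC.dist_le_mul x hx 0 h0
  rw [Real.dist_eq, hzero, sub_zero, dist_zero_right] at hle
  linarith [le_abs_self (V x), norm_nonneg x]

end RadialBounds

section Stack

variable {n L p : ℕ} (x : E n) (wc wa : E L) (th : E p)

theorem norm_stack_sq :
    ‖stack x wc wa th‖ ^ 2 = ‖x‖ ^ 2 + ‖wc‖ ^ 2 + ‖wa‖ ^ 2 + ‖th‖ ^ 2 := by
  simp only [EuclideanSpace.norm_sq_eq, stack, Fintype.sum_sum_type, Sum.elim_inl, Sum.elim_inr]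
  ring

theorem norm_components_le_norm_stack :
    ‖x‖ ≤ ‖stack x wc wa th‖ ∧ ‖wc‖ ≤ ‖stack x wc wa th‖ ∧ ‖wa‖ ≤ ‖stack x wc wa th‖ ∧
      ‖th‖ ≤ ‖stack x wc wa th‖ := by
  have hsq := norm_stack_sq x wc wa th
  refine ⟨?_, ?_, ?_, ?_⟩ <;> refine le_of_sq_le_sq ?_ (norm_nonneg _) <;>
    linarith [sq_nonneg ‖x‖, sq_nonneg ‖wc‖, sq_nonneg ‖wa‖, sq_nonneg ‖th‖]

theorem half_norm_stack_le_component :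
    ‖stack x wc wa th‖ / 2 ≤ ‖x‖ ∨ ‖stack x wc wa th‖ / 2 ≤ ‖wc‖ ∨
      ‖stack x wc wa th‖ / 2 ≤ ‖wa‖ ∨ ‖stack x wc wa th‖ / 2 ≤ ‖th‖ := by
  have hsq := norm_stack_sq x wc wa th
  by_contra! ⟨hx, hwc, hwa, hth⟩
  linarith [pow_lt_pow_left₀ hx (norm_nonneg _) two_ne_zero,
    pow_lt_pow_left₀ hwc (norm_nonneg _) two_ne_zero,
    pow_lt_pow_left₀ hwa (norm_nonneg _) two_ne_zero,
    pow_lt_pow_left₀ hth (norm_nonneg _) two_ne_zero]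

end Stack

namespace Scheme

variable {n m L p N : ℕ} {S : Scheme n m L p N}

section Sandwich

variable {r : Run n L p} {t₀ Γlow Γup : ℝ}

theorem exists_classK_le_VL (hS : S.WeakAssumptions) (ht₀ : 0 ≤ t₀) (hlow : 0 < Γlow)
    (hup : 0 < Γup) (hb : r.GainBounds t₀ Γlow Γup) :
    ∃ η, ClassK η ∧ ∀ t ≥ t₀, ∀ x ∈ S.χ, ∀ wc wa th,
      η ‖stack x wc wa th‖ ≤ S.VL r x wc wa th t := by
  obtain ⟨α, hα, hαV⟩ := exists_classK_le hS.χ_compact hS.zero_mem_χ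
    hS.V_smooth.continuous.continuousOn hS.V_zero fun x _ => hS.V_pos x
  obtain ⟨v₁, _, hv₁, _, hv⟩ := hS.identifier.bounds
  have hcritic : ClassK fun s => 1 / (2 * Γup) * s ^ 2 := .const_mul_sq (by positivity)
  have hactor : ClassK fun s => 1 / 2 * s ^ 2 := .const_mul_sq (by positivity)
  refine ⟨_, (hα.min (hcritic.min (hactor.min hv₁))).comp_half, fun t ht x hx wc wa th => ?_⟩
  obtain ⟨hsa, hΓ⟩ := hb t ht
  have hV := hαV x hx
  have hVθ := (hv th t (ht₀.trans ht)).1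
  have hwc := norm_sq_div_le_inner_inverse hsa hlow hup hΓ wc
  have hV0 := hα.nonneg (norm_nonneg x)
  have hVθ0 := hv₁.nonneg (norm_nonneg th)
  have hdiv : 1 / (2 * Γup) * ‖wc‖ ^ 2 = 1 / 2 * (‖wc‖ ^ 2 / Γup) := by ring
  have hwc0 : 0 ≤ 1 / (2 * Γup) * ‖wc‖ ^ 2 := by positivity
  have hwa0 : 0 ≤ 1 / 2 * ‖wa‖ ^ 2 := by positivity
  have hz : 0 ≤ ‖stack x wc wa th‖ / 2 := by positivity
  simp only [VL, real_inner_self_eq_norm_sq, min_le_iff]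
  have key : ∀ {η : ℝ → ℝ} {y : ℝ}, ClassK η → ‖stack x wc wa th‖ / 2 ≤ y →
      η (‖stack x wc wa th‖ / 2) ≤ η y := fun hη hy => (hη.le_iff hz (hz.trans hy)).2 hy
  rcases half_norm_stack_le_component x wc wa th with h | h | h | h
  · exact .inl (by linarith [key hα h])
  · exact .inr (.inl (by linarith [key hcritic h]))
  · exact .inr (.inr (.inl (by linarith [key hactor h])))
  · exact .inr (.inr (.inr (by linarith [key hv₁ h])))

theorem exists_VL_le_classK (hS : S.WeakAssumptions) (ht₀ : 0 ≤ t₀) (hlow : 0 < Γlow)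
    (hb : r.GainBounds t₀ Γlow Γup) :
    ∃ η, ClassK η ∧ ∀ t ≥ t₀, ∀ x ∈ S.χ, ∀ wc wa th,
      S.VL r x wc wa th t ≤ η ‖stack x wc wa th‖ := by
  obtain ⟨C, hC, hCV⟩ := exists_le_mul_norm hS.χ_compact hS.zero_mem_χ
    hS.V_smooth.locallyLipschitz hS.V_zero
  obtain ⟨_, v₂, _, hv₂, hv⟩ := hS.identifier.bounds
  refine ⟨_, ((ClassK.const_mul_id hC).add
    ((ClassK.const_mul_sq (c := 1 / (2 * Γlow)) (by positivity)).add
      ((ClassK.const_mul_sq one_half_pos).add hv₂))), fun t ht x hx wc wa th => ?_⟩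
  obtain ⟨hxz, hwcz, hwaz, hthz⟩ := norm_components_le_norm_stack x wc wa th
  have hcritic : ⟪wc, (r.Γ t).inverse wc⟫ ≤ ‖wc‖ * (‖wc‖ / Γlow) :=
    (real_inner_le_norm _ _).trans
      (mul_le_mul_of_nonneg_left (norm_inverse_apply_le hlow (fun v => ((hb t ht).2 v).1) wc)
        (norm_nonneg _))
  have hwc : ⟪wc, (r.Γ t).inverse wc⟫ ≤ ‖stack x wc wa th‖ * (‖stack x wc wa th‖ / Γlow) :=
    hcritic.trans (by gcongr)
  have hwa : ‖wa‖ ^ 2 ≤ ‖stack x wc wa th‖ ^ 2 := by gcongr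
  have hx' : S.V x ≤ C * ‖stack x wc wa th‖ := (hCV x hx).trans (by gcongr)
  have hth : S.Vθ (th, t) ≤ v₂ ‖stack x wc wa th‖ :=
    (hv th t (ht₀.trans ht)).2.trans ((hv₂.le_iff (norm_nonneg _) (norm_nonneg _)).2 hthz)
  have hdiv : 1 / (2 * Γlow) * ‖stack x wc wa th‖ ^ 2
      = 1 / 2 * (‖stack x wc wa th‖ * (‖stack x wc wa th‖ / Γlow)) := by ring
  rw [VL, real_inner_self_eq_norm_sq]
  linarith

theorem exists_sandwich (hS : S.WeakAssumptions) (ht₀ : 0 ≤ t₀) (hlow : 0 < Γlow) (hup : 0 < Γup)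
    (hb : r.GainBounds t₀ Γlow Γup) :
    ∃ η₁ η₂ : ℝ → ℝ, ClassK η₁ ∧ ClassK η₂ ∧ S.Sandwich r t₀ η₁ η₂ := by
  obtain ⟨η₁, hη₁, hle⟩ := exists_classK_le_VL hS ht₀ hlow hup hb
  obtain ⟨η₂, hη₂, hge⟩ := exists_VL_le_classK hS ht₀ hlow hb
  exact ⟨η₁, η₂, hη₁, hη₂, fun t ht x hx wc wa th =>
    ⟨hle t ht x hx wc wa th, hge t ht x hx wc wa th⟩⟩

end Sandwich

end Scheme

theorem div_one_add_mul_sq_sq_le {γ : ℝ} (hγ : 0 < γ) (s : ℝ) :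
    s / (1 + γ * s ^ 2) ^ 2 ≤ 3 * √3 / (16 * √γ) := by
  have h3 : √3 ^ 2 = (3 : ℝ) := Real.sq_sqrt (by norm_num)
  have hγsq : √γ ^ 2 = γ := Real.sq_sqrt hγ.le
  -- the maximum is attained where `σ = 1`
  set σ := √3 * √γ * s with hσ
  have hσsq : σ ^ 2 = 3 * (γ * s ^ 2) := by
    rw [hσ, mul_pow, mul_pow, h3, hγsq]; ring
  have hmax : 16 * σ ≤ (3 + σ ^ 2) ^ 2 := by
    have hfactor : (3 + σ ^ 2) ^ 2 - 16 * σ = (σ - 1) ^ 2 * ((σ + 1) ^ 2 + 8) := by ring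
    rw [← sub_nonneg, hfactor]
    positivity
  rw [div_le_div_iff₀ (by positivity) (by positivity)]
  refine le_of_mul_le_mul_left ?_ (by positivity : 0 < √3)
  calc √3 * (s * (16 * √γ)) = 16 * σ := by rw [hσ]; ring
    _ ≤ (3 + 3 * (γ * s ^ 2)) ^ 2 := hσsq ▸ hmax
    _ = √3 ^ 2 * (3 * (1 + γ * s ^ 2) ^ 2) := by rw [h3]; ring
    _ = √3 * (3 * √3 * (1 + γ * s ^ 2) ^ 2) := by ring

theorem mul_sub_half_mul_sq_le {a : ℝ} (ha : 0 < a) (b s : ℝ) :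
    b * s - 1 / 2 * a * s ^ 2 ≤ b ^ 2 / (2 * a) := by
  rw [le_div_iff₀ (by positivity)]
  nlinarith [sq_nonneg (a * s - b)]

theorem inner_gradient_le_of_convexOn {V : Type*} [NormedAddCommGroup V] [InnerProductSpace ℝ V]
    [CompleteSpace V] {P : V → ℝ} (hP : ConvexOn ℝ univ P) {w : V}
    (hd : DifferentiableAt ℝ P w) (z : V) : ⟪gradient P w, z - w⟫ ≤ P z - P w := by
  have hconv : ConvexOn ℝ univ (P ∘ AffineMap.lineMap (k := ℝ) w z) :=
    hP.comp_affineMap (AffineMap.lineMap (k := ℝ) w z)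
  have hline : HasDerivAt (AffineMap.lineMap w z) (z - w) (0 : ℝ) := AffineMap.hasDerivAt_lineMap
  have hP' : HasFDerivAt P (fderiv ℝ P w) (AffineMap.lineMap w z (0 : ℝ)) := by
    simpa only [AffineMap.lineMap_apply_zero] using hd.hasFDerivAt
  have h := hconv.le_slope_of_hasDerivAt (mem_univ 0) (mem_univ 1) one_pos
    (hP'.comp_hasDerivAt 0 hline)
  simpa [slope_def_field, inner_gradient_left] using h

namespace Scheme

variable {n m L p N : ℕ} {S : Scheme n m L p N}

section Suprema

variable {V : Type*} [SeminormedAddCommGroup V] {x : E n}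

theorem norm_le_sup₁ {F : E n → V} (hF : BddOn S.χ F) (hx : x ∈ S.χ) :
    ‖F x‖ ≤ S.sup₁ fun x => ‖F x‖ :=
  le_sup₁ hF.norm hx

theorem norm_le_sup₂ {F : E n → E n → V} (hF : BddOn (S.χ ×ˢ S.χ) fun q => F q.1 q.2)
    (hx : x ∈ S.χ) {y : E n} (hy : y ∈ S.χ ∩ Metric.closedBall x S.l) :
    ‖F x y‖ ≤ S.sup₂ fun x y => ‖F x y‖ :=
  le_sup₂ (F := fun x y => ‖F x y‖) hF.norm hx hy

theorem sup₁_nonneg {F : E n → ℝ} (hF : ∀ x, 0 ≤ F x) : 0 ≤ S.sup₁ F :=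
  Real.sSup_nonneg (by rintro _ ⟨x, -, rfl⟩; exact hF x)

theorem sup₂_nonneg {F : E n → E n → ℝ} (hF : ∀ x y, 0 ≤ F x y) : 0 ≤ S.sup₂ F :=
  Real.sSup_nonneg (by rintro _ ⟨x, -, y, -, rfl⟩; exact hF x y)

end Suprema

/-! ### Bellman errors -/

variable (S) in
/-- The regressor at `y`, for centres `c(x)`, under the policy `-½ R⁻¹ gᵀ (∇φᵀ Ŵ_a + b)`. The vector
`b` is the part of the barrier function: `c_b ∇Bᵀ` for `ω`, and `0` for `ω_i`. -/
noncomputable def regressor (y x b : E n) (wa : E L) (th : E p) : E L :=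
  S.dphi y x (S.Y y th + S.g y (S.feedback y (S.dphiT y x wa + b)))

variable (S) in
/-- The Bellman error that belongs to `regressor`, common form of `δ_t` and `δ_i`. -/
noncomputable def bellmanError (y x b : E n) (wc wa : E L) (th : E p) : ℝ :=
  S.cost y (S.feedback y (S.dphiT y x wa + b)) + ⟪wc, S.regressor y x b wa th⟫

theorem omega_eq_regressor (x : E n) (wa : E L) (th : E p) :
    S.omega x wa th = S.regressor x x (S.cb • S.gradB x) wa th := by
  rw [omega, policy_eq_feedback, regressor]

theorem omegaAt_eq_regressor (y x : E n) (wa : E L) (th : E p) :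
    S.omegaAt y x wa th = S.regressor y x 0 wa th := by
  rw [omegaAt, khat_eq_feedback, regressor, add_zero]

theorem delta_eq_bellmanError (x : E n) (wc wa : E L) (th : E p) :
    S.delta x wc wa th = S.bellmanError x x (S.cb • S.gradB x) wc wa th := by
  rw [delta, omega_eq_regressor, policy_eq_feedback, bellmanError]

theorem deltaAt_eq_bellmanError (y x : E n) (wc wa : E L) (th : E p) :
    S.deltaAt y x wc wa th = S.bellmanError y x 0 wc wa th := by
  rw [deltaAt, omegaAt_eq_regressor, khat_eq_feedback, bellmanError, add_zero]

theorem inner_GR_comm (hR : PosDefOp S.R) (y v w : E n) : ⟪v, S.GR y w⟫ = ⟪w, S.GR y v⟫ :=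
  ((isPositive_GR hR y).isSymmetric v w).symm.trans (real_inner_comm _ _)

theorem inner_Gphi (y x : E n) (v w : E L) :
    ⟪v, S.Gphi y x w⟫ = ⟪S.dphiT y x v, S.GR y (S.dphiT y x w)⟫ := by
  rw [inner_dphiT]; rfl

theorem bellmanError_eq (hS : S.WeakAssumptions) (y x b : E n) (wc wa : E L) (th : E p) :
    S.bellmanError y x b wc wa th
      = -⟪S.W x - wc, S.regressor y x b wa th⟫ - ⟪S.dphiT y x (S.W x), S.Y y (S.θ - th)⟫
        + S.Delta x y
        + 1 / 4 * ⟪b - S.dphiT y x (S.W x - wa), S.GR y (b - S.dphiT y x (S.W x - wa))⟫ := by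
  set q := S.dphiT y x (S.W x)
  set s := S.dphiT y x wa + b with hs
  set v := gradient S.V y
  have hsq : b - S.dphiT y x (S.W x - wa) = s - q := by rw [map_sub, hs]; abel
  have hW : ⟪S.W x, S.regressor y x b wa th⟫ = ⟪q, S.Y y th⟫ - 1 / 2 * ⟪q, S.GR y s⟫ := by
    rw [regressor, ← inner_dphiT, ← hs, g_feedback, inner_add_right, inner_neg_right,
      real_inner_smul_right, sub_eq_add_neg]
  have hDelta : S.Delta x y = 1 / 2 * ⟪q, S.GR y (v - q)⟫ + 1 / 4 * ⟪v - q, S.GR y (v - q)⟫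
      - ⟪v - q, S.f y⟫ - ⟪q, S.f y - S.Y y S.θ⟫ := rfl
  rw [bellmanError, cost, inner_feedback_R hS.R_pos, inner_Q_eq_of_hjb hS.R_pos (hS.hjb y),
    inner_sub_left, hW, hDelta, hsq]
  simp only [map_sub, inner_sub_left, inner_sub_right, inner_GR_comm hS.R_pos y v q,
    inner_GR_comm hS.R_pos y s q]
  ring

/-! ### Contribution of one regressor -/

variable (S) in
/-- The bound `3√3/(16√γ_c)` on `‖ω‖/ρ²`. -/
noncomputable def regBound : ℝ := 3 * √3 / (16 * √S.γc)

theorem regBound_nonneg : 0 ≤ S.regBound := by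
  rw [regBound]; positivity

theorem abs_inner_div_rho_sq_le (hγ : 0 < S.γc) (v w : E L) :
    |⟪v, w⟫ / S.rho w ^ 2| ≤ S.regBound * ‖v‖ := by
  have hρ := rho_pos hγ.le w
  have hbound : ‖w‖ / S.rho w ^ 2 ≤ S.regBound := by
    rw [rho, real_inner_self_eq_norm_sq]
    exact div_one_add_mul_sq_sq_le hγ ‖w‖
  calc |⟪v, w⟫ / S.rho w ^ 2| = |⟪v, w⟫| / S.rho w ^ 2 := by
        rw [abs_div, abs_of_pos (by positivity : 0 < S.rho w ^ 2)]
    _ ≤ ‖v‖ * ‖w‖ / S.rho w ^ 2 := by gcongr; exact abs_real_inner_le_norm v w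
    _ = ‖w‖ / S.rho w ^ 2 * ‖v‖ := by ring
    _ ≤ S.regBound * ‖v‖ := by gcongr

variable (S) in
/-- Contribution, per unit of learning gain, of the regressor at `y` to the derivative of the
Lyapunov function: the critic, least-squares and actor laws, in this order. -/
noncomputable def regressorTerm (y x b : E n) (wc wa : E L) (th : E p) : ℝ :=
  ⟪S.W x - wc, S.regressor y x b wa th⟫ / S.rho (S.regressor y x b wa th) ^ 2
      * S.bellmanError y x b wc wa th
    + 1 / 2 * ⟪S.W x - wc, S.Lam (S.regressor y x b wa th) (S.W x - wc)⟫
    - 1 / (4 * S.rho (S.regressor y x b wa th) ^ 2) * ⟪S.regressor y x b wa th, wc⟫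
      * ⟪S.W x - wa, S.Gphi y x wa⟫

variable (S) in
/-- What is left of the Bellman error after removal of the critic's weight error and of the term
`¼ W̃_aᵀ G_φ (W̃_a - W)`, which is moved to the contribution of the actor law. -/
noncomputable def residual (y x b : E n) (wa : E L) (th : E p) : ℝ :=
  S.Delta x y - ⟪S.dphiT y x (S.W x), S.Y y (S.θ - th)⟫
    + 1 / 4 * ⟪S.W x - wa, S.Gphi y x (S.W x)⟫
    - 1 / 2 * ⟪b, S.GR y (S.dphiT y x (S.W x - wa))⟫ + 1 / 4 * ⟪b, S.GR y b⟫

theorem regressorTerm_eq (hS : S.WeakAssumptions) (y x b : E n) (wc wa : E L) (th : E p) :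
    S.regressorTerm y x b wc wa th
      = -(1 / 2 * ⟪S.W x - wc, S.Lam (S.regressor y x b wa th) (S.W x - wc)⟫)
        + ⟪S.W x - wc, S.regressor y x b wa th⟫ / S.rho (S.regressor y x b wa th) ^ 2
          * S.residual y x b wa th
        + 1 / 4 * (⟪S.W x, S.regressor y x b wa th⟫ / S.rho (S.regressor y x b wa th) ^ 2
          * (⟪S.W x - wa, S.Gphi y x (S.W x - wa)⟫ - ⟪S.W x - wa, S.Gphi y x (S.W x)⟫)) := by
  set ϖ := S.regressor y x b wa th
  set c := S.W x - wc with hc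
  set a := S.W x - wa with ha
  have hwc : ⟪ϖ, wc⟫ = ⟪S.W x, ϖ⟫ - ⟪c, ϖ⟫ := by
    rw [← inner_sub_left, hc, sub_sub_cancel, real_inner_comm]
  have hwa : ⟪a, S.Gphi y x wa⟫ = ⟪a, S.Gphi y x (S.W x)⟫ - ⟪a, S.Gphi y x a⟫ := by
    rw [← inner_sub_right, ← map_sub, ha, sub_sub_cancel]
  have hquad : ⟪b - S.dphiT y x a, S.GR y (b - S.dphiT y x a)⟫
      = ⟪b, S.GR y b⟫ - 2 * ⟪b, S.GR y (S.dphiT y x a)⟫ + ⟪a, S.Gphi y x a⟫ := by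
    rw [inner_Gphi]
    simp only [map_sub, inner_sub_left, inner_sub_right,
      inner_GR_comm hS.R_pos y (S.dphiT y x a) b]
    ring
  have hLam : ⟪c, S.Lam ϖ c⟫ = ⟪c, ϖ⟫ / S.rho ϖ ^ 2 * ⟪c, ϖ⟫ := by
    rw [inner_Lam, real_inner_comm]; ring
  have hinv : 1 / (4 * S.rho ϖ ^ 2) * (⟪S.W x, ϖ⟫ - ⟪c, ϖ⟫)
      = 1 / 4 * (⟪S.W x, ϖ⟫ / S.rho ϖ ^ 2) - 1 / 4 * (⟪c, ϖ⟫ / S.rho ϖ ^ 2) := by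
    rw [one_div, mul_inv]; ring
  rw [regressorTerm, bellmanError_eq hS, residual, hquad, hLam, hwc, hinv, hwa]
  ring

theorem abs_residual_le (hS : S.WeakAssumptions) {y x : E n} (hx : x ∈ S.χ)
    (hy : y ∈ S.χ ∩ Metric.closedBall x S.l) (b : E n) (wa : E L) (th : E p) :
    |S.residual y x b wa th|
      ≤ S.sup₂ (fun x y => |S.Delta x y|)
        + S.sup₂ (fun x y => ‖innerSL ℝ (S.W x) ∘L S.dphi y x ∘L S.Y y‖) * ‖S.θ - th‖
        + 1 / 4 * (S.sup₂ (fun x y => ‖S.Gphi y x‖ * ‖S.W x‖) * ‖S.W x - wa‖)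
        + 1 / 2 * (‖S.GR y ∘L S.dphiT y x‖ * ‖b‖ * ‖S.W x - wa‖)
        + 1 / 4 * (‖S.GR y‖ * ‖b‖ ^ 2) := by
  have hΔ : |S.Delta x y| ≤ S.sup₂ (fun x y => |S.Delta x y|) :=
    norm_le_sup₂ (bddOn_Delta hS mapsTo_snd_prod mapsTo_fst_prod) hx hy
  have hY : |⟪S.dphiT y x (S.W x), S.Y y (S.θ - th)⟫|
      ≤ S.sup₂ (fun x y => ‖innerSL ℝ (S.W x) ∘L S.dphi y x ∘L S.Y y‖) * ‖S.θ - th‖ := by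
    have hW : BddOn (S.χ ×ˢ S.χ) fun q : E n × E n => innerSL ℝ (S.W q.1) :=
      (bddOn_W hS mapsTo_fst_prod).of_norm_le fun _ _ => (innerSL_apply_norm ℝ _).le
    rw [inner_dphiT]
    exact ContinuousLinearMap.le_of_opNorm_le _
      (norm_le_sup₂ (F := fun x y => innerSL ℝ (S.W x) ∘L S.dphi y x ∘L S.Y y)
        (hW.clm_comp ((bddOn_dphi hS mapsTo_snd_prod mapsTo_fst_prod).clm_comp
          (bddOn_Y hS mapsTo_snd_prod))) hx hy) (S.θ - th)
  have hGW : ‖S.Gphi y x‖ * ‖S.W x‖ ≤ S.sup₂ (fun x y => ‖S.Gphi y x‖ * ‖S.W x‖) :=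
    le_sup₂ (F := fun x y => ‖S.Gphi y x‖ * ‖S.W x‖)
      ((bddOn_Gphi hS mapsTo_snd_prod mapsTo_fst_prod).norm.mul (bddOn_W hS mapsTo_fst_prod).norm)
      hx hy
  have haW : |⟪S.W x - wa, S.Gphi y x (S.W x)⟫|
      ≤ S.sup₂ (fun x y => ‖S.Gphi y x‖ * ‖S.W x‖) * ‖S.W x - wa‖ := by
    refine (abs_inner_apply_le (S.Gphi y x) (S.W x - wa) (S.W x)).trans ?_
    linarith [mul_le_mul_of_nonneg_right hGW (norm_nonneg (S.W x - wa))]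
  have hba : |⟪b, S.GR y (S.dphiT y x (S.W x - wa))⟫|
      ≤ ‖S.GR y ∘L S.dphiT y x‖ * ‖b‖ * ‖S.W x - wa‖ := by
    rw [mul_assoc]
    exact abs_inner_apply_le (S.GR y ∘L S.dphiT y x) b (S.W x - wa)
  have hbb : |⟪b, S.GR y b⟫| ≤ ‖S.GR y‖ * ‖b‖ ^ 2 := by
    rw [sq]
    exact abs_inner_apply_le (S.GR y) b b
  rw [residual]
  rw [abs_le] at *
  constructor <;> linarith

theorem actor_term_le (hS : S.WeakAssumptions) {y x : E n} (hx : x ∈ S.χ)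
    (hy : y ∈ S.χ ∩ Metric.closedBall x S.l) (a ϖ : E L) :
    ⟪S.W x, ϖ⟫ / S.rho ϖ ^ 2 * (⟪a, S.Gphi y x a⟫ - ⟪a, S.Gphi y x (S.W x)⟫)
      ≤ S.regBound * (S.sup₂ (fun x y => ‖S.Gphi y x‖) * S.sup₁ (fun x => ‖S.W x‖) ^ 2 * ‖a‖
        + S.sup₂ (fun x y => ‖S.Gphi y x‖ * ‖S.W x‖) * ‖a‖ ^ 2) := by
  have hG : ‖S.Gphi y x‖ ≤ S.sup₂ (fun x y => ‖S.Gphi y x‖) :=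
    norm_le_sup₂ (F := fun x y => S.Gphi y x)
      (bddOn_Gphi hS mapsTo_snd_prod mapsTo_fst_prod) hx hy
  have hW : ‖S.W x‖ ≤ S.sup₁ (fun x => ‖S.W x‖) := norm_le_sup₁ (bddOn_W hS (mapsTo_id _)) hx
  have hGW : ‖S.Gphi y x‖ * ‖S.W x‖ ≤ S.sup₂ (fun x y => ‖S.Gphi y x‖ * ‖S.W x‖) :=
    le_sup₂ (F := fun x y => ‖S.Gphi y x‖ * ‖S.W x‖)
      ((bddOn_Gphi hS mapsTo_snd_prod mapsTo_fst_prod).norm.mul (bddOn_W hS mapsTo_fst_prod).norm)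
      hx hy
  have hdiff : |⟪a, S.Gphi y x a⟫ - ⟪a, S.Gphi y x (S.W x)⟫|
      ≤ ‖S.Gphi y x‖ * (‖a‖ * ‖a‖) + ‖S.Gphi y x‖ * (‖a‖ * ‖S.W x‖) :=
    (abs_sub _ _).trans
      (add_le_add (abs_inner_apply_le _ a a) (abs_inner_apply_le _ a (S.W x)))
  have hG₀ := (norm_nonneg _).trans hG
  have hreg := regBound_nonneg (S := S)
  calc ⟪S.W x, ϖ⟫ / S.rho ϖ ^ 2 * (⟪a, S.Gphi y x a⟫ - ⟪a, S.Gphi y x (S.W x)⟫)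
      ≤ S.regBound * ‖S.W x‖
          * (‖S.Gphi y x‖ * (‖a‖ * ‖a‖) + ‖S.Gphi y x‖ * (‖a‖ * ‖S.W x‖)) :=
        (le_abs_self _).trans ((abs_mul _ _).trans_le (mul_le_mul
          (abs_inner_div_rho_sq_le hS.gains.γc_pos _ _) hdiff (abs_nonneg _) (by positivity)))
    _ = S.regBound
          * (‖S.Gphi y x‖ * ‖S.W x‖ ^ 2 * ‖a‖ + ‖S.Gphi y x‖ * ‖S.W x‖ * ‖a‖ ^ 2) := by ring
    _ ≤ _ := by gcongr

variable (S) in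
/-- The part of the bound on `regressorTerm` that does not depend on the barrier function, in terms
of the norms of `W̃_c`, `W̃_a` and `θ̃`. -/
noncomputable def commonBound (c a ϑ : ℝ) : ℝ :=
  S.regBound * c * (S.sup₂ (fun x y => ‖innerSL ℝ (S.W x) ∘L S.dphi y x ∘L S.Y y‖) * ϑ
      + S.sup₂ (fun x y => |S.Delta x y|))
    + S.regBound / 4 * (S.sup₂ (fun x y => ‖S.Gphi y x‖) * S.sup₁ (fun x => ‖S.W x‖) ^ 2 * a
      + S.sup₂ (fun x y => ‖S.Gphi y x‖ * ‖S.W x‖) * (a ^ 2 + c * a))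

theorem commonBound_nonneg {c a ϑ : ℝ} (hc : 0 ≤ c) (ha : 0 ≤ a) (hϑ : 0 ≤ ϑ) :
    0 ≤ S.commonBound c a ϑ := by
  have hY : 0 ≤ S.sup₂ (fun x y => ‖innerSL ℝ (S.W x) ∘L S.dphi y x ∘L S.Y y‖) :=
    sup₂_nonneg fun _ _ => norm_nonneg _
  have hΔ : 0 ≤ S.sup₂ (fun x y => |S.Delta x y|) := sup₂_nonneg fun _ _ => abs_nonneg _
  have hG : 0 ≤ S.sup₂ (fun x y => ‖S.Gphi y x‖) := sup₂_nonneg fun _ _ => norm_nonneg _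
  have hGW : 0 ≤ S.sup₂ (fun x y => ‖S.Gphi y x‖ * ‖S.W x‖) :=
    sup₂_nonneg fun _ _ => by positivity
  have hreg := regBound_nonneg (S := S)
  rw [commonBound]
  positivity

theorem regressorTerm_le (hS : S.WeakAssumptions) {y x : E n} (hx : x ∈ S.χ)
    (hy : y ∈ S.χ ∩ Metric.closedBall x S.l) (b : E n) (wc wa : E L) (th : E p) :
    S.regressorTerm y x b wc wa th
      ≤ -(1 / 2 * ⟪S.W x - wc, S.Lam (S.regressor y x b wa th) (S.W x - wc)⟫)
        + S.commonBound ‖S.W x - wc‖ ‖S.W x - wa‖ ‖S.θ - th‖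
        + S.regBound * ‖S.W x - wc‖ * (1 / 2 * (‖S.GR y ∘L S.dphiT y x‖ * ‖b‖ * ‖S.W x - wa‖)
          + 1 / 4 * (‖S.GR y‖ * ‖b‖ ^ 2)) := by
  have hreg := regBound_nonneg (S := S)
  have hcritic := (le_abs_self _).trans ((abs_mul _ _).trans_le (mul_le_mul
    (abs_inner_div_rho_sq_le hS.gains.γc_pos (S.W x - wc) (S.regressor y x b wa th))
    (abs_residual_le hS hx hy b wa th) (abs_nonneg _) (by positivity)))
  have hactor := actor_term_le hS hx hy (S.W x - wa) (S.regressor y x b wa th)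
  rw [regressorTerm_eq hS, commonBound]
  linarith

theorem regressorTerm_trajectory_le (hS : S.WeakAssumptions) {x : E n} (hx : x ∈ S.χ)
    (wc wa : E L) (th : E p) {Bsup : ℝ} (hB : ‖S.gradB x‖ ≤ Bsup) :
    S.regressorTerm x x (S.cb • S.gradB x) wc wa th
      ≤ S.commonBound ‖S.W x - wc‖ ‖S.W x - wa‖ ‖S.θ - th‖
        + S.regBound * ‖S.W x - wc‖
          * (1 / 2 * (S.sup₁ (fun x => ‖S.GR x ∘L S.dphiT x x‖) * (S.cb * Bsup) * ‖S.W x - wa‖)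
          + 1 / 4 * (S.sup₁ (fun x => ‖S.GR x‖) * (S.cb * Bsup) ^ 2)) := by
  have hterm := regressorTerm_le hS hx ⟨hx, Metric.mem_closedBall_self hS.l_nonneg⟩
    (S.cb • S.gradB x) wc wa th
  have hLam := (isPositive_Lam (S := S)
    (S.regressor x x (S.cb • S.gradB x) wa th)).inner_nonneg_right (S.W x - wc)
  have hGφ : ‖S.GR x ∘L S.dphiT x x‖ ≤ S.sup₁ (fun x => ‖S.GR x ∘L S.dphiT x x‖) :=
    norm_le_sup₁ (F := fun x => S.GR x ∘L S.dphiT x x)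
      ((bddOn_GR hS (mapsTo_id _)).clm_comp (bddOn_dphiT hS (mapsTo_id _) (mapsTo_id _))) hx
  have hG : ‖S.GR x‖ ≤ S.sup₁ (fun x => ‖S.GR x‖) := norm_le_sup₁ (bddOn_GR hS (mapsTo_id _)) hx
  have hb : ‖S.cb • S.gradB x‖ ≤ S.cb * Bsup := by
    rw [norm_smul, Real.norm_of_nonneg hS.gains.cb_pos.le]
    exact mul_le_mul_of_nonneg_left hB hS.gains.cb_pos.le
  have hreg := regBound_nonneg (S := S)
  have hGφ₀ := (norm_nonneg _).trans hGφ
  have hG₀ := (norm_nonneg _).trans hG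
  have hbarrier : S.regBound * ‖S.W x - wc‖
      * (1 / 2 * (‖S.GR x ∘L S.dphiT x x‖ * ‖S.cb • S.gradB x‖ * ‖S.W x - wa‖)
          + 1 / 4 * (‖S.GR x‖ * ‖S.cb • S.gradB x‖ ^ 2))
      ≤ S.regBound * ‖S.W x - wc‖
          * (1 / 2 * (S.sup₁ (fun x => ‖S.GR x ∘L S.dphiT x x‖) * (S.cb * Bsup) * ‖S.W x - wa‖)
          + 1 / 4 * (S.sup₁ (fun x => ‖S.GR x‖) * (S.cb * Bsup) ^ 2)) := by
    gcongr
  linarith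

theorem inner_LamAvg (x : E n) (wa : E L) (th : E p) (t : ℝ) (v : E L) :
    ⟪v, S.LamAvg x wa th t v⟫
      = 1 / N * ∑ i, ⟪v, S.Lam (S.regressor (S.xi i x t) x 0 wa th) v⟫ := by
  simp [LamAvg, omegaAt_eq_regressor, inner_smul_right, inner_sum, sum_apply]

theorem sum_regressorTerm_le (hS : S.WeakAssumptions) {x : E n} (hx : x ∈ S.χ) (wc wa : E L)
    (th : E p) {t : ℝ} (ht : 0 ≤ t) :
    1 / N * ∑ i, S.regressorTerm (S.xi i x t) x 0 wc wa th
      ≤ -(1 / 2 * ⟪S.W x - wc, S.LamAvg x wa th t (S.W x - wc)⟫)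
        + S.commonBound ‖S.W x - wc‖ ‖S.W x - wa‖ ‖S.θ - th‖ := by
  set C := S.commonBound ‖S.W x - wc‖ ‖S.W x - wa‖ ‖S.θ - th‖
  have hC : 0 ≤ C := commonBound_nonneg (norm_nonneg _) (norm_nonneg _) (norm_nonneg _)
  have hterm : ∀ i, S.regressorTerm (S.xi i x t) x 0 wc wa th
      ≤ -(1 / 2 * ⟪S.W x - wc, S.Lam (S.regressor (S.xi i x t) x 0 wa th) (S.W x - wc)⟫) + C :=
    fun i => by
      simpa using regressorTerm_le hS hx (hS.extrapolation i x hx t ht) 0 wc wa th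
  calc 1 / N * ∑ i, S.regressorTerm (S.xi i x t) x 0 wc wa th
      ≤ 1 / N * ∑ i, (-(1 / 2
          * ⟪S.W x - wc, S.Lam (S.regressor (S.xi i x t) x 0 wa th) (S.W x - wc)⟫) + C) := by
        gcongr with i
        exact hterm i
    _ = -(1 / 2 * ⟪S.W x - wc, S.LamAvg x wa th t (S.W x - wc)⟫) + N / N * C := by
        rw [inner_LamAvg, Finset.sum_add_distrib, Finset.sum_neg_distrib, ← Finset.mul_sum,
          Finset.sum_const, Finset.card_univ, Fintype.card_fin, nsmul_eq_mul]
        ring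
    _ ≤ _ := by
        gcongr
        exact mul_le_of_le_one_left hC (div_self_le_one _)

/-! ### Rates along the closed loop -/

variable (S) in
/-- The vector field `f + g u` of the plant under the policy with actor weights `wa`. -/
noncomputable def field (x : E n) (wa : E L) : E n := S.f x + S.g x (S.policy x wa)

theorem field_eq (x : E n) (wa : E L) :
    S.field x wa = S.f x - (1 / 2 : ℝ) • S.GR x (S.dphiT x x (S.W x))
      + (1 / 2 : ℝ) • S.GR x (S.dphiT x x (S.W x - wa)) - (S.cb / 2) • S.GR x (S.gradB x) := by
  rw [field, policy_eq_feedback, g_feedback, map_sub, map_sub, map_add, map_smul]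
  module

theorem inner_gradient_field_eq (hS : S.WeakAssumptions) (x : E n) (wa : E L) :
    ⟪gradient S.V x, S.field x wa⟫
      = -⟪x, S.Q x⟫ - 1 / 4 * ⟪gradient S.V x, S.GR x (gradient S.V x)⟫
        + 1 / 2 * S.dV x (S.GR x (gradient S.V x - S.dphiT x x (S.W x)))
        + 1 / 2 * S.dV x (S.GR x (S.dphiT x x (S.W x - wa)))
        - S.cb / 2 * S.dV x (S.GR x (S.gradB x)) := by
  have hQ := inner_Q_eq_of_hjb hS.R_pos (hS.hjb x)
  rw [field_eq]
  simp only [dV_apply, map_sub, inner_sub_right, inner_add_right, real_inner_smul_right]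
  linarith

theorem norm_gradient_sub_dphiT_le (hS : S.WeakAssumptions) {x : E n} (hx : x ∈ S.χ) :
    ‖gradient S.V x - S.dphiT x x (S.W x)‖
      ≤ S.sup₁ (fun x => ‖innerSL ℝ (S.phi x x) ∘L S.dW x + S.dEps x‖) := by
  have hrow : innerSL ℝ (gradient S.V x - S.dphiT x x (S.W x))
      = innerSL ℝ (S.phi x x) ∘L S.dW x + S.dEps x := by
    rw [inner_phi_dW_add_dEps hS hx]
    ext w
    simp [dV_apply, inner_dphiT]
  rw [← innerSL_apply_norm (𝕜 := ℝ), hrow]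
  exact norm_le_sup₁ (bddOn_phi_dW_add_dEps hS) hx

theorem value_rate_le (hS : S.WeakAssumptions) {x : E n} (hx : x ∈ S.χ) (wa : E L) {Bsup : ℝ}
    (hB : ‖S.gradB x‖ ≤ Bsup) :
    ⟪gradient S.V x, S.field x wa⟫
      ≤ -(lambdaMin S.Q * ‖x‖ ^ 2)
        + 1 / 2 * S.sup₁ (fun x => ‖S.dV x ∘L S.GR x‖)
          * (S.sup₁ (fun x => ‖innerSL ℝ (S.phi x x) ∘L S.dW x + S.dEps x‖) + S.cb * Bsup)
        + 1 / 2 * S.sup₁ (fun x => ‖S.dV x ∘L S.GR x ∘L S.dphiT x x‖) * ‖S.W x - wa‖ := by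
  have hQ := lambdaMin_mul_norm_sq_le hS.Q_pos.1 x
  have hG := (isPositive_GR hS.R_pos x).inner_nonneg_right (gradient S.V x)
  have hVG : ‖S.dV x ∘L S.GR x‖ ≤ S.sup₁ (fun x => ‖S.dV x ∘L S.GR x‖) :=
    norm_le_sup₁ ((bddOn_dV hS (mapsTo_id _)).clm_comp (bddOn_GR hS (mapsTo_id _))) hx
  have hVGφ : ‖S.dV x ∘L S.GR x ∘L S.dphiT x x‖
      ≤ S.sup₁ (fun x => ‖S.dV x ∘L S.GR x ∘L S.dphiT x x‖) :=
    norm_le_sup₁ ((bddOn_dV hS (mapsTo_id _)).clm_comp ((bddOn_GR hS (mapsTo_id _)).clm_comp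
      (bddOn_dphiT hS (mapsTo_id _) (mapsTo_id _)))) hx
  have herror : S.dV x (S.GR x (gradient S.V x - S.dphiT x x (S.W x)))
      ≤ S.sup₁ (fun x => ‖S.dV x ∘L S.GR x‖)
        * S.sup₁ (fun x => ‖innerSL ℝ (S.phi x x) ∘L S.dW x + S.dEps x‖) :=
    (le_abs_self _).trans ((S.dV x ∘L S.GR x).le_of_opNorm_le_of_le hVG
      (norm_gradient_sub_dphiT_le hS hx))
  have hbarrier : -S.dV x (S.GR x (S.gradB x)) ≤ S.sup₁ (fun x => ‖S.dV x ∘L S.GR x‖) * Bsup :=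
    (neg_le_abs _).trans ((S.dV x ∘L S.GR x).le_of_opNorm_le_of_le hVG hB)
  have hactor : S.dV x (S.GR x (S.dphiT x x (S.W x - wa)))
      ≤ S.sup₁ (fun x => ‖S.dV x ∘L S.GR x ∘L S.dphiT x x‖) * ‖S.W x - wa‖ :=
    (le_abs_self _).trans ((S.dV x ∘L S.GR x ∘L S.dphiT x x).le_of_opNorm_le hVGφ _)
  rw [inner_gradient_field_eq hS]
  linarith [mul_le_mul_of_nonneg_left hbarrier hS.gains.cb_pos.le]

theorem norm_dW_field_le (hS : S.WeakAssumptions) {x : E n} (hx : x ∈ S.χ) (wa : E L) {Bsup : ℝ}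
    (hB : ‖S.gradB x‖ ≤ Bsup) :
    ‖S.dW x (S.field x wa)‖
      ≤ S.iotaX Bsup + 1 / 2 * S.sup₁ (fun x => ‖S.dW x ∘L S.GR x ∘L S.dphiT x x‖)
        * ‖S.W x - wa‖ := by
  have hcb := hS.gains.cb_pos
  have hdW := bddOn_dW hS (mapsTo_id _)
  have hGR := bddOn_GR hS (mapsTo_id _)
  have hφ := bddOn_dphiT hS (mapsTo_id _) (mapsTo_id _)
  have hdrift : ‖S.dW x (S.f x)‖ ≤ S.sup₁ (fun x => ‖S.dW x (S.f x)‖) :=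
    norm_le_sup₁ (hdW.clm_apply (bddOn_f hS (mapsTo_id _))) hx
  have hideal : ‖S.dW x (S.GR x (S.dphiT x x (S.W x)))‖
      ≤ S.sup₁ (fun x => ‖S.dW x (S.GR x (S.dphiT x x (S.W x)))‖) :=
    norm_le_sup₁ (hdW.clm_apply (hGR.clm_apply (hφ.clm_apply (bddOn_W hS (mapsTo_id _))))) hx
  have hWG : ‖S.dW x ∘L S.GR x‖ ≤ S.sup₁ (fun x => ‖S.dW x ∘L S.GR x‖) :=
    norm_le_sup₁ (hdW.clm_comp hGR) hx
  have hWGφ : ‖S.dW x ∘L S.GR x ∘L S.dphiT x x‖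
      ≤ S.sup₁ (fun x => ‖S.dW x ∘L S.GR x ∘L S.dphiT x x‖) :=
    norm_le_sup₁ (hdW.clm_comp (hGR.clm_comp hφ)) hx
  have hbarrier : ‖S.dW x (S.GR x (S.gradB x))‖ ≤ S.sup₁ (fun x => ‖S.dW x ∘L S.GR x‖) * Bsup :=
    (S.dW x ∘L S.GR x).le_of_opNorm_le_of_le hWG hB
  have hactor : ‖S.dW x (S.GR x (S.dphiT x x (S.W x - wa)))‖
      ≤ S.sup₁ (fun x => ‖S.dW x ∘L S.GR x ∘L S.dphiT x x‖) * ‖S.W x - wa‖ :=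
    (S.dW x ∘L S.GR x ∘L S.dphiT x x).le_of_opNorm_le hWGφ _
  have htriangle : ‖S.dW x (S.field x wa)‖
      ≤ ‖S.dW x (S.f x)‖ + 1 / 2 * ‖S.dW x (S.GR x (S.dphiT x x (S.W x)))‖
        + 1 / 2 * ‖S.dW x (S.GR x (S.dphiT x x (S.W x - wa)))‖
        + S.cb / 2 * ‖S.dW x (S.GR x (S.gradB x))‖ := by
    rw [field_eq, map_sub, map_add, map_sub, map_smul, map_smul, map_smul]
    refine (norm_sub_le _ _).trans (add_le_add ((norm_add_le _ _).trans
      (add_le_add ((norm_sub_le _ _).trans (add_le_add le_rfl ?_)) ?_)) ?_) <;>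
    rw [norm_smul, Real.norm_of_nonneg (by positivity)]
  rw [iotaX]
  linarith [mul_le_mul_of_nonneg_left hbarrier hcb.le]

theorem inner_inverse_critic (x : E n) (wc wa : E L) {Γ : E L →L[ℝ] E L} (hΓ : IsSelfAdjoint Γ)
    (hinv : Γ.IsInvertible) (th : E p) (t : ℝ) (c : E L) :
    ⟪Γ.inverse c, S.critic x wc wa Γ th t⟫
      = -(S.kc1 * (⟪c, S.regressor x x (S.cb • S.gradB x) wa th⟫
            / S.rho (S.regressor x x (S.cb • S.gradB x) wa th) ^ 2
            * S.bellmanError x x (S.cb • S.gradB x) wc wa th)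
        + S.kc2 * (1 / N * ∑ i, ⟪c, S.regressor (S.xi i x t) x 0 wa th⟫
            / S.rho (S.regressor (S.xi i x t) x 0 wa th) ^ 2
            * S.bellmanError (S.xi i x t) x 0 wc wa th)) := by
  have hcancel : ∀ v, ⟪Γ.inverse c, Γ v⟫ = ⟪c, v⟫ := fun v => by
    rw [← congrArg (⟪·, v⟫) (hinv.self_apply_inverse c)]
    exact (hΓ.isSymmetric (Γ.inverse c) v).symm
  simp only [critic, inner_neg_right, hcancel, inner_add_right, real_inner_smul_right, inner_sum,
    omega_eq_regressor, omegaAt_eq_regressor, delta_eq_bellmanError, deltaAt_eq_bellmanError,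
    Finset.mul_sum]
  refine congrArg Neg.neg (congrArg₂ _ (by ring) (Finset.sum_congr rfl fun i _ => by ring))

theorem inner_sub_le_inner_sub_proj (hconvex : ConvexOn ℝ univ S.P)
    (hdiff : Differentiable ℝ S.P) (hε : 0 < S.εP) {z : E L} (hz : S.P z ≤ 0) (w τ : E L) :
    ⟪z - w, τ⟫ ≤ ⟪z - w, S.proj w τ⟫ := by
  rw [proj]
  split_ifs with h
  · exact le_rfl
  · obtain ⟨hw, hτ⟩ := not_or.1 h
    rw [not_le] at hw hτ
    have hinward : ⟪z - w, gradient S.P w⟫ ≤ 0 := by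
      rw [real_inner_comm]
      linarith [inner_gradient_le_of_convexOn hconvex (hdiff w) z]
    have hcoeff : 0 ≤ min 1 (S.P w / S.εP)
        * (⟪gradient S.P w, τ⟫ / ‖gradient S.P w‖ ^ 2) := by positivity
    rw [inner_sub_right, real_inner_smul_right]
    linarith [mul_nonpos_of_nonneg_of_nonpos hcoeff hinward]

theorem le_inner_actor (hS : S.WeakAssumptions) {x : E n} (hx : x ∈ S.χ) (wc wa : E L)
    (th : E p) (t : ℝ) :
    -(S.ka1 * ⟪S.W x - wa, S.W x - wc⟫) + (S.ka1 + S.ka2) * ‖S.W x - wa‖ ^ 2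
        - S.ka2 * ⟪S.W x - wa, S.W x⟫
        + S.kc1 * (1 / (4 * S.rho (S.regressor x x (S.cb • S.gradB x) wa th) ^ 2)
          * ⟪S.regressor x x (S.cb • S.gradB x) wa th, wc⟫ * ⟪S.W x - wa, S.Gphi x x wa⟫)
        + S.kc2 * (1 / N * ∑ i, 1 / (4 * S.rho (S.regressor (S.xi i x t) x 0 wa th) ^ 2)
          * ⟪S.regressor (S.xi i x t) x 0 wa th, wc⟫ * ⟪S.W x - wa, S.Gphi (S.xi i x t) x wa⟫)
      ≤ ⟪S.W x - wa, S.actor x wc wa th t⟫ := by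
  rw [actor]
  refine le_trans (le_of_eq ?_) (inner_sub_le_inner_sub_proj hS.P_convex hS.P_diff hS.εP_pos
    (hS.ideal x hx) wa _)
  have hadjoint : ∀ y, ContinuousLinearMap.adjoint (S.Gphi y x) = S.Gphi y x := fun y =>
    (isPositive_Gphi hS.R_pos y x).isSelfAdjoint.adjoint_eq
  set c := S.W x - wc with hc
  set a := S.W x - wa with ha
  have hdecay : -(S.ka1 • (wa - wc)) - S.ka2 • wa
      = -(S.ka1 • c) + (S.ka1 + S.ka2) • a - S.ka2 • S.W x := by rw [hc, ha]; module
  rw [hdecay]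
  simp only [hadjoint, inner_sub_right, inner_add_right, inner_neg_right, inner_sum,
    real_inner_smul_right, real_inner_self_eq_norm_sq, omega_eq_regressor, omegaAt_eq_regressor,
    Finset.mul_sum]
  refine congrArg₂ _ (by ring) (Finset.sum_congr rfl fun i _ => ?_)
  simp only [div_eq_mul_inv, mul_inv]
  ring

theorem learning_rate_le (hS : S.WeakAssumptions) {x : E n} (hx : x ∈ S.χ) (wc wa : E L)
    {Γ : E L →L[ℝ] E L} (hΓ : IsSelfAdjoint Γ) (hinv : Γ.IsInvertible) (th : E p) (t : ℝ) :
    -⟪Γ.inverse (S.W x - wc), S.critic x wc wa Γ th t⟫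
        + 1 / 2 * (S.kc1 * ⟪S.W x - wc, S.Lam (S.omega x wa th) (S.W x - wc)⟫
          + S.kc2 * ⟪S.W x - wc, S.LamAvg x wa th t (S.W x - wc)⟫)
        - ⟪S.W x - wa, S.actor x wc wa th t⟫
      ≤ S.ka1 * ⟪S.W x - wa, S.W x - wc⟫ + S.ka2 * ⟪S.W x - wa, S.W x⟫
        - (S.ka1 + S.ka2) * ‖S.W x - wa‖ ^ 2
        + S.kc1 * S.regressorTerm x x (S.cb • S.gradB x) wc wa th
        + S.kc2 * (1 / N * ∑ i, S.regressorTerm (S.xi i x t) x 0 wc wa th) := by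
  rw [inner_inverse_critic x wc wa hΓ hinv, inner_LamAvg, omega_eq_regressor]
  simp only [regressorTerm, Finset.sum_sub_distrib, Finset.sum_add_distrib, ← Finset.mul_sum]
  linarith [le_inner_actor hS hx wc wa th t]

/-- The bound on what the learning laws add to the rate, besides the decay of `W̃_c` and `W̃_a`, in
terms of the norms of `W̃_c`, `W̃_a` and `θ̃`. -/
noncomputable def learningBound (S : Scheme n m L p N) (Bsup c a ϑ : ℝ) : ℝ :=
  S.ka1 * (a * c) + S.ka2 * (a * S.sup₁ (fun x => ‖S.W x‖))
    + S.kc1 * (S.commonBound c a ϑ + S.regBound * c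
        * (1 / 2 * (S.sup₁ (fun x => ‖S.GR x ∘L S.dphiT x x‖) * (S.cb * Bsup) * a)
          + 1 / 4 * (S.sup₁ (fun x => ‖S.GR x‖) * (S.cb * Bsup) ^ 2)))
    + S.kc2 * S.commonBound c a ϑ

theorem learning_rate_le_learningBound (hS : S.WeakAssumptions) {x : E n} (hx : x ∈ S.χ)
    (wc wa : E L) {Γ : E L →L[ℝ] E L} (hΓ : IsSelfAdjoint Γ) (hinv : Γ.IsInvertible) (th : E p)
    {t c₃ Bsup : ℝ} (ht : 0 ≤ t) (hB : ‖S.gradB x‖ ≤ Bsup)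
    (hexc : c₃ * ‖S.W x - wc‖ ^ 2 ≤ ⟪S.W x - wc, S.LamAvg x wa th t (S.W x - wc)⟫) :
    -⟪Γ.inverse (S.W x - wc), S.critic x wc wa Γ th t⟫
        + 1 / 2 * (S.kc1 * ⟪S.W x - wc, S.Lam (S.omega x wa th) (S.W x - wc)⟫
          + S.kc2 * ⟪S.W x - wc, S.LamAvg x wa th t (S.W x - wc)⟫)
        - ⟪S.W x - wa, S.actor x wc wa th t⟫
      ≤ S.learningBound Bsup ‖S.W x - wc‖ ‖S.W x - wa‖ ‖S.θ - th‖
        - (S.ka1 + S.ka2) * ‖S.W x - wa‖ ^ 2 - 1 / 2 * S.kc2 * (c₃ * ‖S.W x - wc‖ ^ 2) := by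
  have hW : ⟪S.W x - wa, S.W x⟫ ≤ ‖S.W x - wa‖ * S.sup₁ (fun x => ‖S.W x‖) :=
    (real_inner_le_norm _ _).trans (mul_le_mul_of_nonneg_left
      (norm_le_sup₁ (bddOn_W hS (mapsTo_id _)) hx) (norm_nonneg _))
  have htrajectory := regressorTerm_trajectory_le hS hx wc wa th hB
  have hextrapolated := sum_regressorTerm_le hS hx wc wa th ht
  rw [learningBound]
  linarith [learning_rate_le hS hx wc wa hΓ hinv th t,
    mul_le_mul_of_nonneg_left (real_inner_le_norm (S.W x - wa) (S.W x - wc)) hS.gains.ka1_pos.le,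
    mul_le_mul_of_nonneg_left hW hS.gains.ka2_pos.le,
    mul_le_mul_of_nonneg_left htrajectory hS.gains.kc1_pos.le,
    mul_le_mul_of_nonneg_left hextrapolated hS.gains.kc2_pos.le,
    mul_le_mul_of_nonneg_left hexc hS.gains.kc2_pos.le]

/-! ### The constants of the theorem -/

theorem clow_mul_pos (hS : S.GainsPos) {c₃ Γup : ℝ} (hc₃ : 0 ≤ c₃) (hup : 0 < Γup) :
    0 < S.clow c₃ Γup * S.kc2 := by
  have hkc2 := hS.kc2_pos
  have hβ := hS.βc_pos
  rw [clow]
  positivity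

theorem clow_mul_mul_sq (hS : S.GainsPos) {Γup : ℝ} (hup : 0 < Γup) (c₃ c : ℝ) :
    S.clow c₃ Γup * S.kc2 * c ^ 2
      = 1 / 2 * S.kc2 * (c₃ * c ^ 2) + 1 / 2 * (S.βc * (c ^ 2 / Γup)) := by
  have hkc2 := hS.kc2_pos
  rw [clow]
  field_simp

theorem kappa_pos (hn : 0 < n) (hS : S.WeakAssumptions) {c₃ Γup : ℝ} (hc₃ : 0 ≤ c₃)
    (hup : 0 < Γup) : 0 < S.kappa c₃ Γup := by
  have hclow := clow_mul_pos hS.gains hc₃ hup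
  have hka1 := hS.gains.ka1_pos
  have hka2 := hS.gains.ka2_pos
  have hK := hS.identifier.K_pos
  rw [kappa]
  exact lt_min (hS.Q_pos.lambdaMin_pos hn) (by positivity)

theorem iota_pos (hS : S.WeakAssumptions) {c₃ Γup Bsup : ℝ} (hc₃ : 0 ≤ c₃)
    (hup : 0 < Γup) (hB : 0 ≤ Bsup) (Γlow : ℝ) : 0 < S.iota c₃ Γlow Γup Bsup := by
  have hclow := clow_mul_pos hS.gains hc₃ hup
  have hka1 := hS.gains.ka1_pos
  have hka2 := hS.gains.ka2_pos
  have hcb := hS.gains.cb_pos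
  have hK := hS.identifier.K_pos
  have hD := hS.identifier.D_pos
  have hVG : 0 ≤ S.sup₁ (fun x => ‖S.dV x ∘L S.GR x‖) := sup₁_nonneg fun _ => norm_nonneg _
  have hε : 0 ≤ S.sup₁ (fun x => ‖innerSL ℝ (S.phi x x) ∘L S.dW x + S.dEps x‖) :=
    sup₁_nonneg fun _ => norm_nonneg _
  rw [iota, mul_assoc 2 (S.clow c₃ Γup)]
  positivity

theorem cross_terms_le {c₃ Γlow Γup Bsup : ℝ} (hM : 0 < lambdaMin (S.M c₃ Γlow Γup Bsup))
    (c a ϑ : ℝ) :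
    S.phiA * a ^ 2 + S.phiAC Γlow Bsup * (a * c) + S.phiCθ * (c * ϑ)
      ≤ S.clow c₃ Γup * S.kc2 / 4 * c ^ 2 + (S.ka1 + S.ka2) / 4 * a ^ 2 + S.Kθ / 4 * ϑ ^ 2 := by
  have hM_symm : (S.M c₃ Γlow Γup Bsup).IsHermitian := by
    ext i j
    fin_cases i <;> fin_cases j <;> rfl
  have hquad := dotProduct_mulVec_nonneg_of_lambdaMin_pos hM_symm hM ![c, a, ϑ]
  simp only [M, Matrix.mulVec, dotProduct, Fin.sum_univ_three, Matrix.of_apply,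
    Matrix.cons_val] at hquad
  linarith

theorem kappa_mul_le (c₃ Γup : ℝ) {x c a ϑ : ℝ} (hx : 0 ≤ x) (hc : 0 ≤ c) (ha : 0 ≤ a)
    (hϑ : 0 ≤ ϑ) :
    S.kappa c₃ Γup * (x + c + a + ϑ) ≤ lambdaMin S.Q * x
      + S.clow c₃ Γup * S.kc2 / 4 * c + (S.ka1 + S.ka2) / 4 * a + S.Kθ / 4 * ϑ := by
  simp only [mul_add]
  gcongr <;> simp [kappa]

theorem learningBound_add_eq (Γlow Bsup c a ϑ : ℝ) :
    S.learningBound Bsup c a ϑ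
        + (c / Γlow + a) * (S.iotaX Bsup
          + 1 / 2 * S.sup₁ (fun x => ‖S.dW x ∘L S.GR x ∘L S.dphiT x x‖) * a)
        + 1 / 2 * S.sup₁ (fun x => ‖S.dV x ∘L S.GR x ∘L S.dphiT x x‖) * a
      = S.iotaC Γlow Bsup * c + S.iotaA Bsup * a
        + (S.phiA * a ^ 2 + S.phiAC Γlow Bsup * (a * c) + S.phiCθ * (c * ϑ)) := by
  simp only [learningBound, iotaC, iotaA, phiA, phiAC, phiCθ, commonBound, regBound]
  ring

theorem completed_squares_le (hS : S.WeakAssumptions) {c₃ Γlow Γup Bsup : ℝ} (hc₃ : 0 ≤ c₃)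
    (hup : 0 < Γup) (hM : 0 < lambdaMin (S.M c₃ Γlow Γup Bsup)) (x c a ϑ : ℝ) :
    -(lambdaMin S.Q * x ^ 2)
        + 1 / 2 * S.sup₁ (fun x => ‖S.dV x ∘L S.GR x‖)
          * (S.sup₁ (fun x => ‖innerSL ℝ (S.phi x x) ∘L S.dW x + S.dEps x‖) + S.cb * Bsup)
        + (S.iotaC Γlow Bsup * c + S.iotaA Bsup * a
          + (S.phiA * a ^ 2 + S.phiAC Γlow Bsup * (a * c) + S.phiCθ * (c * ϑ)))
        - S.clow c₃ Γup * S.kc2 * c ^ 2 - (S.ka1 + S.ka2) * a ^ 2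
        + (-S.Kθ * ϑ ^ 2 + S.Dθ * ϑ)
      ≤ -(S.kappa c₃ Γup * (x ^ 2 + c ^ 2 + a ^ 2 + ϑ ^ 2)) + S.iota c₃ Γlow Γup Bsup := by
  have hcross := cross_terms_le hM c a ϑ
  have hcritic := mul_sub_half_mul_sq_le (clow_mul_pos hS.gains hc₃ hup) (S.iotaC Γlow Bsup) c
  have hactor := mul_sub_half_mul_sq_le (add_pos hS.gains.ka1_pos hS.gains.ka2_pos)
    (S.iotaA Bsup) a
  have hident := mul_sub_half_mul_sq_le hS.identifier.K_pos S.Dθ ϑ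
  have hκ := kappa_mul_le (S := S) c₃ Γup (sq_nonneg x) (sq_nonneg c) (sq_nonneg a) (sq_nonneg ϑ)
  rw [iota, mul_assoc 2 (S.clow c₃ Γup)]
  linarith

/-! ### Decay of the Lyapunov function -/

variable (S) in
/-- The derivative of the Lyapunov function candidate along a run, by the chain rule. -/
noncomputable def lyapRate (r : Run n L p) (t : ℝ) : ℝ :=
  let F := S.field (r.x t) (r.Wa t)
  let c := S.W (r.x t) - r.Wc t
  ⟪gradient S.V (r.x t), F⟫
    + (⟪(r.Γ t).inverse c,
        S.dW (r.x t) F - S.critic (r.x t) (r.Wc t) (r.Wa t) (r.Γ t) (r.θh t) t⟫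
      + 1 / 2 * ⟪c, (S.info r t - S.βc • (r.Γ t).inverse) c⟫)
    + ⟪S.W (r.x t) - r.Wa t,
        S.dW (r.x t) F - S.actor (r.x t) (r.Wc t) (r.Wa t) (r.θh t) t⟫
    + fderiv ℝ S.Vθ (S.θ - r.θh t, t) (-r.ψ (r.θh t) t, 1)

theorem lyapRate_le (hS : S.WeakAssumptions) {r : Run n L p} {t₀ c₃ Γlow Γup Bsup t : ℝ}
    (hr : S.ExcitedRun r t₀ c₃ Bsup) (hΓ : r.GainBounds t₀ Γlow Γup) (hc₃ : 0 ≤ c₃)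
    (hlow : 0 < Γlow) (hup : 0 < Γup) (hM : 0 < lambdaMin (S.M c₃ Γlow Γup Bsup))
    (ht : t₀ < t) (hx : r.x t ∈ S.χ) :
    S.lyapRate r t ≤ -(S.kappa c₃ Γup * ‖S.Z r t‖ ^ 2) + S.iota c₃ Γlow Γup Bsup := by
  obtain ⟨hΓ_symm, hΓt⟩ := hΓ t ht.le
  have hΓlow : ∀ v, Γlow * ‖v‖ ^ 2 ≤ ⟪v, r.Γ t v⟫ := fun v => (hΓt v).1
  obtain ⟨T, c₁, c₂, -, -, -, -, -, hexc⟩ := hr.excitation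
  have hB := hr.gradB_bound t ((timeInterval_top t₀).superset ht.le) (hr.mem_interior hS ht.le)
  have hvalue := value_rate_le hS hx (r.Wa t) hB
  have hlearning := learning_rate_le_learningBound hS hx (r.Wc t) (r.Wa t) hΓ_symm
    (isInvertible_of_coercive hlow hΓlow) (r.θh t) (hr.t₀_nonneg.trans ht.le) hB
    (hexc t ht.le _).2.2
  have hident := (hr.identifier (S.θ - r.θh t) t ht).2
  rw [sub_sub_cancel] at hident
  have hdW := norm_dW_field_le hS hx (r.Wa t) hB
  have hforget := mul_le_mul_of_nonneg_left
    (norm_sq_div_le_inner_inverse hΓ_symm hlow hup hΓt (S.W (r.x t) - r.Wc t)) hS.gains.βc_pos.le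
  rw [lyapRate, Z, norm_stack_sq]
  simp only [sub_apply, smul_apply, inner_sub_right, inner_smul_right, inner_info, LamRun,
    LamAvgRun]
  set c := S.W (r.x t) - r.Wc t
  set a := S.W (r.x t) - r.Wa t
  set dW := S.dW (r.x t) (S.field (r.x t) (r.Wa t))
  have hcritic : ⟪(r.Γ t).inverse c, dW⟫ ≤ ‖c‖ / Γlow * ‖dW‖ :=
    (real_inner_le_norm _ _).trans <|
      mul_le_mul_of_nonneg_right (norm_inverse_apply_le hlow hΓlow c) (norm_nonneg _)
  have hactor : ⟪a, dW⟫ ≤ ‖a‖ * ‖dW‖ := real_inner_le_norm _ _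
  have hdW' := mul_le_mul_of_nonneg_left hdW (by positivity : 0 ≤ ‖c‖ / Γlow + ‖a‖)
  have hsplit := learningBound_add_eq (S := S) Γlow Bsup ‖c‖ ‖a‖ ‖S.θ - r.θh t‖
  have hclow := clow_mul_mul_sq hS.gains hup c₃ ‖c‖
  linarith [completed_squares_le hS hc₃ hup hM ‖r.x t‖ ‖c‖ ‖a‖ ‖S.θ - r.θh t‖]

end Scheme

theorem continuous_stack {n L p : ℕ} : Continuous fun q : E n × E L × E L × E p =>
    stack q.1 q.2.1 q.2.2.1 q.2.2.2 := by
  refine (PiLp.continuous_toLp 2 _).comp (continuous_pi ?_)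
  rintro (i | i | i | i) <;> simp only [Sum.elim_inl, Sum.elim_inr] <;> fun_prop

theorem UniformlyUltimatelyBounded.limsup_norm_le {F : Type*} [NormedAddCommGroup F]
    {𝓕 : Set (ℝ × (ℝ → F))} {ρ : ℝ} (h : UniformlyUltimatelyBounded 𝓕 ρ) {q : ℝ × (ℝ → F)}
    (hq : q ∈ 𝓕) : limsup (fun t => ((‖q.2 t‖ : ℝ) : EReal)) atTop ≤ (ρ : EReal) := by
  obtain ⟨T, -, hT⟩ := h (max 1 ‖q.2 q.1‖) (by positivity)
  refine limsup_le_of_le (by isBoundedDefault) ?_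
  filter_upwards [eventually_ge_atTop (q.1 + T)] with t ht
  exact EReal.coe_le_coe_iff.2 (hT q hq (le_max_right _ _) t ht)

/-! ### Trajectories of the composite state -/

namespace Scheme

variable {n m L p N : ℕ} {S : Scheme n m L p N}

/-- The Lyapunov function candidate `V_L(Z(t), t)` along a run. -/
noncomputable def lyap (S : Scheme n m L p N) (r : Run n L p) (t : ℝ) : ℝ :=
  S.VL r (r.x t) (S.W (r.x t) - r.Wc t) (S.W (r.x t) - r.Wa t) (S.θ - r.θh t) t

theorem mu_nonneg (c₃ Γlow Γup Bsup : ℝ) : 0 ≤ S.mu c₃ Γlow Γup Bsup := Real.sqrt_nonneg _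

theorem le_kappa_mul_sq_of_mu_le {c₃ Γlow Γup Bsup z : ℝ} (hκ : 0 < S.kappa c₃ Γup)
    (hι : 0 ≤ S.iota c₃ Γlow Γup Bsup) (hz : S.mu c₃ Γlow Γup Bsup ≤ z) :
    2 * S.iota c₃ Γlow Γup Bsup ≤ S.kappa c₃ Γup * z ^ 2 := by
  have hsq := pow_le_pow_left₀ (mu_nonneg c₃ Γlow Γup Bsup) hz 2
  rwa [mu, Real.sq_sqrt (by positivity), div_le_iff₀' hκ] at hsq

theorem Sandwich.apply_le_apply {r : Run n L p} {t₀ ζ : ℝ} {η₁ η₂ : ℝ → ℝ}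
    (h : S.Sandwich r t₀ η₁ η₂) (hn : 0 < n) (hζ : 0 ≤ ζ)
    (hball : ∀ (x : E n) (wc wa : E L) (th : E p),
      stack x wc wa th ∈ Metric.closedBall 0 ζ → x ∈ S.χ) : η₁ ζ ≤ η₂ ζ := by
  have hnorm : ‖stack (EuclideanSpace.single (⟨0, hn⟩ : Fin n) ζ) (0 : E L) (0 : E L)
      (0 : E p)‖ = ζ := by
    refine (sq_eq_sq₀ (norm_nonneg _) hζ).1 ?_
    simp [norm_stack_sq]
  have hsand := h t₀ le_rfl _ (hball _ _ _ _ (mem_closedBall_zero_iff.2 hnorm.le)) 0 0 0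
  rw [hnorm] at hsand
  exact hsand.1.trans hsand.2

namespace ExcitedRun

variable {r : Run n L p} {t₀ c₃ Γlow Γup Bsup ζ : ℝ} {η₁ η₂ : ℝ → ℝ}

theorem continuousOn_lyap (hS : S.WeakAssumptions) (hr : S.ExcitedRun r t₀ c₃ Bsup) {b : ℝ}
    (hx : ∀ t ∈ Icc t₀ b, r.x t ∈ S.χ) : ContinuousOn (S.lyap r) (Icc t₀ b) := by
  obtain ⟨K, D, hflow, -⟩ := hr.exists_gainFlow hS
  have hsub := Icc_subset_Ici_self.trans (timeInterval_top t₀).superset (a := Icc t₀ b)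
  have hxc := hr.sol.x_cont.mono hsub
  have hW : ContinuousOn (fun s => S.W (r.x s)) (Icc t₀ b) := fun t ht =>
    (hS.contDiffAt_W (hx t ht)).continuousAt.comp_continuousWithinAt (hxc t ht)
  have hc := hW.sub (hr.sol.Wc_cont.mono hsub)
  have ha := hW.sub (hr.sol.Wa_cont.mono hsub)
  have hθ : ContinuousOn (fun s => S.θ - r.θh s) (Icc t₀ b) :=
    continuousOn_const.sub (hr.sol.θh_cont.mono hsub)
  have hΓ := hflow.continuousOn_inverse (s := Icc t₀ b) Icc_subset_Ici_self
    fun t ht => hflow.isInvertible ht.1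
  have hVθ : ContinuousOn (fun s => S.Vθ (S.θ - r.θh s, s)) (Icc t₀ b) :=
    hS.identifier.cont.comp (hθ.prodMk continuousOn_id) fun t ht =>
      ⟨mem_univ _, hr.t₀_nonneg.trans ht.1⟩
  exact (((hS.V_smooth.continuous.comp_continuousOn hxc).add
    (continuousOn_const.mul (hc.inner (hΓ.clm_apply hc)))).add
    (continuousOn_const.mul (ha.inner ha))).add hVθ

theorem exists_hasDerivAt_lyap (hS : S.WeakAssumptions) (hr : S.ExcitedRun r t₀ c₃ Bsup) :
    ∃ D : Set ℝ, (∀ s, (D ∩ Icc t₀ s).Finite) ∧ ∀ t > t₀, t ∉ D → r.x t ∈ S.χ →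
      HasDerivAt (S.lyap r) (S.lyapRate r t) t := by
  obtain ⟨K, D, hflow, hode⟩ := hr.exists_gainFlow hS
  refine ⟨D, hflow.finite, fun t ht htD hxχ => ?_⟩
  obtain ⟨hx, hWc, hWa, hθh⟩ := hode t ht htD
  have hΓ := hflow.hasDerivAt_inverse ht htD (hflow.isInvertible ht.le)
  have hV : HasDerivAt (fun s => S.V (r.x s)) _ t := (hS.hasFDerivAt_V _).comp_hasDerivAt t hx
  have hW : HasDerivAt (fun s => S.W (r.x s)) _ t := (hS.hasFDerivAt_W hxχ).comp_hasDerivAt t hx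
  have hc : HasDerivAt (fun s => S.W (r.x s) - r.Wc s) _ t := hW.sub hWc
  have ha : HasDerivAt (fun s => S.W (r.x s) - r.Wa s) _ t := hW.sub hWa
  have hθ : HasDerivAt (fun s => (S.θ - r.θh s, s)) (-r.ψ (r.θh t) t, (1 : ℝ)) t :=
    (hθh.const_sub S.θ).prodMk (hasDerivAt_id t)
  have hVθ : HasDerivAt (fun s => S.Vθ (S.θ - r.θh s, s)) _ t :=
    HasFDerivAt.comp_hasDerivAt (f := fun s => (S.θ - r.θh s, s)) t
      (hr.identifier (S.θ - r.θh t) t ht).1.hasFDerivAt hθ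
  have hsum : HasDerivAt (S.lyap r) _ t :=
    ((hV.add ((hc.inner ℝ (hΓ.clm_apply hc)).const_mul (1 / 2))).add
      ((ha.inner ℝ ha).const_mul (1 / 2))).add hVθ
  refine hsum.congr_deriv ?_
  have hsymm (v w : E L) : ⟪v, (r.Γ t).inverse w⟫ = ⟪(r.Γ t).inverse v, w⟫ :=
    ((isSelfAdjoint_inverse (hflow.isSelfAdjoint ht.le)).isSymmetric v w).symm
  rw [lyapRate, ← dV_apply, inner_add_right, hsymm _ (_ - _), real_inner_comm ((r.Γ t).inverse _),
    real_inner_comm (S.W (r.x t) - r.Wa t)]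
  simp only [field]
  ring

theorem lyap_le (hn : 0 < n) (hS : S.WeakAssumptions) (hr : S.ExcitedRun r t₀ c₃ Bsup)
    (hΓ : r.GainBounds t₀ Γlow Γup) (hc₃ : 0 ≤ c₃) (hlow : 0 < Γlow) (hup : 0 < Γup)
    (hB : 0 ≤ Bsup) (hM : 0 < lambdaMin (S.M c₃ Γlow Γup Bsup)) (hη₂ : ClassK η₂)
    (hsand : S.Sandwich r t₀ η₁ η₂) {b : ℝ} (hb : t₀ ≤ b) (hx : ∀ t ∈ Icc t₀ b, r.x t ∈ S.χ) :
    S.lyap r b ≤ max (η₂ (S.mu c₃ Γlow Γup Bsup))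
      (S.lyap r t₀ - S.iota c₃ Γlow Γup Bsup * (b - t₀)) := by
  obtain ⟨D, hD, hderiv⟩ := hr.exists_hasDerivAt_lyap hS
  have hι := iota_pos hS hc₃ hup hB Γlow
  refine le_max_of_decreasing_above hb
    ((hD b).subset (inter_subset_inter_right _ Ioo_subset_Icc_self)) hι.le
    (hr.continuousOn_lyap hS hx)
    (fun t ht htD => hderiv t ht.1 htD (hx t (Ioo_subset_Icc_self ht))) fun t ht _ habove => ?_
  have hxt := hx t (Ioo_subset_Icc_self ht)
  have hmu : S.mu c₃ Γlow Γup Bsup < ‖S.Z r t‖ :=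
    (hη₂.lt_iff (mu_nonneg ..) (norm_nonneg _)).1
      (habove.trans_le (hsand t ht.1.le _ hxt _ _ _).2)
  linarith [lyapRate_le hS hr hΓ hc₃ hlow hup hM ht.1 hxt,
    le_kappa_mul_sq_of_mu_le (kappa_pos hn hS hc₃ hup) hι.le hmu.le]

/-- While `Z` has norm less than `ζ`, the state is in `χ`, where `Z` is continuous; so `Z` cannot
leave the ball of radius `ζ` before the state leaves `χ`. -/
theorem exists_exit_time (hS : S.WeakAssumptions) (hr : S.ExcitedRun r t₀ c₃ Bsup)
    (hball : ∀ t, ‖S.Z r t‖ ≤ ζ → r.x t ∈ S.χ) (hinit : ‖S.Z r t₀‖ < ζ) {t : ℝ} (ht : t₀ ≤ t)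
    (hout : ζ ≤ ‖S.Z r t‖) :
    ∃ s ≥ t₀, (∀ u ∈ Icc t₀ s, r.x u ∈ S.χ) ∧ ζ ≤ ‖S.Z r s‖ := by
  obtain ⟨O, hO, hχO, hW⟩ := hS.W_smooth
  have hsub := Icc_subset_Ici_self.trans (timeInterval_top t₀).superset (a := Icc t₀ t)
  have hxc := hr.sol.x_cont.mono hsub
  have hγ := hxc.prodMk ((hr.sol.Wc_cont.mono hsub).prodMk
    ((hr.sol.Wa_cont.mono hsub).prodMk (hr.sol.θh_cont.mono hsub)))
  let z (q : E n × E L × E L × E p) :=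
    stack q.1 (S.W q.1 - q.2.1) (S.W q.1 - q.2.2.1) (S.θ - q.2.2.2)
  have hz : ContinuousOn z (Prod.fst ⁻¹' O) := by
    have hWO : ContinuousOn (fun q : E n × E L × E L × E p => S.W q.1) (Prod.fst ⁻¹' O) :=
      hW.continuousOn.comp continuousOn_fst fun q hq => hq
    exact continuous_stack.comp_continuousOn (s := Prod.fst ⁻¹' O)
      (by fun_prop : ContinuousOn (fun q : E n × E L × E L × E p =>
        (q.1, S.W q.1 - q.2.1, S.W q.1 - q.2.2.1, S.θ - q.2.2.2)) _)
  have hU : IsOpen (Prod.fst ⁻¹' O ∩ z ⁻¹' Metric.ball 0 ζ) :=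
    hz.isOpen_inter_preimage (hO.preimage continuous_fst) Metric.isOpen_ball
  obtain ⟨s, ⟨hs, hst⟩, hsout, hin⟩ := exists_first_exit_time hγ hU ht
    ⟨hχO (hball t₀ hinit.le), mem_ball_zero_iff.2 hinit⟩
    fun h => hout.not_gt (mem_ball_zero_iff.1 h.2)
  have hxin : ∀ u ∈ Ico t₀ s, r.x u ∈ S.χ := fun u hu =>
    hball u (mem_ball_zero_iff.1 (hin u hu).2).le
  have hxs : ∀ u ∈ Icc t₀ s, r.x u ∈ S.χ := by
    have hmaps : MapsTo r.x (Ico t₀ s) S.χ := hxin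
    rw [← closure_Ico hs.ne, ← hS.χ_compact.isClosed.closure_eq]
    exact hmaps.closure_of_continuousOn
      (by rw [closure_Ico hs.ne]; exact hxc.mono (Icc_subset_Icc_right hst))
  refine ⟨s, hs.le, hxs, ?_⟩
  by_contra! hlt
  exact hsout ⟨hχO (hxs s ⟨hs.le, le_rfl⟩), mem_ball_zero_iff.2 hlt⟩

theorem norm_Z_lt (hn : 0 < n) (hS : S.WeakAssumptions) (hr : S.ExcitedRun r t₀ c₃ Bsup)
    (hΓ : r.GainBounds t₀ Γlow Γup) (hc₃ : 0 ≤ c₃) (hlow : 0 < Γlow) (hup : 0 < Γup)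
    (hB : 0 ≤ Bsup) (hM : 0 < lambdaMin (S.M c₃ Γlow Γup Bsup)) (hη₁ : ClassK η₁)
    (hη₂ : ClassK η₂) (hsand : S.Sandwich r t₀ η₁ η₂) (hζ : 0 < ζ)
    (hball : ∀ (x : E n) (wc wa : E L) (th : E p),
      stack x wc wa th ∈ Metric.closedBall 0 ζ → x ∈ S.χ)
    (hinit : η₂ ‖S.Z r t₀‖ < η₁ ζ) (hmu : η₂ (S.mu c₃ Γlow Γup Bsup) < η₁ ζ)
    {t : ℝ} (ht : t₀ ≤ t) : ‖S.Z r t‖ < ζ := by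
  have hχ : ∀ s, ‖S.Z r s‖ ≤ ζ → r.x s ∈ S.χ := fun s hs =>
    hball _ _ _ _ (mem_closedBall_zero_iff.2 hs)
  have hZ₀ : ‖S.Z r t₀‖ < ζ := (hη₂.lt_iff (norm_nonneg _) hζ.le).1
    (hinit.trans_le (hsand.apply_le_apply hn hζ.le hball))
  by_contra! hout
  obtain ⟨s, hs, hx, hZs⟩ := hr.exists_exit_time hS hχ hZ₀ ht hout
  have hdecay : 0 ≤ S.iota c₃ Γlow Γup Bsup * (s - t₀) :=
    mul_nonneg (iota_pos hS hc₃ hup hB Γlow).le (sub_nonneg.2 hs)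
  have hstart : S.lyap r t₀ ≤ η₂ ‖S.Z r t₀‖ := (hsand t₀ le_rfl _ (hχ _ hZ₀.le) _ _ _).2
  have hlevel : η₁ ‖S.Z r s‖ < η₁ ζ := calc
    η₁ ‖S.Z r s‖ ≤ S.lyap r s := (hsand s hs _ (hx s ⟨hs, le_rfl⟩) _ _ _).1
    _ ≤ _ := hr.lyap_le hn hS hΓ hc₃ hlow hup hB hM hη₂ hsand hs hx
    _ < η₁ ζ := max_lt hmu (by linarith)
  exact hZs.not_gt ((hη₁.lt_iff (norm_nonneg _) hζ.le).1 hlevel)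

end ExcitedRun

theorem uniformlyUltimatelyBounded (hn : 0 < n) (hS : S.WeakAssumptions)
    {c₃ Γlow Γup Bsup ζ ρ : ℝ} {η₁ η₂ : ℝ → ℝ} (hc₃ : 0 ≤ c₃) (hlow : 0 < Γlow) (hup : 0 < Γup)
    (hB : 0 ≤ Bsup) (hζ : 0 < ζ) (hη₁ : ClassK η₁) (hη₂ : ClassK η₂)
    (hball : ∀ (x : E n) (wc wa : E L) (th : E p),
      stack x wc wa th ∈ Metric.closedBall 0 ζ → x ∈ S.χ)
    (hM : 0 < lambdaMin (S.M c₃ Γlow Γup Bsup)) (hρ : 0 ≤ ρ)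
    (hηρ : η₁ ρ = η₂ (S.mu c₃ Γlow Γup Bsup)) :
    UniformlyUltimatelyBounded (S.compositeTrajectories c₃ Γlow Γup Bsup ζ η₁ η₂) ρ := by
  intro a ha
  have hι := iota_pos hS hc₃ hup hB Γlow
  set T := max 0 ((η₂ a - η₂ (S.mu c₃ Γlow Γup Bsup)) / S.iota c₃ Γlow Γup Bsup)
  have hT : 0 ≤ T := le_max_left _ _
  refine ⟨T, hT, ?_⟩
  rintro ⟨t₀, _⟩ ⟨r, rfl, hr, hΓ, hsand, hstay⟩ hle t (ht : t₀ + T ≤ t)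
  have ht₀ : t₀ ≤ t := by linarith
  have hx : ∀ s ≥ t₀, r.x s ∈ S.χ := hstay.elim id fun ⟨hinit, hmu⟩ s hs =>
    hball _ _ _ _ (mem_closedBall_zero_iff.2
      (hr.norm_Z_lt hn hS hΓ hc₃ hlow hup hB hM hη₁ hη₂ hsand hζ hball hinit hmu hs).le)
  have hstart : S.lyap r t₀ ≤ η₂ a := calc
    S.lyap r t₀ ≤ η₂ ‖S.Z r t₀‖ := (hsand t₀ le_rfl _ (hx t₀ le_rfl) _ _ _).2
    _ ≤ η₂ a := (hη₂.le_iff (norm_nonneg _) ha.le).2 hle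
  have hdecay : η₂ a - η₂ (S.mu c₃ Γlow Γup Bsup) ≤ S.iota c₃ Γlow Γup Bsup * (t - t₀) := by
    rw [← div_le_iff₀' hι]
    exact (le_max_right _ _).trans (le_sub_iff_add_le'.2 ht)
  have hlevel : η₁ ‖S.Z r t‖ ≤ η₁ ρ := calc
    η₁ ‖S.Z r t‖ ≤ S.lyap r t := (hsand t ht₀ _ (hx t ht₀) _ _ _).1
    _ ≤ _ := hr.lyap_le hn hS hΓ hc₃ hlow hup hB hM hη₂ hsand ht₀ fun s hs => hx s hs.1
    _ ≤ η₁ ρ := by rw [hηρ]; exact max_le le_rfl (by linarith)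
  exact (hη₁.le_iff (norm_nonneg _) hρ).1 hlevel

end Scheme

end SafeMBRL

theorem theorem2_general {n m L p N : ℕ} (hn : 0 < n) (S : Scheme n m L p N)
    (hS : S.WeakAssumptions) :
    S.ForwardInvariant ∧
    (∀ (r : Run n L p) (t₀ c₃ Bsup : ℝ), S.ExcitedRun r t₀ c₃ Bsup →
      (∀ t ≥ t₀, r.x t ∈ interior S.safe) ∧
      (∃ Γlow > 0, ∃ Γup > 0, r.GainBounds t₀ Γlow Γup) ∧
      ∃ η₁ η₂ : ℝ → ℝ, ClassK η₁ ∧ ClassK η₂ ∧ S.Sandwich r t₀ η₁ η₂) ∧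
    ∀ (c₃ Γlow Γup Bsup ζ ρ : ℝ) (η₁ η₂ : ℝ → ℝ),
      0 ≤ c₃ → 0 < Γlow → 0 < Γup → 0 ≤ Bsup → 0 < ζ → ClassK η₁ → ClassK η₂ →
      (∀ (x : E n) (wc wa : E L) (th : E p),
        stack x wc wa th ∈ Metric.closedBall 0 ζ → x ∈ S.χ) →
      0 < lambdaMin (S.M c₃ Γlow Γup Bsup) →
      0 ≤ ρ → η₁ ρ = η₂ (S.mu c₃ Γlow Γup Bsup) →
      UniformlyUltimatelyBounded (S.compositeTrajectories c₃ Γlow Γup Bsup ζ η₁ η₂) ρ ∧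
      ∀ q ∈ S.compositeTrajectories c₃ Γlow Γup Bsup ζ η₁ η₂,
        limsup (fun t => ((‖q.2 t‖ : ℝ) : EReal)) atTop ≤ (ρ : EReal) := by
  refine ⟨Scheme.forwardInvariant hS, fun r t₀ c₃ Bsup hr => ?_, ?_⟩
  · obtain ⟨Γlow, hlow, Γup, hup, hΓ⟩ := hr.exists_gainBounds hS
    exact ⟨fun t ht => hr.mem_interior hS ht, ⟨Γlow, hlow, Γup, hup, hΓ⟩,
      Scheme.exists_sandwich hS hr.t₀_nonneg hlow hup hΓ⟩
  · intro c₃ Γlow Γup Bsup ζ ρ η₁ η₂ hc₃ hlow hup hB hζ hη₁ hη₂ hball hM hρ hηρ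
    have huub := Scheme.uniformlyUltimatelyBounded hn hS hc₃ hlow hup hB hζ hη₁ hη₂ hball hM
      hρ hηρ
    exact ⟨huub, fun q hq => huub.limsup_norm_le hq⟩

theorem theorem2 {n m L p N : ℕ} (hn : 0 < n) (S : Scheme n m L p N) (hS : S.Assumptions) :
    -- forward invariance of the interior of the safe set
    S.ForwardInvariant ∧
    -- bounds on the gain and comparison functions for the Lyapunov function exist for every run
    (∀ (r : Run n L p) (t₀ c₃ Bsup : ℝ), S.ExcitedRun r t₀ c₃ Bsup →
      (∀ t ≥ t₀, r.x t ∈ interior S.safe) ∧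
      (∃ Γlow > 0, ∃ Γup > 0, r.GainBounds t₀ Γlow Γup) ∧
      ∃ η₁ η₂ : ℝ → ℝ, ClassK η₁ ∧ ClassK η₂ ∧ S.Sandwich r t₀ η₁ η₂) ∧
    -- uniform ultimate boundedness; `s` is `η₁⁻¹(η₂(ζ))` and `ρ` is `η₁⁻¹(η₂(√(2ι/κ)))`
    ∀ (c₃ Γlow Γup Bsup ζ s ρ : ℝ) (η₁ η₂ : ℝ → ℝ),
      0 ≤ c₃ → 0 < Γlow → 0 < Γup → 0 ≤ Bsup → 0 < ζ → ClassK η₁ → ClassK η₂ →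
      (∀ (x : E n) (wc wa : E L) (th : E p),
        stack x wc wa th ∈ Metric.closedBall 0 ζ → x ∈ S.χ) →
      0 < lambdaMin (S.M c₃ Γlow Γup Bsup) →
      0 ≤ s → η₁ s = η₂ ζ → S.mu c₃ Γlow Γup Bsup < s →
      0 ≤ ρ → η₁ ρ = η₂ (S.mu c₃ Γlow Γup Bsup) →
      UniformlyUltimatelyBounded (S.compositeTrajectories c₃ Γlow Γup Bsup ζ η₁ η₂) ρ ∧
      ∀ q ∈ S.compositeTrajectories c₃ Γlow Γup Bsup ζ η₁ η₂,
        limsup (fun t => ((‖q.2 t‖ : ℝ) : EReal)) atTop ≤ (ρ : EReal) := by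
  obtain ⟨hinv, hbounds, huub⟩ := theorem2_general hn S hS.weaken
  exact ⟨hinv, hbounds, fun c₃ Γlow Γup Bsup ζ _ ρ η₁ η₂ hc₃ hlow hup hB hζ h₁ h₂ hball hM _ _ _ =>
    huub c₃ Γlow Γup Bsup ζ ρ η₁ η₂ hc₃ hlow hup hB hζ h₁ h₂ hball hM⟩
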